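/- Let $G=S^3\simeq SU(2)$ be the group of unit quaternions. An almost Hermitian structure on a manifold is a pair $(g,J)$ of a smooth Riemannian metric and a smooth $g$-orthogonal almost complex structure; its Kähler form is $\omega(X,Y)=g(JX,Y)$, and it is nearly Kähler if $(\nabla_XJ)X=0$ for every vector field $X$, where $\nabla$ is the Levi-Civita connection of $g$. A cyclic co-frame on $S^3\times S^3$ is a left-invariant co-frame $(e_1,e_2,e_3,f_1,f_2,f_3)$ such that the $e_i$ vanish on the tangent spaces of the first factor, the $f_i$ on those of the second, and $de_i=e_{i+1}\wedge e_{i+2}$, $df_i=f_{i+1}\wedge f_{i+2}$ (indices modulo $3$). Let $s(h_1,h_2,h_3)=(h_2,h_3,h_1)$ on $G^3$, an automorphism of order $3$ whose fixed point set is the diagonal $\Delta G$, and identify $G^3/\Delta G$ with $S^3\times S^3$ through the projection $\pi(h_1,h_2,h_3)=(h_1h_3^{-1},h_2h_3^{-1})$, so that $G^3$ acts by $(h_1,h_2,h_3)\cdot(x,y)=(h_1xh_3^{-1},h_2yh_3^{-1})$. Let $\mathfrak m=\{v\in\mathfrak g^3 : v+ds(v)+ds^2(v)=0\}$. For an $\mathrm{Ad}(G)$-invariant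 scalar product $q$ on $\mathfrak g$, a Ledger–Obata structure defined by $q$ is a $G^3$-invariant almost Hermitian structure $(g,J)$ on $S^3\times S^3$ which at the base point, under the identification of $\mathfrak m$ with the tangent space by $d\pi$, satisfies $ds|_{\mathfrak m}=-\tfrac12\mathrm{Id}+\tfrac{\sqrt3}{2}J$ and $g=(q\oplus q\oplus q)|_{\mathfrak m}$. Then: 1. $\mathrm{Ad}(G)$-invariant scalar products $q$ exist; for each of them there is exactly one Ledger–Obata structure defined by $q$, and it is a left-invariant nearly Kähler structure on $S^3\times S^3$. 2. The left-invariant nearly Kähler structure on $S^3\times S^3$ is unique up to homothety, sign and change of cyclic co-frame: if $(g,J)$ and $(g',J')$ are two left-invariant nearly Kähler structures on $S^3\times S^3$, there are $a\in S^3\times S^3$, $c>0$ and $\varepsilon\in\{1,-1\}$ such that the conjugation $F(p)=apa^{-1}$ satisfies $F^*g'=c\,g$ and $F^*J'=\varepsilon J$. 3. For every left-invariant nearly Kähler structure $(g,J)$ on $S^3\times S^3$ there are $q$ as above, with Ledger–Obata structure $(g_0,J_0)$, an element $a\in S^3\times S^3$ and $\varepsilon\in\{1,-1\}$ such that $F(p)=apa^{-1}$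 satisfies $F^*g_0=g$ and $F^*J_0=\varepsilon J$. 4. The Kähler form of every left-invariant nearly Kähler structure on $S^3\times S^3$ can be written, in some cyclic co-frame, as $\omega=\pm\lambda(e_1\wedge f_1+e_2\wedge f_2+e_3\wedge f_3)$ with $\lambda>0$. Conversely, for every cyclic co-frame and every real $c\ne0$ there is exactly one left-invariant nearly Kähler structure with Kähler form $c(e_1\wedge f_1+e_2\wedge f_2+e_3\wedge f_3)$. -/

import Mathlib

open scoped Manifold ContDiff Quaternion

noncomputable section

namespace NearlyKahler

/-! ### Almost Hermitian structures and nearly Kähler manifolds -/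

section General

variable {E : Type*} [NormedAddCommGroup E] [NormedSpace ℝ E]
  {H : Type*} [TopologicalSpace H] (I : ModelWithCorners ℝ E H)
  (M : Type*) [TopologicalSpace M] [ChartedSpace H M] [IsManifold I ∞ M]

/-- A smooth almost Hermitian structure `(g, J)` on the manifold `M`: a smooth Riemannian metric
`g` and a smooth field `J` of `g`-orthogonal endomorphisms of the tangent spaces with
`J ^ 2 = -1`. -/
structure AlmostHermitian where
  /-- the Riemannian metric -/
  g : Bundle.ContMDiffRiemannianMetric I ∞ E (TangentSpace I : M → Type _)
  /-- the almost complex structure -/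
  J : ∀ p : M, TangentSpace I p →L[ℝ] TangentSpace I p
  contMDiff_J : ContMDiff I (I.prod 𝓘(ℝ, E →L[ℝ] E)) ∞
    (fun p ↦ Bundle.TotalSpace.mk' (E →L[ℝ] E)
      (E := fun q : M ↦ TangentSpace I q →L[ℝ] TangentSpace I q) p (J p))
  J_sq : ∀ (p : M) (u : TangentSpace I p), J p (J p u) = -u
  compat : ∀ (p : M) (u v : TangentSpace I p), g.inner p (J p u) (J p v) = g.inner p u v

variable {I M}

/-- Smooth vector fields on `M`. -/
def IsSmoothField (X : ∀ p : M, TangentSpace I p) : Prop :=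
  ContMDiff I I.tangent ∞ (fun p ↦ (⟨p, X p⟩ : TangentBundle I M))

/-- The Kähler form `ω(u, v) = g(J u, v)`. -/
def AlmostHermitian.kahlerForm (S : AlmostHermitian I M) (p : M) (u v : TangentSpace I p) : ℝ :=
  S.g.inner p (S.J p u) v

/-- `∇` is the Levi-Civita connection of `g`: it is torsion-free and
`d(g(Y, Z)) = g(∇ Y, Z) + g(Y, ∇ Z)`. (The covariant derivative `∇_v Y` at the point `p`
is written `∇ Y p v`.) -/
def IsLeviCivita [FiniteDimensional ℝ E] [IsManifold I 2 M]
    (g : Bundle.ContMDiffRiemannianMetric I ∞ E (TangentSpace I : M → Type _))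
    (nabla : CovariantDerivative I E (TangentSpace I : M → Type _)) : Prop :=
  haveI : CompleteSpace E := FiniteDimensional.complete ℝ E
  nabla.torsion = 0 ∧
  ∀ (Y Z : ∀ p : M, TangentSpace I p), IsSmoothField Y → IsSmoothField Z →
    ∀ (p : M) (v : TangentSpace I p),
      mvfderiv I (fun q ↦ g.inner q (Y q) (Z q)) p v =
        g.inner p (nabla Y p v) (Z p) + g.inner p (Y p) (nabla Z p v)

/-- `(g, J)` is nearly Kähler: `(∇_X J) X = 0`, that is `∇_X (J X) = J (∇_X X)`, for every
smooth vector field `X`, where `∇` is the Levi-Civita connection of `g`. -/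
def AlmostHermitian.IsNearlyKahler [FiniteDimensional ℝ E] [IsManifold I 2 M]
    (S : AlmostHermitian I M) : Prop :=
  ∃ nabla : CovariantDerivative I E (TangentSpace I : M → Type _),
    IsLeviCivita S.g nabla ∧
    ∀ X : ∀ p : M, TangentSpace I p, IsSmoothField X → ∀ p : M,
      nabla (fun q ↦ S.J q (X q)) p (X p) = S.J p (nabla X p (X p))

/-- The map `F : M → M` satisfies `F^* g' = c g` and `F^* J' = ε J`, where `(g, J)` and
`(g', J')` are the structures `S` and `S'`. -/
def Relates (F : M → M) (c ε : ℝ) (S S' : AlmostHermitian I M) : Prop :=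
  ∀ (p : M) (u v : TangentSpace I p),
    S'.g.inner (F p) (mfderiv I I F p u) (mfderiv I I F p v) = c * S.g.inner p u v ∧
    S'.J (F p) (mfderiv I I F p u) = ε • mfderiv I I F p (S.J p u)

/-- Left-invariant almost Hermitian structures on a group: all left translations preserve
`g` and `J`. -/
def AlmostHermitian.IsLeftInvariant [Group M] (S : AlmostHermitian I M) : Prop :=
  ∀ a : M, Relates (fun p ↦ a * p) 1 1 S S

/-- The exterior derivative of a `1`-form, evaluated on two smooth vector fields:
`dα(X, Y) = X(α(Y)) - Y(α(X)) - α([X, Y])`. -/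
def extDerivOneForm (α : ∀ p : M, TangentSpace I p →L[ℝ] ℝ) (X Y : ∀ p : M, TangentSpace I p)
    (p : M) : ℝ :=
  mvfderiv I (fun q ↦ α q (Y q)) p (X p) - mvfderiv I (fun q ↦ α q (X q)) p (Y p)
    - α p (VectorField.mlieBracket I X Y p)

/-- The wedge product of two covectors, `(α ∧ β)(u, v) = α(u) β(v) - α(v) β(u)`. -/
def wedge {V : Type*} [TopologicalSpace V] [AddCommGroup V] [Module ℝ V] (α β : V →L[ℝ] ℝ)
    (u v : V) : ℝ :=
  α u * β v - α v * β u

end General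

/-! ### The Lie group `S³` -/

instance : Fact (Module.finrank ℝ ℍ = 3 + 1) := ⟨by rw [Quaternion.finrank_eq_four]⟩

/-- The group `S³ ≃ SU(2)` of unit quaternions. -/
abbrev S3 : Type := Metric.sphere (0 : ℍ) 1

/-- `S³` is a Lie group. -/
instance : LieGroup (𝓡 3) ∞ S3 where
  contMDiff_mul := by
    apply ContMDiff.codRestrict_sphere
    let c : S3 → ℍ := (↑)
    have h₂ : ContMDiff (𝓘(ℝ, ℍ).prod 𝓘(ℝ, ℍ)) 𝓘(ℝ, ℍ) ∞ fun z : ℍ × ℍ => z.fst * z.snd := by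
      rw [contMDiff_iff]
      exact ⟨continuous_mul, fun x y => contDiff_mul.contDiffOn⟩
    suffices h₁ : ContMDiff _ _ _ (Prod.map c c) from
      h₂.comp h₁
    apply ContMDiff.prodMap <;> exact contMDiff_coe_sphere
  contMDiff_inv := by
    have hs : ∀ x : S3, ((x⁻¹ : S3) : ℍ) = star (x : ℍ) := by
      intro x
      have h1 : Quaternion.normSq (x : ℍ) = 1 := by
        rw [Quaternion.normSq_eq_norm_mul_self, norm_eq_of_mem_sphere, mul_one]
      change (x : ℍ)⁻¹ = _
      rw [Quaternion.inv_def, h1]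
      simp
    let st : ℍ →ₗ[ℝ] ℍ :=
      { toFun := star
        map_add' := star_add
        map_smul' := fun r x ↦ Quaternion.star_smul r x }
    have h₂ : ContMDiff (𝓡 3) 𝓘(ℝ, ℍ) ∞ fun x : S3 ↦ star (x : ℍ) :=
      (LinearMap.toContinuousLinearMap st).contDiff.contMDiff.comp contMDiff_coe_sphere
    exact (h₂.congr hs).codRestrict_sphere _

/-- The model of `S³ × S³`. -/
abbrev I2 := (𝓡 3).prod (𝓡 3)

/-- The model of `S³ × S³ × S³`. -/
abbrev I3 := (𝓡 3).prod ((𝓡 3).prod (𝓡 3))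

/-! ### Cyclic co-frames -/

/-- Cyclic co-frames `(e₁, e₂, e₃, f₁, f₂, f₃)` of `S³ × S³` (with indices in `ℤ/3`). -/
structure IsCyclicCoframe (e f : Fin 3 → ∀ p : S3 × S3, TangentSpace I2 p →L[ℝ] ℝ) : Prop where
  /-- the six forms are a basis of each cotangent space -/
  coframe : ∀ p, LinearIndependent ℝ (Sum.elim (fun i ↦ e i p) (fun i ↦ f i p))
  /-- the forms are left-invariant -/
  invariant_e : ∀ i (a p : S3 × S3) (u : TangentSpace I2 p),
    e i (a * p) (mfderiv I2 I2 (fun q ↦ a * q) p u) = e i p u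
  invariant_f : ∀ i (a p : S3 × S3) (u : TangentSpace I2 p),
    f i (a * p) (mfderiv I2 I2 (fun q ↦ a * q) p u) = f i p u
  /-- the `e i` vanish on the tangent spaces of the first factor, the `f i` on those of the
  second factor -/
  vanish_e : ∀ i (p : S3 × S3) (u : TangentSpace I2 p),
    mfderiv I2 (𝓡 3) Prod.snd p u = 0 → e i p u = 0
  vanish_f : ∀ i (p : S3 × S3) (u : TangentSpace I2 p),
    mfderiv I2 (𝓡 3) Prod.fst p u = 0 → f i p u = 0
  /-- `d e i = e (i + 1) ∧ e (i + 2)` and `d f i = f (i + 1) ∧ f (i + 2)` -/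
  deriv_e : ∀ i (X Y : ∀ p : S3 × S3, TangentSpace I2 p), IsSmoothField X → IsSmoothField Y →
    ∀ p, extDerivOneForm (e i) X Y p = wedge (e (i + 1) p) (e (i + 2) p) (X p) (Y p)
  deriv_f : ∀ i (X Y : ∀ p : S3 × S3, TangentSpace I2 p), IsSmoothField X → IsSmoothField Y →
    ∀ p, extDerivOneForm (f i) X Y p = wedge (f (i + 1) p) (f (i + 2) p) (X p) (Y p)

/-- The Kähler form of `S` is `c (e₁ ∧ f₁ + e₂ ∧ f₂ + e₃ ∧ f₃)`. -/
def HasDiagonalKahlerForm (S : AlmostHermitian I2 (S3 × S3))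
    (e f : Fin 3 → ∀ p : S3 × S3, TangentSpace I2 p →L[ℝ] ℝ) (c : ℝ) : Prop :=
  ∀ (p : S3 × S3) (u v : TangentSpace I2 p),
    S.kahlerForm p u v = c * ∑ i, wedge (e i p) (f i p) u v

/-! ### The 3-symmetric space of Ledger and Obata

The group `G = S³ × S³ × S³` has the automorphism `s(h₁, h₂, h₃) = (h₂, h₃, h₁)`, whose fixed
points are the diagonal `Δ`. The space `G / Δ` is identified with `S³ × S³`, the
class of `(x, y, 1)` corresponding to `(x, y)`. -/

/-- The automorphism `s` of `S³ × S³ × S³`. -/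
def cyclicAut : (S3 × S3 × S3) ≃* (S3 × S3 × S3) where
  toFun h := (h.2.1, h.2.2, h.1)
  invFun h := (h.2.2, h.1, h.2.1)
  left_inv _ := rfl
  right_inv _ := rfl
  map_mul' _ _ := rfl

/-- The diagonal subgroup. -/
def diagonalSubgroup : Subgroup (S3 × S3 × S3) :=
  ((MonoidHom.id S3).prod ((MonoidHom.id S3).prod (MonoidHom.id S3))).range

/-- The projection `G → G / Δ = S³ × S³`. -/
def quotientProj (h : S3 × S3 × S3) : S3 × S3 := (h.1 * h.2.2⁻¹, h.2.1 * h.2.2⁻¹)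

/-- The action of `G` on `G / Δ = S³ × S³`. -/
def groupAct (h : S3 × S3 × S3) (p : S3 × S3) : S3 × S3 :=
  (h.1 * p.1 * h.2.2⁻¹, h.2.1 * p.2 * h.2.2⁻¹)

theorem cyclicAut_order : orderOf cyclicAut = 3 := by
  have h1 : cyclicAut ^ 3 = 1 := by ext h <;> rfl
  have h2 : cyclicAut ≠ 1 := by
    intro h
    have h3 := congrArg (fun t : (S3 × S3 × S3) ≃* (S3 × S3 × S3) ↦
      (((t (-1, 1, 1)).1 : S3) : ℍ).re) h
    simp [cyclicAut] at h3
    norm_num at h3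
  exact orderOf_eq_prime h1 h2

theorem cyclicAut_fixed_iff (h : S3 × S3 × S3) : cyclicAut h = h ↔ h ∈ diagonalSubgroup := by
  obtain ⟨a, b, c⟩ := h
  simp only [cyclicAut, diagonalSubgroup, MulEquiv.coe_mk, Equiv.coe_fn_mk, Prod.mk.injEq,
    MonoidHom.mem_range, MonoidHom.prod_apply, MonoidHom.id_apply]
  constructor
  · rintro ⟨rfl, rfl, -⟩
    exact ⟨_, rfl, rfl, rfl⟩
  · rintro ⟨x, rfl, rfl, rfl⟩
    exact ⟨rfl, rfl, rfl⟩

theorem quotientProj_eq_iff (h k : S3 × S3 × S3) :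
    quotientProj h = quotientProj k ↔ h⁻¹ * k ∈ diagonalSubgroup := by
  rw [← cyclicAut_fixed_iff]
  obtain ⟨a, b, c⟩ := h
  obtain ⟨a', b', c'⟩ := k
  have key : ∀ x x' y y' : S3, x * y⁻¹ = x' * y'⁻¹ ↔ x⁻¹ * x' = y⁻¹ * y' := by
    intro x x' y y'
    rw [mul_inv_eq_iff_eq_mul, inv_mul_eq_iff_eq_mul]
    constructor
    · rintro rfl
      group
    · rintro rfl
      group
  simp only [cyclicAut, quotientProj, MulEquiv.coe_mk, Equiv.coe_fn_mk, Prod.mk.injEq,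
    Prod.inv_mk, Prod.mk_mul_mk, key]
  constructor
  · rintro ⟨h1, h2⟩
    exact ⟨h2.trans h1.symm, h2.symm, h1⟩
  · rintro ⟨h1, h2, h3⟩
    exact ⟨h3, h2.symm⟩

theorem quotientProj_mul (h k : S3 × S3 × S3) :
    quotientProj (h * k) = groupAct h (quotientProj k) := by
  simp [quotientProj, groupAct, mul_assoc]

/-- The derivative `ds` of the automorphism `s` on the Lie algebra `T₁ G`. -/
def dCyclicAut (v : TangentSpace I3 (1 : S3 × S3 × S3)) : TangentSpace I3 (1 : S3 × S3 × S3) :=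
  mfderiv I3 I3 cyclicAut 1 v

/-- The complement `𝔪` of the fixed space of `ds` in `T₁ G`: the real part of the sum of the
eigenspaces of `ds` for the two primitive cubic roots of unity. -/
def mSpace : Set (TangentSpace I3 (1 : S3 × S3 × S3)) :=
  {v | v + dCyclicAut v + dCyclicAut (dCyclicAut v) = 0}

/-- `q` is an `Ad`-invariant scalar product on the Lie algebra of `S³`. -/
structure IsAdInvariantInner
    (q : TangentSpace (𝓡 3) (1 : S3) →L[ℝ] TangentSpace (𝓡 3) (1 : S3) →L[ℝ] ℝ) : Prop where
  symm : ∀ u v, q u v = q v u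
  pos : ∀ u, u ≠ 0 → 0 < q u u
  adInvariant : ∀ (h : S3) (u v : TangentSpace (𝓡 3) (1 : S3)),
    q (mfderiv (𝓡 3) (𝓡 3) (fun x : S3 ↦ h * x * h⁻¹) 1 u)
      (mfderiv (𝓡 3) (𝓡 3) (fun x : S3 ↦ h * x * h⁻¹) 1 v) = q u v

/-- `S` is the canonical almost Hermitian structure of the 3-symmetric space `G / Δ`, defined
by the `Ad`-invariant scalar product `q`: it is invariant under `G`; at the base point, where
the derivative of the projection identifies `𝔪` with the tangent space, the restriction of `ds`
to `𝔪` is `-1/2 + (√3/2) J`, and the metric is the restriction of `q ⊕ q ⊕ q` to `𝔪`. -/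
structure IsLedgerObata
    (q : TangentSpace (𝓡 3) (1 : S3) →L[ℝ] TangentSpace (𝓡 3) (1 : S3) →L[ℝ] ℝ)
    (S : AlmostHermitian I2 (S3 × S3)) : Prop where
  invariant : ∀ h : S3 × S3 × S3, Relates (groupAct h) 1 1 S S
  complex : ∀ v ∈ mSpace,
    mfderiv I3 I2 quotientProj 1 (dCyclicAut v) =
      (-(1 / 2) : ℝ) • mfderiv I3 I2 quotientProj 1 v
        + (√3 / 2) • S.J (quotientProj 1) (mfderiv I3 I2 quotientProj 1 v)
  metric : ∀ v ∈ mSpace, ∀ w ∈ mSpace,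
    S.g.inner (quotientProj 1) (mfderiv I3 I2 quotientProj 1 v)
        (mfderiv I3 I2 quotientProj 1 w) =
      q v.1 w.1 + q v.2.1 w.2.1 + q v.2.2 w.2.2

end NearlyKahler

end

open scoped Manifold ContDiff Quaternion

noncomputable section

namespace NearlyKahler

/-! ### Imaginary quaternions and the adjoint representation -/

/-! Left translations trivialise the tangent bundle of `S³ × S³`. A left-invariant almost Hermitian
structure is therefore a pair `(q, j)` on the Lie algebra `R33`, two copies of `ℝ³` with the cross
product (`HermData`). Conjugations act on it through `Ad2`, that is, by a pair of rotations, and the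
Koszul formula turns the nearly Kähler condition into an algebraic identity
(`HermData.isNearlyKahler_iff`).

For a nearly Kähler structure the tensor `T(u, v, w) = ⟨(∇_u J) v, w⟩` is totally skew, so it equals
a third of its cyclic sum, `-rho / 3`, where `rho = -dω`. Since `∇J` anticommutes with `J`, the form
`rho` allows `J` to move freely from one argument to another. The Kähler form has a mixed part,
which is a 3 × 3 matrix, and one pure part on each factor. Every invariant 2-form on `S³` is closed,
so `rho` depends on the mixed part alone. A singular value decomposition by rotations
(`exists_svd_Ad_sorted`) makes the mixed part diagonal with entries `l i` of a common sign.

If some `l i` vanished, either `ω` would be degenerate or `J` would have a real eigenvector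
(`HermData.IsNK.diag_ne_zero`). Once all `l i` are nonzero, the vectors `p` with `rho(e_i, p, ·) =
0` fill the plane of `e_i` and `f_i`, and `J e_i` is such a vector; hence `J` preserves three
coordinate planes. The linear relations obtained by moving `J`, together with the quadratic ones
contained in `3 T = -rho`, then force the three blocks to coincide (`HermData.IsNK.exists_scalar`).
Only a scale `k > 0` and the sign of `s`, with `s² = 1/3`, remain: up to conjugation the structure
is `stdData k s`.

The claims follow from this normal form. Homothety and sign are the ratios of the parameters; the
Ledger–Obata structures are the `stdData` with `s = 1/√3`, because invariant scalar products on `ℝ³`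
are multiples of the dot product; cyclic co-frames correspond to pairs of rotations; and a diagonal
Kähler form determines the product `k s`, hence `k` and `s`. -/

/-- The model of the Lie algebra of `S³`, with the cross product as bracket. -/
abbrev R3 : Type := Fin 3 → ℝ

/-- The quaternion with given components. -/
def mkQ (a b c d : ℝ) : ℍ := ⟨a, b, c, d⟩

@[simp] theorem re_mkQ (a b c d : ℝ) : (mkQ a b c d).re = a := rfl
@[simp] theorem imI_mkQ (a b c d : ℝ) : (mkQ a b c d).imI = b := rfl
@[simp] theorem imJ_mkQ (a b c d : ℝ) : (mkQ a b c d).imJ = c := rfl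
@[simp] theorem imK_mkQ (a b c d : ℝ) : (mkQ a b c d).imK = d := rfl

/-- The embedding of `R3` as imaginary quaternions, normalised such that the commutator corresponds
to the cross product. -/
def imQ : R3 →L[ℝ] ℍ := LinearMap.toContinuousLinearMap
  { toFun := fun x ↦ mkQ 0 (x 0 / 2) (x 1 / 2) (x 2 / 2)
    map_add' := fun x y ↦ by ext <;> simp <;> ring
    map_smul' := fun c x ↦ by ext <;> simp <;> ring }

/-- The coordinates of the imaginary part, a left inverse of `imQ`. -/
def coordQ : ℍ →L[ℝ] R3 := LinearMap.toContinuousLinearMap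
  { toFun := fun z ↦ ![2 * z.imI, 2 * z.imJ, 2 * z.imK]
    map_add' := fun x y ↦ by ext i; fin_cases i <;> simp <;> ring
    map_smul' := fun c x ↦ by ext i; fin_cases i <;> simp <;> ring }

theorem imQ_apply (x : R3) : imQ x = mkQ 0 (x 0 / 2) (x 1 / 2) (x 2 / 2) := rfl

theorem coordQ_apply (z : ℍ) : coordQ z = ![2 * z.imI, 2 * z.imJ, 2 * z.imK] := rfl

@[simp] theorem re_imQ (x : R3) : (imQ x).re = 0 := rfl

@[simp] theorem coordQ_imQ (x : R3) : coordQ (imQ x) = x := by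
  ext i; fin_cases i <;> simp [imQ_apply, coordQ_apply] <;> ring

theorem imQ_coordQ {z : ℍ} (hz : z.re = 0) : imQ (coordQ z) = z := by
  ext <;> simp [imQ_apply, coordQ_apply, hz]

theorem imQ_injective : Function.Injective imQ := Function.LeftInverse.injective coordQ_imQ

open Matrix in
theorem imQ_cross (x y : R3) : imQ (x ⨯₃ y) = imQ x * imQ y - imQ y * imQ x := by
  ext <;> simp [imQ_apply, cross_apply] <;> ring

theorem normSq_S3 (h : S3) : Quaternion.normSq (h : ℍ) = 1 := by
  rw [Quaternion.normSq_eq_norm_mul_self, norm_eq_of_mem_sphere, mul_one]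

theorem S3_eq_one (h : S3) :
    (h : ℍ).re ^ 2 + (h : ℍ).imI ^ 2 + (h : ℍ).imJ ^ 2 + (h : ℍ).imK ^ 2 = 1 := by
  rw [← Quaternion.normSq_def', normSq_S3]

@[simp] theorem star_mul_self_S3 (h : S3) : star (h : ℍ) * h = 1 := by
  rw [Quaternion.star_mul_self, normSq_S3]; simp

@[simp] theorem self_mul_star_S3 (h : S3) : (h : ℍ) * star (h : ℍ) = 1 := by
  rw [Quaternion.self_mul_star, normSq_S3]; simp

theorem coe_inv_S3 (h : S3) : ((h⁻¹ : S3) : ℍ) = star (h : ℍ) := by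
  change (h : ℍ)⁻¹ = _
  rw [Quaternion.inv_def, normSq_S3]
  simp

theorem coe_mul_S3 (g h : S3) : ((g * h : S3) : ℍ) = g * h := rfl

/-- The adjoint representation of `S³`. -/
def Ad (h : S3) : R3 →L[ℝ] R3 :=
  coordQ ∘L ((ContinuousLinearMap.mul ℝ ℍ) h) ∘L
    ((ContinuousLinearMap.mul ℝ ℍ).flip (star (h : ℍ))) ∘L imQ

theorem Ad_apply (h : S3) (x : R3) : Ad h x = coordQ (h * (imQ x * star (h : ℍ))) := rfl

theorem re_conj (h : ℍ) {z : ℍ} (hz : z.re = 0) : (h * (z * star h)).re = 0 := by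
  simp [hz]; ring

theorem imQ_Ad (h : S3) (x : R3) : imQ (Ad h x) = h * (imQ x * star (h : ℍ)) := by
  rw [Ad_apply, imQ_coordQ (re_conj _ (re_imQ x))]

@[simp] theorem Ad_one (x : R3) : Ad 1 x = x := by
  apply imQ_injective
  rw [imQ_Ad]
  change (1 : ℍ) * (_ * star (1 : ℍ)) = _
  simp

theorem Ad_mul (g h : S3) (x : R3) : Ad (g * h) x = Ad g (Ad h x) := by
  apply imQ_injective
  simp only [imQ_Ad, coe_mul_S3, star_mul, mul_assoc]

@[simp] theorem Ad_inv_Ad (h : S3) (x : R3) : Ad h⁻¹ (Ad h x) = x := by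
  rw [← Ad_mul]; simp

@[simp] theorem Ad_Ad_inv (h : S3) (x : R3) : Ad h (Ad h⁻¹ x) = x := by
  rw [← Ad_mul]; simp

open Matrix in
theorem Ad_cross (h : S3) (x y : R3) : Ad h (x ⨯₃ y) = Ad h x ⨯₃ Ad h y := by
  apply imQ_injective
  have key : ∀ a b : ℍ, (h * (a * star (h : ℍ))) * (h * (b * star (h : ℍ))) =
      h * (a * b * star (h : ℍ)) := fun a b ↦ by
    calc _ = h * (a * ((star (h : ℍ) * h) * (b * star (h : ℍ)))) := by simp only [mul_assoc]
      _ = _ := by rw [star_mul_self_S3, one_mul, mul_assoc]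
  rw [imQ_cross, imQ_Ad, imQ_cross, imQ_Ad, imQ_Ad, key, key, sub_mul, mul_sub]

open Matrix in
theorem re_imQ_mul (x y : R3) : (imQ x * imQ y).re = -(x ⬝ᵥ y) / 4 := by
  simp [imQ_apply, dotProduct, Fin.sum_univ_three]; ring

open Matrix in
theorem Ad_dot (h : S3) (x y : R3) : Ad h x ⬝ᵥ Ad h y = x ⬝ᵥ y := by
  have key : (imQ (Ad h x) * imQ (Ad h y)).re = (imQ x * imQ y).re := by
    rw [imQ_Ad, imQ_Ad]
    have : (h * (imQ x * star (h : ℍ))) * (h * (imQ y * star (h : ℍ))) =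
        h * ((imQ x * imQ y) * star (h : ℍ)) := by
      calc _ = h * (imQ x * ((star (h : ℍ) * h) * (imQ y * star (h : ℍ)))) := by
            simp only [mul_assoc]
        _ = _ := by rw [star_mul_self_S3, one_mul, mul_assoc]
    rw [this]
    set z := imQ x * imQ y
    have hh := S3_eq_one h
    simp
    linear_combination z.re * hh
  rw [re_imQ_mul, re_imQ_mul] at key
  linarith

/-- The adjoint representation is onto the rotation group. -/
theorem exists_Ad_eq {a b c : ℍ} (ha : a * a = -1) (hb : b * b = -1) (hab : a * b = c)
    (hba : b * a = -c) (hra : a.re = 0) (hrb : b.re = 0) (hrc : c.re = 0) :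
    ∃ h : S3, (h : ℍ) * mkQ 0 1 0 0 = a * h ∧ (h : ℍ) * mkQ 0 0 1 0 = b * h := by
  have hac : a * c = -b := by rw [← hab, ← mul_assoc, ha]; simp
  have hbc : b * c = a := by
    rw [← neg_neg c, ← hba, mul_neg, ← mul_assoc, hb]; simp
  let i : ℍ := mkQ 0 1 0 0
  let j : ℍ := mkQ 0 0 1 0
  let k : ℍ := mkQ 0 0 0 1
  have hii : i * i = -1 := by ext <;> simp [i]
  have hjj : j * j = -1 := by ext <;> simp [j]
  have hij : i * j = k := by ext <;> simp [i, j, k]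
  have hji : j * i = -k := by ext <;> simp [i, j, k]
  have hki : k * i = j := by ext <;> simp [i, j, k]
  have hkj : k * j = -i := by ext <;> simp [i, j, k]
  -- Averaging over the quaternion units: since the units have inverse `-i`, `-j`, `-k`, the sum of
  -- `x`, `a x i⁻¹`, `b x j⁻¹`, `c x k⁻¹` intertwines right multiplication by `i`, `j` with left
  -- multiplication by `a`, `b`.
  let T : ℍ → ℍ := fun x ↦ x - a * x * i - b * x * j - c * x * k
  have hTi : ∀ x, T x * i = a * T x := fun x ↦ by
    simp only [T, sub_mul, mul_sub, mul_assoc, hii, hji, hki]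
    simp only [← mul_assoc, ha, hab, hac]
    simp only [mul_neg, neg_mul, mul_one, one_mul]
    abel
  have hTj : ∀ x, T x * j = b * T x := fun x ↦ by
    simp only [T, sub_mul, mul_sub, mul_assoc, hij, hjj, hkj]
    simp only [← mul_assoc, hb, hba, hbc]
    simp only [mul_neg, neg_mul, mul_one, one_mul]
    abel
  obtain ⟨x, hx⟩ : ∃ x, T x ≠ 0 := by
    by_contra! H
    -- These are the diagonal entries of the linear map `T`. Their sum, the trace, is 4, since `x ↦
    -- a x i` and its analogues have trace zero when `a`, `b`, `c` are imaginary.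
    have h1 := congrArg (·.re) (H 1)
    have h2 := congrArg (·.imI) (H i)
    have h3 := congrArg (·.imJ) (H j)
    have h4 := congrArg (·.imK) (H k)
    simp [T, i, j, k, hra, hrb, hrc] at h1 h2 h3 h4
    linarith
  have hn : ‖T x‖ ≠ 0 := norm_ne_zero_iff.2 hx
  refine ⟨⟨(‖T x‖)⁻¹ • T x, ?_⟩, ?_, ?_⟩
  · simp [norm_smul, hn]
  · change (‖T x‖⁻¹ • T x) * i = _ * (‖T x‖⁻¹ • T x)
    rw [smul_mul_assoc, mul_smul_comm, hTi x]
  · change (‖T x‖⁻¹ • T x) * j = _ * (‖T x‖⁻¹ • T x)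
    rw [smul_mul_assoc, mul_smul_comm, hTj x]

/-! ### The Maurer-Cartan form of `S³` -/

/-- The derivative of the inclusion of `S³` in the quaternions. -/
def dCoe (h : S3) : TangentSpace (𝓡 3) h →L[ℝ] ℍ :=
  mvfderiv (𝓡 3) (fun x : S3 ↦ (x : ℍ)) h

/-- The Maurer-Cartan form of `S³`. -/
def mc (h : S3) : TangentSpace (𝓡 3) h →L[ℝ] R3 :=
  coordQ ∘L (ContinuousLinearMap.mul ℝ ℍ (star (h : ℍ))) ∘L dCoe h

theorem mc_apply (h : S3) (u : TangentSpace (𝓡 3) h) : mc h u = coordQ (star (h : ℍ) * dCoe h u) :=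
  rfl

theorem re_star_mul (h z : ℍ) : (star h * z).re = inner ℝ h z := by
  simp [Quaternion.inner_def]

theorem range_dCoe (h : S3) : (dCoe h).range = (ℝ ∙ (h : ℍ))ᗮ := range_mvfderiv_subtypeVal h

theorem dCoe_injective (h : S3) : Function.Injective (dCoe h) :=
  injective_mvfderiv_subtypeVal_sphere h

theorem re_star_mul_dCoe (h : S3) (u : TangentSpace (𝓡 3) h) :
    (star (h : ℍ) * dCoe h u).re = 0 := by
  have : dCoe h u ∈ (ℝ ∙ (h : ℍ))ᗮ := range_dCoe h ▸ ⟨u, rfl⟩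
  rw [re_star_mul]
  exact Submodule.mem_orthogonal_singleton_iff_inner_right.1 this

theorem imQ_mc (h : S3) (u : TangentSpace (𝓡 3) h) : imQ (mc h u) = star (h : ℍ) * dCoe h u := by
  rw [mc_apply, imQ_coordQ (re_star_mul_dCoe h u)]

theorem dCoe_eq (h : S3) (u : TangentSpace (𝓡 3) h) : dCoe h u = h * imQ (mc h u) := by
  rw [imQ_mc, ← mul_assoc, self_mul_star_S3, one_mul]

theorem mc_eq_iff (h : S3) (u : TangentSpace (𝓡 3) h) (x : R3) :
    mc h u = x ↔ dCoe h u = h * imQ x := by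
  constructor
  · rintro rfl
    exact dCoe_eq h u
  · intro H
    apply imQ_injective
    rw [imQ_mc, H, ← mul_assoc, star_mul_self_S3, one_mul]

theorem mc_injective (h : S3) : Function.Injective (mc h) := by
  intro u v huv
  apply dCoe_injective h
  rw [dCoe_eq, dCoe_eq, huv]

theorem mc_surjective (h : S3) : Function.Surjective (mc h) := by
  intro x
  have : (h : ℍ) * imQ x ∈ (dCoe h).range := by
    rw [range_dCoe, Submodule.mem_orthogonal_singleton_iff_inner_right, ← re_star_mul,
      ← mul_assoc, star_mul_self_S3, one_mul, re_imQ]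
  obtain ⟨u, hu⟩ := this
  exact ⟨u, (mc_eq_iff h u x).2 hu⟩

section Calculus

variable {E : Type*} [NormedAddCommGroup E] [NormedSpace ℝ E]
  {H : Type*} [TopologicalSpace H] {I : ModelWithCorners ℝ E H}
  {M : Type*} [TopologicalSpace M] [ChartedSpace H M]

theorem mdifferentiableAt_coe_S3 (h : S3) :
    MDifferentiableAt (𝓡 3) 𝓘(ℝ, ℍ) (fun x : S3 ↦ (x : ℍ)) h :=
  (contMDiff_coe_sphere (m := 1)).mdifferentiableAt one_ne_zero

theorem dCoe_mfderiv {F : M → S3} {p : M} (hF : MDifferentiableAt I (𝓡 3) F p)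
    (u : TangentSpace I p) :
    dCoe (F p) (mfderiv I (𝓡 3) F p u) = mvfderiv I (fun q ↦ (F q : ℍ)) p u := by
  have := mfderiv_comp p (mdifferentiableAt_coe_S3 (F p)) hF
  have h2 := congrArg (fun L ↦ L u) this
  exact h2.symm

theorem mdifferentiableAt_mul_S3 {F G : M → S3} {p : M} (hF : MDifferentiableAt I (𝓡 3) F p)
    (hG : MDifferentiableAt I (𝓡 3) G p) : MDifferentiableAt I (𝓡 3) (fun q ↦ F q * G q) p :=
  ((contMDiff_mul (𝓡 3) ∞ (G := S3)).mdifferentiableAt (by simp)).comp p (hF.prodMk hG)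

theorem mdifferentiableAt_inv_S3 {F : M → S3} {p : M} (hF : MDifferentiableAt I (𝓡 3) F p) :
    MDifferentiableAt I (𝓡 3) (fun q ↦ (F q)⁻¹) p :=
  ((contMDiff_inv (𝓡 3) ∞ (G := S3)).mdifferentiableAt (by simp)).comp p hF

/-- The Leibniz rule in the quaternions, translated back to the identity by `(F G)⁻¹`: the term `dF
· G` is conjugated by `G`, the term `F · dG` is not. -/
theorem mc_mfderiv_mul {F G : M → S3} {p : M} (hF : MDifferentiableAt I (𝓡 3) F p)
    (hG : MDifferentiableAt I (𝓡 3) G p) (u : TangentSpace I p) :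
    mc (F p * G p) (mfderiv I (𝓡 3) (fun q ↦ F q * G q) p u) =
      Ad (G p)⁻¹ (mc (F p) (mfderiv I (𝓡 3) F p u)) + mc (G p) (mfderiv I (𝓡 3) G p u) := by
  rw [mc_eq_iff, dCoe_mfderiv (mdifferentiableAt_mul_S3 hF hG)]
  have hF' : MDifferentiableAt I 𝓘(ℝ, ℍ) (fun q ↦ (F q : ℍ)) p :=
    (mdifferentiableAt_coe_S3 _).comp p hF
  have hG' : MDifferentiableAt I 𝓘(ℝ, ℍ) (fun q ↦ (G q : ℍ)) p :=
    (mdifferentiableAt_coe_S3 _).comp p hG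
  have key : mvfderiv I (fun q ↦ ((F q * G q : S3) : ℍ)) p u =
      (F p : ℍ) * mvfderiv I (fun q ↦ (G q : ℍ)) p u +
        mvfderiv I (fun q ↦ (F q : ℍ)) p u * (G p : ℍ) := by
    have := (hF'.hasMFDerivAt.mul' hG'.hasMFDerivAt).mfderiv
    exact congrArg (fun L ↦ L u) this
  rw [key, ← dCoe_mfderiv hF, ← dCoe_mfderiv hG, dCoe_eq, dCoe_eq, map_add, imQ_Ad, coe_inv_S3,
    star_star, coe_mul_S3, mul_add, add_comm]
  congr 1
  · simp only [mul_assoc]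
    rw [← mul_assoc (G p : ℍ) (star (G p : ℍ)), self_mul_star_S3, one_mul]
  · simp only [mul_assoc]

theorem mc_mfderiv_const (h : S3) (p : M) (u : TangentSpace I p) :
    mc h (mfderiv I (𝓡 3) (fun _ : M ↦ h) p u) = 0 := by
  rw [mfderiv_const]
  exact map_zero _

/-- Obtained by differentiating `F F⁻¹ = 1` with the product rule. -/
theorem mc_mfderiv_inv {F : M → S3} {p : M} (hF : MDifferentiableAt I (𝓡 3) F p)
    (u : TangentSpace I p) :
    mc (F p)⁻¹ (mfderiv I (𝓡 3) (fun q ↦ (F q)⁻¹) p u) =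
      -Ad (F p) (mc (F p) (mfderiv I (𝓡 3) F p u)) := by
  have h1 := mc_mfderiv_mul hF (mdifferentiableAt_inv_S3 hF) u
  have h2 : ∀ Φ : M → S3, Φ = (fun _ ↦ 1) → mc (Φ p) (mfderiv I (𝓡 3) Φ p u) = 0 := by
    rintro _ rfl
    exact mc_mfderiv_const 1 p u
  replace h2 := h2 (fun q ↦ F q * (F q)⁻¹) (funext fun q ↦ mul_inv_cancel _)
  rw [h2, inv_inv] at h1
  exact (neg_eq_of_add_eq_zero_right h1.symm).symm

end Calculus

/-! ### The Maurer-Cartan form of `S³ × S³` -/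

/-- The model of the Lie algebra of `S³ × S³`. -/
abbrev R33 : Type := R3 × R3

open Matrix in
/-- The Lie bracket of `R33`. -/
def brk (u v : R33) : R33 := (u.1 ⨯₃ v.1, u.2 ⨯₃ v.2)

/-- The Maurer-Cartan form of `S³ × S³`, as a continuous linear map. -/
def mcMap (p : S3 × S3) : TangentSpace I2 p →L[ℝ] R33 :=
  ((mc p.1).comp (mfderiv I2 (𝓡 3) Prod.fst p)).prod
    ((mc p.2).comp (mfderiv I2 (𝓡 3) Prod.snd p))

theorem mcMap_apply (p : S3 × S3) (u : TangentSpace I2 p) :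
    mcMap p u = (mc p.1 (mfderiv I2 (𝓡 3) Prod.fst p u), mc p.2 (mfderiv I2 (𝓡 3) Prod.snd p u)) :=
  rfl

theorem mcMap_apply' (p : S3 × S3) (u : TangentSpace I2 p) :
    mcMap p u = (mc p.1 u.1, mc p.2 u.2) := by
  rw [mcMap_apply, mfderiv_fst, mfderiv_snd]
  rfl

theorem mcMap_bijective (p : S3 × S3) : Function.Bijective (mcMap p) := by
  constructor
  · intro u v h
    rw [mcMap_apply', mcMap_apply', Prod.mk.injEq] at h
    exact Prod.ext (mc_injective _ h.1) (mc_injective _ h.2)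
  · rintro ⟨x, y⟩
    obtain ⟨u, hu⟩ := mc_surjective p.1 x
    obtain ⟨v, hv⟩ := mc_surjective p.2 y
    refine ⟨(u, v), ?_⟩
    exact (mcMap_apply' p _).trans (Prod.ext hu hv)

instance (p : S3 × S3) : FiniteDimensional ℝ (TangentSpace I2 p) :=
  inferInstanceAs (FiniteDimensional ℝ (EuclideanSpace ℝ (Fin 3) × EuclideanSpace ℝ (Fin 3)))

instance (p : S3 × S3) : T2Space (TangentSpace I2 p) :=
  inferInstanceAs (T2Space (EuclideanSpace ℝ (Fin 3) × EuclideanSpace ℝ (Fin 3)))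

/-- The Maurer-Cartan form of `S³ × S³`. -/
def mcE (p : S3 × S3) : TangentSpace I2 p ≃L[ℝ] R33 :=
  (LinearEquiv.ofBijective (mcMap p).toLinearMap (mcMap_bijective p)).toContinuousLinearEquiv

theorem mcE_apply (p : S3 × S3) (u : TangentSpace I2 p) : mcE p u = mcMap p u := rfl

theorem mcE_apply' (p : S3 × S3) (u : TangentSpace I2 p) : mcE p u = (mc p.1 u.1, mc p.2 u.2) :=
  mcMap_apply' p u

/-- The adjoint representation of `S³ × S³`. -/
def Ad2 (a : S3 × S3) : R33 →L[ℝ] R33 := (Ad a.1).prodMap (Ad a.2)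

theorem Ad2_apply (a : S3 × S3) (u : R33) : Ad2 a u = (Ad a.1 u.1, Ad a.2 u.2) := rfl

theorem mdifferentiableAt_fst_S3 (p : S3 × S3) :
    MDifferentiableAt I2 (𝓡 3) (Prod.fst : S3 × S3 → S3) p := mdifferentiableAt_fst

theorem mdifferentiableAt_snd_S3 (p : S3 × S3) :
    MDifferentiableAt I2 (𝓡 3) (Prod.snd : S3 × S3 → S3) p := mdifferentiableAt_snd

theorem mcE_mfderiv {E : Type*} [NormedAddCommGroup E] [NormedSpace ℝ E]
    {H : Type*} [TopologicalSpace H] {I : ModelWithCorners ℝ E H}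
    {M : Type*} [TopologicalSpace M] [ChartedSpace H M] {F G : M → S3} {p : M}
    (hF : MDifferentiableAt I (𝓡 3) F p) (hG : MDifferentiableAt I (𝓡 3) G p)
    (u : TangentSpace I p) :
    mcE (F p, G p) (mfderiv I I2 (fun q ↦ (F q, G q)) p u) =
      (mc (F p) (mfderiv I (𝓡 3) F p u), mc (G p) (mfderiv I (𝓡 3) G p u)) := by
  rw [mcE_apply', mfderiv_prodMk hF hG]
  rfl

theorem mcE_mul_left (a p : S3 × S3) (u : TangentSpace I2 p) :
    mcE (a * p) (mfderiv I2 I2 (fun q ↦ a * q) p u) = mcE p u := by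
  have h1 := mdifferentiableAt_mul_S3 (mdifferentiableAt_const (I := I2) (x := p) (c := a.1))
    (mdifferentiableAt_fst_S3 p)
  have h2 := mdifferentiableAt_mul_S3 (mdifferentiableAt_const (I := I2) (x := p) (c := a.2))
    (mdifferentiableAt_snd_S3 p)
  refine (mcE_mfderiv h1 h2 u).trans ?_
  rw [mc_mfderiv_mul mdifferentiableAt_const (mdifferentiableAt_fst_S3 p),
    mc_mfderiv_mul mdifferentiableAt_const (mdifferentiableAt_snd_S3 p),
    mc_mfderiv_const, mc_mfderiv_const, map_zero, map_zero, zero_add, zero_add]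
  rfl

/-- Two-sided translations `(x, y) ↦ (a₁ x b⁻¹₁, a₂ y b⁻¹₂)` act on the Maurer-Cartan form by the
adjoint representation. -/
theorem mcE_two_sided (a b p : S3 × S3) (u : TangentSpace I2 p) :
    mcE (a.1 * p.1 * b.1⁻¹, a.2 * p.2 * b.2⁻¹)
      (mfderiv I2 I2 (fun q : S3 × S3 ↦ (a.1 * q.1 * b.1⁻¹, a.2 * q.2 * b.2⁻¹)) p u) =
        Ad2 b (mcE p u) := by
  have h1 := mdifferentiableAt_mul_S3 (mdifferentiableAt_const (I := I2) (x := p) (c := a.1))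
    (mdifferentiableAt_fst_S3 p)
  have h2 := mdifferentiableAt_mul_S3 (mdifferentiableAt_const (I := I2) (x := p) (c := a.2))
    (mdifferentiableAt_snd_S3 p)
  have c1 := mdifferentiableAt_const (I := I2) (I' := 𝓡 3) (x := p) (c := b.1⁻¹)
  have c2 := mdifferentiableAt_const (I := I2) (I' := 𝓡 3) (x := p) (c := b.2⁻¹)
  refine (mcE_mfderiv (mdifferentiableAt_mul_S3 h1 c1) (mdifferentiableAt_mul_S3 h2 c2) u).trans ?_
  rw [mc_mfderiv_mul h1 c1, mc_mfderiv_mul h2 c2,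
    mc_mfderiv_mul mdifferentiableAt_const (mdifferentiableAt_fst_S3 p),
    mc_mfderiv_mul mdifferentiableAt_const (mdifferentiableAt_snd_S3 p)]
  simp only [mc_mfderiv_const, map_zero, zero_add, add_zero, inv_inv]
  rfl

/-! ### Derivatives of vector valued functions along Lie brackets -/

section LieBracket

open VectorField Set Bundle

variable {E : Type*} [NormedAddCommGroup E] [NormedSpace ℝ E]
  {H : Type*} [TopologicalSpace H] {I : ModelWithCorners ℝ E H}
  {M : Type*} [TopologicalSpace M] [ChartedSpace H M] [IsManifold I 2 M]
  {F : Type*} [NormedAddCommGroup F] [NormedSpace ℝ F]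

/-- Differentiating along a field commutes with passing to a chart. This moves the bracket identity
below to a normed space. -/
theorem fderivWithin_comp_extChartAt_symm {h : M → F} {x : M} {V : ∀ p : M, TangentSpace I p}
    {y : E} (hy : y ∈ (extChartAt I x).target)
    (hh : MDifferentiableAt I 𝓘(ℝ, F) h ((extChartAt I x).symm y)) :
    fderivWithin ℝ (h ∘ (extChartAt I x).symm) (range I) y
      (mpullbackWithin 𝓘(ℝ, E) I (extChartAt I x).symm V (range I) y) =
        mvfderiv I h ((extChartAt I x).symm y) (V ((extChartAt I x).symm y)) := by
  have : IsManifold I 1 M := IsManifold.of_le (n := 2) (by norm_num)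
  have hinv := isInvertible_mfderivWithin_extChartAt_symm (I := I) hy
  have hs : MDifferentiableWithinAt 𝓘(ℝ, E) I (extChartAt I x).symm (range I) y :=
    mdifferentiableWithinAt_extChartAt_symm hy
  have huniq : UniqueMDiffWithinAt 𝓘(ℝ, E) (range I) y :=
    I.uniqueMDiffOn _ (extChartAt_target_subset_range x hy)
  have h1 := mfderiv_comp_mfderivWithin y hh hs huniq
  have h2 : fderivWithin ℝ (h ∘ (extChartAt I x).symm) (range I) y =
    mfderivWithin 𝓘(ℝ, E) 𝓘(ℝ, F) (h ∘ (extChartAt I x).symm) (range I) y :=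
    mfderivWithin_eq_fderivWithin.symm
  rw [h2, h1, mpullbackWithin_apply]
  obtain ⟨L, hL⟩ := hinv
  rw [← hL, ContinuousLinearMap.inverse_equiv]
  change mfderiv I 𝓘(ℝ, F) h _ (L (L.symm _)) = _
  rw [L.apply_symm_apply]
  rfl

variable [CompleteSpace E]

/-- `df([V, W]) = d(df(W))(V) - d(df(V))(W)`. -/
theorem mvfderiv_mlieBracket {f : M → F} {x : M} {V W : ∀ p : M, TangentSpace I p}
    (hf : ContMDiff I 𝓘(ℝ, F) 2 f)
    (hV : MDifferentiableAt I I.tangent (fun p ↦ (⟨p, V p⟩ : TangentBundle I M)) x)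
    (hW : MDifferentiableAt I I.tangent (fun p ↦ (⟨p, W p⟩ : TangentBundle I M)) x)
    (hfV : MDifferentiableAt I 𝓘(ℝ, F) (fun p ↦ mvfderiv I f p (V p)) x)
    (hfW : MDifferentiableAt I 𝓘(ℝ, F) (fun p ↦ mvfderiv I f p (W p)) x) :
    mvfderiv I f x (mlieBracket I V W x) =
      mvfderiv I (fun p ↦ mvfderiv I f p (W p)) x (V x) -
        mvfderiv I (fun p ↦ mvfderiv I f p (V p)) x (W x) := by
  have : IsManifold I 1 M := IsManifold.of_le (n := 2) (by norm_num)
  set φ := extChartAt I x with hφ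
  set V' := mpullbackWithin 𝓘(ℝ, E) I φ.symm V (range I) with hV'
  set W' := mpullbackWithin 𝓘(ℝ, E) I φ.symm W (range I) with hW'
  have hx : φ x ∈ φ.target := mem_extChartAt_target x
  have hx' : φ.symm (φ x) = x := extChartAt_to_inv x
  have hdiff : ∀ p, MDifferentiableAt I 𝓘(ℝ, F) f p := fun p ↦ hf.mdifferentiableAt (by simp)
  have near : ∀ᶠ y in nhdsWithin (φ x) (range I), y ∈ φ.target :=
    extChartAt_target_mem_nhdsWithin x
  have hc : ContDiffWithinAt ℝ 2 (f ∘ φ.symm) (range I) (φ x) := by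
    have := (contMDiffAt_iff.1 (hf x)).2
    simpa [-extChartAt, extChartAt_model_space_eq_id] using this
  have A : ∀ (Z : ∀ p : M, TangentSpace I p),
      (fun y ↦ fderivWithin ℝ (f ∘ φ.symm) (range I) y
        (mpullbackWithin 𝓘(ℝ, E) I φ.symm Z (range I) y)) =ᶠ[nhdsWithin (φ x) (range I)]
      (fun p ↦ mvfderiv I f p (Z p)) ∘ φ.symm := fun Z ↦ by
    filter_upwards [near] with y hy
    exact fderivWithin_comp_extChartAt_symm hy (hdiff _)
  have B : ∀ (Z Z' : ∀ p : M, TangentSpace I p),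
      MDifferentiableAt I 𝓘(ℝ, F) (fun p ↦ mvfderiv I f p (Z p)) x →
      fderivWithin ℝ (fun y ↦ fderivWithin ℝ (f ∘ φ.symm) (range I) y
        (mpullbackWithin 𝓘(ℝ, E) I φ.symm Z (range I) y)) (range I) (φ x)
          (mpullbackWithin 𝓘(ℝ, E) I φ.symm Z' (range I) (φ x)) =
      mvfderiv I (fun p ↦ mvfderiv I f p (Z p)) x (Z' x) := fun Z Z' hZ ↦ by
    rw [(A Z).fderivWithin_eq ((A Z).self_of_nhdsWithin (mem_range_self _)),
      fderivWithin_comp_extChartAt_symm (V := Z') hx (by rw [hx']; exact hZ), hx']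
  -- In the chart the identity expresses the symmetry of the second derivative of a `C²` function.
  have key := fderivWithin_apply_lieBracket (V := V') (W := W') (n := 2) hc (by simp)
    I.uniqueDiffOn (I.range_subset_closure_interior (mem_range_self _)) (mem_range_self _)
    (by simpa [-extChartAt] using (hW.mdifferentiableWithinAt
      (s := univ)).differentiableWithinAt_mpullbackWithin_vectorField)
    (by simpa [-extChartAt] using (hV.mdifferentiableWithinAt
      (s := univ)).differentiableWithinAt_mpullbackWithin_vectorField)
  rw [B W V hfW, B V W hfV] at key
  rw [← key]
  have hb : mlieBracket I V W x = lieBracketWithin ℝ V' W' (range I) (φ x) := by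
    rw [← mlieBracketWithin_univ, mlieBracketWithin_apply, mfderiv_extChartAt_self,
      preimage_univ, univ_inter]
    exact congrArg (fun L : E →L[ℝ] E ↦ L (lieBracketWithin ℝ V' W' (range I) (φ x)))
      (ContinuousLinearMap.inverse_id (R := ℝ) (M := E))
  have hcomp : mvfderiv I f x = fderivWithin ℝ (f ∘ φ.symm) (range I) (φ x) := by
    have := (hdiff x).mfderiv
    simp only [writtenInExtChartAt, extChartAt_model_space_eq_id] at this
    exact this
  rw [hb, hcomp]
  rfl

end LieBracket

/-! ### Smoothness of the Maurer-Cartan form -/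

section Smooth

open Bundle

/-- The model space of `S³ × S³`. -/
abbrev E33 : Type := EuclideanSpace ℝ (Fin 3) × EuclideanSpace ℝ (Fin 3)

/-- The base set of the trivialization of the tangent bundle of `S³ × S³` at a point. -/
abbrev trivBase (x : S3 × S3) : Set (S3 × S3) :=
  (trivializationAt E33 (TangentSpace I2 : S3 × S3 → Type _) x).baseSet

/-- The inverse of the trivialization of the tangent bundle of `S³ × S³` at a point. -/
abbrev trivSymm (x p : S3 × S3) : E33 →L[ℝ] TangentSpace I2 p :=
  (trivializationAt E33 (TangentSpace I2 : S3 × S3 → Type _) x).symmL ℝ p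

/-- The trivialization of the tangent bundle of `S³ × S³` at a point. -/
abbrev trivTo (x p : S3 × S3) : TangentSpace I2 p →L[ℝ] E33 :=
  (trivializationAt E33 (TangentSpace I2 : S3 × S3 → Type _) x).continuousLinearMapAt ℝ p

/-- The Maurer-Cartan form in the trivialization at `x`. -/
def mcCoord (x p : S3 × S3) : E33 →L[ℝ] R33 := (mcMap p).comp (trivSymm x p)

theorem trivBase_mem_nhds (x : S3 × S3) : trivBase x ∈ nhds x :=
  (trivializationAt E33 (TangentSpace I2 : S3 × S3 → Type _) x).open_baseSet.mem_nhds
    (mem_baseSet_trivializationAt _ _ _)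

theorem contMDiffAt_mvfderiv {F : Type*} [NormedAddCommGroup F] [NormedSpace ℝ F] {f : S3 × S3 → F}
    (hf : ContMDiff I2 𝓘(ℝ, F) ∞ f) (x : S3 × S3) :
    ContMDiffAt I2 𝓘(ℝ, E33 →L[ℝ] F) ∞ (fun p ↦ (mvfderiv I2 f p).comp (trivSymm x p)) x := by
  have h := ContMDiffAt.mfderiv_const (m := ∞) (hf x) (by simp)
  refine h.congr_of_eventuallyEq (Filter.Eventually.of_forall fun p ↦ ?_)
  simp only [inTangentCoordinates, ContinuousLinearMap.inCoordinates,
    TangentBundle.continuousLinearMapAt_model_space]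
  rfl

/-- Smoothness of the Maurer-Cartan form is reduced to that of the derivatives of the two
quaternion-valued coordinate maps. -/
theorem mcCoord_eq (x p : S3 × S3) : mcCoord x p =
    ContinuousLinearMap.prod
      (coordQ ∘L (ContinuousLinearMap.mul ℝ ℍ (star (p.1 : ℍ))) ∘L
        ((mvfderiv I2 (fun q : S3 × S3 ↦ (q.1 : ℍ)) p).comp (trivSymm x p)))
      (coordQ ∘L (ContinuousLinearMap.mul ℝ ℍ (star (p.2 : ℍ))) ∘L
        ((mvfderiv I2 (fun q : S3 × S3 ↦ (q.2 : ℍ)) p).comp (trivSymm x p))) := by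
  refine ContinuousLinearMap.ext fun u ↦ ?_
  refine (mcMap_apply p _).trans ?_
  rw [mc_apply, mc_apply, dCoe_mfderiv (mdifferentiableAt_fst_S3 p),
    dCoe_mfderiv (mdifferentiableAt_snd_S3 p)]
  rfl

/-- Quaternionic conjugation as a continuous linear map. -/
def starQ : ℍ →L[ℝ] ℍ := LinearMap.toContinuousLinearMap
  { toFun := star
    map_add' := star_add
    map_smul' := fun r x ↦ Quaternion.star_smul r x }

theorem contMDiff_coe_fst : ContMDiff I2 𝓘(ℝ, ℍ) ∞ (fun q : S3 × S3 ↦ (q.1 : ℍ)) :=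
  contMDiff_coe_sphere.comp contMDiff_fst

theorem contMDiff_coe_snd : ContMDiff I2 𝓘(ℝ, ℍ) ∞ (fun q : S3 × S3 ↦ (q.2 : ℍ)) :=
  contMDiff_coe_sphere.comp contMDiff_snd

theorem contMDiff_mul_star {f : S3 × S3 → ℍ} (hf : ContMDiff I2 𝓘(ℝ, ℍ) ∞ f) :
    ContMDiff I2 𝓘(ℝ, ℍ →L[ℝ] ℍ) ∞ (fun q ↦ ContinuousLinearMap.mul ℝ ℍ (star (f q))) :=
  (ContinuousLinearMap.contDiff ((ContinuousLinearMap.mul ℝ ℍ).comp starQ)).contMDiff.comp hf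

theorem contMDiffAt_mcCoord (x : S3 × S3) :
    ContMDiffAt I2 𝓘(ℝ, E33 →L[ℝ] R33) ∞ (mcCoord x) x := by
  have h1 := contMDiffAt_mvfderiv contMDiff_coe_fst x
  have h2 := contMDiffAt_mvfderiv contMDiff_coe_snd x
  have h3 := (contMDiff_mul_star contMDiff_coe_fst x).clm_comp h1
  have h4 := (contMDiff_mul_star contMDiff_coe_snd x).clm_comp h2
  have c : ContMDiffAt I2 𝓘(ℝ, ℍ →L[ℝ] R3) ∞ (fun _ ↦ coordQ) x := contMDiffAt_const
  have h5 := c.clm_comp h3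
  have h6 := c.clm_comp h4
  have h7 : ContMDiffAt I2 𝓘(ℝ, E33 →L[ℝ] R33) ∞ (fun p ↦
    (ContinuousLinearMap.inl ℝ R3 R3).comp (coordQ ∘L (ContinuousLinearMap.mul ℝ ℍ (star (p.1 : ℍ)))
      ∘L ((mvfderiv I2 (fun q : S3 × S3 ↦ (q.1 : ℍ)) p).comp (trivSymm x p))) +
    (ContinuousLinearMap.inr ℝ R3 R3).comp (coordQ ∘L (ContinuousLinearMap.mul ℝ ℍ (star (p.2 : ℍ)))
      ∘L ((mvfderiv I2 (fun q : S3 × S3 ↦ (q.2 : ℍ)) p).comp (trivSymm x p)))) x :=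
    (contMDiffAt_const.clm_comp h5).add (contMDiffAt_const.clm_comp h6)
  refine h7.congr_of_eventuallyEq (Filter.Eventually.of_forall fun p ↦ ?_)
  rw [mcCoord_eq]
  refine ContinuousLinearMap.ext fun u ↦ ?_
  simp

/-- In a trivialization, the Maurer-Cartan form is an isomorphism. -/
def mcCoordE (x : S3 × S3) {p : S3 × S3} (hp : p ∈ trivBase x) : E33 ≃L[ℝ] R33 :=
  ((trivializationAt E33 (TangentSpace I2 : S3 × S3 → Type _) x).continuousLinearEquivAt ℝ p
    hp).symm.trans (mcE p)

theorem mcCoordE_eq (x : S3 × S3) {p : S3 × S3} (hp : p ∈ trivBase x) :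
    (mcCoordE x hp : E33 →L[ℝ] R33) = mcCoord x p := by
  refine ContinuousLinearMap.ext fun u ↦ ?_
  simp only [mcCoord, mcCoordE]
  change mcMap p _ = mcMap p _
  exact congrArg (fun T : E33 → TangentSpace I2 p ↦ mcMap p (T u))
    (Trivialization.symm_continuousLinearEquivAt_eq _ hp)

theorem mcCoord_trivTo (x : S3 × S3) {p : S3 × S3} (hp : p ∈ trivBase x) (u : TangentSpace I2 p) :
    mcCoord x p (trivTo x p u) = mcMap p u := by
  change mcMap p (trivSymm x p (trivTo x p u)) = _
  rw [Trivialization.symmL_continuousLinearMapAt _ hp]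

theorem inverse_mcCoord (x : S3 × S3) {p : S3 × S3} (hp : p ∈ trivBase x) (u : TangentSpace I2 p) :
    (mcCoord x p).inverse (mcMap p u) = trivTo x p u := by
  rw [← mcCoord_trivTo x hp, ← mcCoordE_eq x hp, ContinuousLinearMap.inverse_equiv]
  exact (mcCoordE x hp).symm_apply_apply _

/-- Inversion of operators is smooth at an invertible operator, and `mcCoord x x` is invertible. -/
theorem contMDiffAt_inverse_mcCoord (x : S3 × S3) :
    ContMDiffAt I2 𝓘(ℝ, R33 →L[ℝ] E33) ∞ (fun p ↦ (mcCoord x p).inverse) x := by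
  have hx : x ∈ trivBase x := mem_baseSet_trivializationAt _ _ _
  have h := contDiffAt_map_inverse (n := ∞) (mcCoordE x hx)
  rw [mcCoordE_eq] at h
  exact h.contMDiffAt.comp x (contMDiffAt_mcCoord x)

theorem trivTo_apply (x : S3 × S3) {p : S3 × S3} (hp : p ∈ trivBase x) (u : TangentSpace I2 p) :
    trivTo x p u = (trivializationAt E33 (TangentSpace I2 : S3 × S3 → Type _) x ⟨p, u⟩).2 := by
  rw [Trivialization.continuousLinearMapAt_apply, Trivialization.coe_linearMapAt_of_mem _ hp]

/-- A vector field is smooth if and only if it is so in the left-invariant trivialization. -/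
theorem isSmoothField_iff {X : ∀ p : S3 × S3, TangentSpace I2 p} :
    IsSmoothField X ↔ ContMDiff I2 𝓘(ℝ, R33) ∞ (fun p ↦ mcE p (X p)) := by
  refine forall_congr' fun x ↦ ?_
  rw [contMDiffAt_section]
  constructor
  · intro h
    refine ((contMDiffAt_mcCoord x).clm_apply h).congr_of_eventuallyEq ?_
    filter_upwards [trivBase_mem_nhds x] with p hp
    rw [← trivTo_apply x hp, mcCoord_trivTo x hp]
    rfl
  · intro h
    refine ((contMDiffAt_inverse_mcCoord x).clm_apply h).congr_of_eventuallyEq ?_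
    filter_upwards [trivBase_mem_nhds x] with p hp
    rw [← trivTo_apply x hp, mcE_apply, inverse_mcCoord x hp]

theorem mdifferentiableAt_mcE {X : ∀ p : S3 × S3, TangentSpace I2 p} {x : S3 × S3}
    (hX : MDifferentiableAt I2 I2.tangent (fun p ↦ (⟨p, X p⟩ : TangentBundle I2 (S3 × S3))) x) :
    MDifferentiableAt I2 𝓘(ℝ, R33) (fun p ↦ mcE p (X p)) x := by
  have h := (mdifferentiableAt_section I2 X).1 hX
  refine (((contMDiffAt_mcCoord x).mdifferentiableAt (by simp)).clm_apply
    h).congr_of_eventuallyEq ?_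
  filter_upwards [trivBase_mem_nhds x] with p hp
  rw [← trivTo_apply x hp, mcCoord_trivTo x hp]
  rfl

end Smooth

/-! ### Left-invariant vector fields -/

section Invariant

open VectorField

/-- The left-invariant vector field with value `w` under the Maurer-Cartan form. -/
def inv (w : R33) (p : S3 × S3) : TangentSpace I2 p := (mcE p).symm w

@[simp] theorem mcE_inv (w : R33) (p : S3 × S3) : mcE p (inv w p) = w :=
  (mcE p).apply_symm_apply w

theorem inv_mcE (p : S3 × S3) (u : TangentSpace I2 p) : inv (mcE p u) p = u :=
  (mcE p).symm_apply_apply u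

theorem isSmoothField_inv (w : R33) : IsSmoothField (inv w) := by
  rw [isSmoothField_iff]
  simp only [mcE_inv]
  exact contMDiff_const

/-- Differentiability of vector fields at a point. -/
abbrev DiffFieldAt (X : ∀ p : S3 × S3, TangentSpace I2 p) (x : S3 × S3) : Prop :=
  MDifferentiableAt I2 I2.tangent (fun p ↦ (⟨p, X p⟩ : TangentBundle I2 (S3 × S3))) x

theorem IsSmoothField.diffFieldAt {X : ∀ p : S3 × S3, TangentSpace I2 p} (hX : IsSmoothField X)
    (x : S3 × S3) : DiffFieldAt X x :=
  ContMDiff.mdifferentiableAt hX (by simp)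

/-- As a quaternion-valued function, `g` has derivative `g · imQ v` along `V`. Differentiating once
more, `[V, W]` acts as right multiplication by the commutator of `imQ v` and `imQ w`, which is `imQ`
of the cross product. -/
theorem dCoe_mlieBracket {g : S3 × S3 → S3} (hg : ContMDiff I2 (𝓡 3) ∞ g) (v w : R3)
    (V W : ∀ p : S3 × S3, TangentSpace I2 p) (hV : IsSmoothField V) (hW : IsSmoothField W)
    (hgV : ∀ p, mc (g p) (mfderiv I2 (𝓡 3) g p (V p)) = v)
    (hgW : ∀ p, mc (g p) (mfderiv I2 (𝓡 3) g p (W p)) = w) (x : S3 × S3) :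
    mc (g x) (mfderiv I2 (𝓡 3) g x (mlieBracket I2 V W x)) = crossProduct v w := by
  have hgd : ∀ p, MDifferentiableAt I2 (𝓡 3) g p := fun p ↦ hg.mdifferentiableAt (by simp)
  have hcg : ContMDiff I2 𝓘(ℝ, ℍ) ∞ (fun p ↦ (g p : ℍ)) := contMDiff_coe_sphere.comp hg
  have key : ∀ (Z : ∀ p : S3 × S3, TangentSpace I2 p) (z : R3),
      (∀ p, mc (g p) (mfderiv I2 (𝓡 3) g p (Z p)) = z) →
      (fun p ↦ mvfderiv I2 (fun q ↦ (g q : ℍ)) p (Z p)) = fun p ↦ (g p : ℍ) * imQ z := by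
    intro Z z hz
    funext p
    rw [← dCoe_mfderiv (hgd p), dCoe_eq, hz]
  have hmul : ∀ z : R3, ContMDiff I2 𝓘(ℝ, ℍ) ∞ (fun p ↦ (g p : ℍ) * imQ z) := fun z ↦
    (ContinuousLinearMap.contDiff
      ((ContinuousLinearMap.mul ℝ ℍ).flip (imQ z))).contMDiff.comp hcg
  have hd : ∀ (z : R3) (u : TangentSpace I2 x), mvfderiv I2 (fun p ↦ (g p : ℍ) * imQ z) x u =
      mvfderiv I2 (fun p ↦ (g p : ℍ)) x u * imQ z := by
    intro z u
    let L := (ContinuousLinearMap.mul ℝ ℍ).flip (imQ z)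
    have h1 : HasMFDerivAt I2 𝓘(ℝ, ℍ) (fun p ↦ (g p : ℍ) * imQ z) x
        (L.comp (mfderiv I2 𝓘(ℝ, ℍ) (fun p ↦ (g p : ℍ)) x)) :=
      HasMFDerivAt.comp (g := L) x L.hasMFDerivAt
        (hcg.mdifferentiableAt (by simp)).hasMFDerivAt
    exact congrArg (fun T ↦ T u) h1.mfderiv
  rw [mc_eq_iff, dCoe_mfderiv (hgd x), mvfderiv_mlieBracket (hcg.of_le ENat.LEInfty.out) (hV.diffFieldAt x)
    (hW.diffFieldAt x)]
  · rw [key V v hgV, key W w hgW, hd, hd]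
    have e1 := congrFun (key V v hgV) x
    have e2 := congrFun (key W w hgW) x
    rw [e1, e2, imQ_cross, mul_sub, mul_assoc, mul_assoc]
  · rw [key V v hgV]
    exact (hmul v).mdifferentiableAt (by simp)
  · rw [key W w hgW]
    exact (hmul w).mdifferentiableAt (by simp)

theorem mcE_mlieBracket_inv (v w : R33) (x : S3 × S3) :
    mcE x (mlieBracket I2 (inv v) (inv w) x) = brk v w := by
  have h : ∀ (z : R33) (p : S3 × S3),
      (mc p.1 (mfderiv I2 (𝓡 3) Prod.fst p (inv z p)), mc p.2 (mfderiv I2 (𝓡 3) Prod.snd p (inv z p)))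
        = z := fun z p ↦ mcE_inv z p
  refine Prod.ext ?_ ?_
  · exact dCoe_mlieBracket contMDiff_fst v.1 w.1 _ _ (isSmoothField_inv v) (isSmoothField_inv w)
      (fun p ↦ congrArg Prod.fst (h v p)) (fun p ↦ congrArg Prod.fst (h w p)) x
  · exact dCoe_mlieBracket contMDiff_snd v.2 w.2 _ _ (isSmoothField_inv v) (isSmoothField_inv w)
      (fun p ↦ congrArg Prod.snd (h v p)) (fun p ↦ congrArg Prod.snd (h w p)) x

/-! ### Left-invariant connections -/

/-- The left-invariant connection with `∇_v w = Γ v w` on left-invariant fields. -/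
def invConn (Γ : R33 →L[ℝ] R33 →L[ℝ] R33) :
    CovariantDerivative I2 E33 (TangentSpace I2 : S3 × S3 → Type _) where
  toFun Y p := ((mcE p).symm : R33 →L[ℝ] TangentSpace I2 p).comp
    (mvfderiv I2 (fun q ↦ mcE q (Y q)) p + (Γ.flip (mcE p (Y p))).comp (mcMap p))
  isCovariantDerivativeOnUniv :=
    { add := by
        intro Y Z x hY hZ _
        have h : mvfderiv I2 (fun q ↦ mcE q ((Y + Z) q)) x = mvfderiv I2 (fun q ↦ mcE q (Y q)) x +
            mvfderiv I2 (fun q ↦ mcE q (Z q)) x := by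
          have h0 := mvfderiv_add (mdifferentiableAt_mcE hY) (mdifferentiableAt_mcE hZ)
          rw [← h0]
          congr 1
          funext q
          exact map_add _ _ _
        rw [h, Pi.add_apply, map_add, map_add, ← ContinuousLinearMap.comp_add]
        congr 1
        rw [ContinuousLinearMap.add_comp]
        abel
      leibniz := by
        intro Y g x hY hg _
        have h : mvfderiv I2 (fun q ↦ mcE q ((g • Y) q)) x = g x • mvfderiv I2 (fun q ↦ mcE q (Y q)) x +
            (mvfderiv I2 g x).smulRight (mcE x (Y x)) := by
          have h0 := mvfderiv_smul hg (mdifferentiableAt_mcE hY)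
          rw [← h0]
          congr 1
          funext q
          exact map_smul (mcE q) (g q) (Y q)
        rw [h]
        refine ContinuousLinearMap.ext fun u ↦ (mcE x).injective ?_
        simp [Pi.smul_apply']
        module }

end Invariant

/-! ### Left-invariant almost Hermitian structures -/

section Structures

open Bundle

/-- A Hermitian structure on the Lie algebra `R33` of `S³ × S³`. -/
@[ext]
structure HermData where
  /-- the scalar product -/
  q : R33 →L[ℝ] R33 →L[ℝ] ℝ
  /-- the complex structure -/
  j : R33 →L[ℝ] R33
  symm : ∀ u v, q u v = q v u
  pos : ∀ u, u ≠ 0 → 0 < q u u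
  sq : ∀ u, j (j u) = -u
  compat : ∀ u v, q (j u) (j v) = q u v

/-- The constant is the minimum of `q u u` on the compact unit sphere. The bound serves to show that
the unit balls of the metric are bounded. -/
theorem exists_lower_bound (q : R33 →L[ℝ] R33 →L[ℝ] ℝ) (hq : ∀ u, u ≠ 0 → 0 < q u u) :
    ∃ m : ℝ, 0 < m ∧ ∀ u, m * ‖u‖ ^ 2 ≤ q u u := by
  have hc : IsCompact (Metric.sphere (0 : R33) 1) := isCompact_sphere 0 1
  have hne : (Metric.sphere (0 : R33) 1).Nonempty := NormedSpace.sphere_nonempty.2 zero_le_one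
  have hcont : Continuous fun u : R33 ↦ q u u := by fun_prop
  obtain ⟨u₀, hu₀, hmin⟩ := hc.exists_isMinOn hne hcont.continuousOn
  have hu₁ : u₀ ≠ 0 := by
    rintro rfl
    simp at hu₀
  refine ⟨q u₀ u₀, hq u₀ hu₁, fun u ↦ ?_⟩
  rcases eq_or_ne u 0 with rfl | hu
  · simp
  · have hn : ‖u‖ ≠ 0 := norm_ne_zero_iff.2 hu
    have h1 : (‖u‖⁻¹ • u) ∈ Metric.sphere (0 : R33) 1 := by
      rw [mem_sphere_zero_iff_norm, norm_smul, norm_inv, norm_norm, inv_mul_cancel₀ hn]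
    have h2 : q u₀ u₀ ≤ ‖u‖⁻¹ * (‖u‖⁻¹ * q u u) := by
      simpa using hmin h1
    calc q u₀ u₀ * ‖u‖ ^ 2 ≤ (‖u‖⁻¹ * (‖u‖⁻¹ * q u u)) * ‖u‖ ^ 2 := by gcongr
      _ = q u u := by field_simp

theorem isVonNBounded_inner (D : HermData) (p : S3 × S3) :
    Bornology.IsVonNBounded ℝ {v : TangentSpace I2 p | D.q (mcE p v) (mcE p v) < 1} := by
  obtain ⟨m, hm, hq⟩ := exists_lower_bound D.q D.pos
  have h1 : Bornology.IsVonNBounded ℝ {w : R33 | D.q w w < 1} := by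
    rw [NormedSpace.isVonNBounded_iff', ]
    refine ⟨1 + m⁻¹, fun w hw ↦ ?_⟩
    have h2 : m * ‖w‖ ^ 2 < 1 := (hq w).trans_lt hw
    have h3 : ‖w‖ ^ 2 < m⁻¹ := by rwa [← one_div, lt_div_iff₀' hm]
    -- From `2 ‖w‖ ≤ 1 + ‖w‖²`.
    nlinarith [sq_nonneg (‖w‖ - 1), inv_pos.2 hm]
  have h4 := h1.image ((mcE p).symm : R33 →L[ℝ] TangentSpace I2 p)
  refine h4.subset ?_
  intro v hv
  exact ⟨mcE p v, hv, (mcE p).symm_apply_apply v⟩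

/-- The pullback of a bilinear form under a linear map. -/
def pullQ {V : Type*} [TopologicalSpace V] [AddCommGroup V] [Module ℝ V] [IsTopologicalAddGroup V]
    [ContinuousSMul ℝ V] {W : Type*} [TopologicalSpace W] [AddCommGroup W] [Module ℝ W]
    [IsTopologicalAddGroup W] [ContinuousSMul ℝ W] (q : W →L[ℝ] W →L[ℝ] ℝ) (T : V →L[ℝ] W) :
    V →L[ℝ] V →L[ℝ] ℝ :=
  (ContinuousLinearMap.precomp ℝ T).comp (q.comp T)

/-- The left-invariant almost Hermitian structure given by a Hermitian structure on the Lie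
algebra. -/
def HermData.toAlmostHermitian (D : HermData) : AlmostHermitian I2 (S3 × S3) where
  g :=
    { inner := fun p ↦ pullQ D.q (mcMap p)
      symm := fun p u v ↦ D.symm _ _
      pos := fun p u hu ↦ D.pos _ fun h ↦ hu ((mcE p).map_eq_zero_iff.1 h)
      isVonNBounded := fun p ↦ isVonNBounded_inner D p
      contMDiff := by
        intro x
        rw [contMDiffAt_hom_bundle]
        refine ⟨contMDiffAt_id, ?_⟩
        let Q : (E33 →L[ℝ] R33) → (E33 →L[ℝ] E33 →L[ℝ] ℝ) := fun T ↦ pullQ D.q T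
        -- The pulled back form depends quadratically on the operator, hence smoothly.
        have hQ : ContDiff ℝ ∞ Q := by
          have h1 : Q = fun T ↦ ((ContinuousLinearMap.compL ℝ E33 R33 ℝ).flip T).comp (D.q.comp T) := by
            funext T
            rfl
          rw [h1]
          exact ContDiff.clm_comp (ContinuousLinearMap.contDiff _)
            (contDiff_const.clm_comp contDiff_id)
        refine ((hQ.contMDiff (mcCoord x x)).comp x (contMDiffAt_mcCoord x)).congr_of_eventuallyEq ?_
        filter_upwards [trivBase_mem_nhds x] with p hp
        refine ContinuousLinearMap.ext fun u ↦ ContinuousLinearMap.ext fun v ↦ ?_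
        rw [inCoordinates_apply_eq₂ hp hp (by trivial)]
        rw [← Trivialization.symmL_apply (R := ℝ) _ hp, ← Trivialization.symmL_apply (R := ℝ) _ hp]
        have hid : (trivializationAt ℝ (fun _ : S3 × S3 ↦ ℝ) x).linearMapAt ℝ p = LinearMap.id :=
          Bundle.Trivial.linearMapAt_trivialization ℝ (S3 × S3) ℝ p
        rw [hid]
        rfl }
  J := fun p ↦ ((mcE p).symm : R33 →L[ℝ] TangentSpace I2 p).comp (D.j.comp (mcMap p))
  contMDiff_J := by
    intro x
    rw [contMDiffAt_hom_bundle]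
    refine ⟨contMDiffAt_id, ?_⟩
    refine ((contMDiffAt_inverse_mcCoord x).clm_comp ((contMDiffAt_const (c := D.j)).clm_comp
      (contMDiffAt_mcCoord x))).congr_of_eventuallyEq ?_
    filter_upwards [trivBase_mem_nhds x] with p hp
    refine ContinuousLinearMap.ext fun u ↦ ?_
    have h := inverse_mcCoord x hp ((mcE p).symm (D.j (mcCoord x p u)))
    rw [← mcE_apply, ContinuousLinearEquiv.apply_symm_apply] at h
    exact h.symm
  J_sq := fun p u ↦ by
    refine (mcE p).injective ?_
    simp [← mcE_apply, D.sq]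
  compat := fun p u v ↦ by
    change D.q (mcE p ((mcE p).symm (D.j (mcE p u)))) (mcE p ((mcE p).symm (D.j (mcE p v)))) =
      D.q (mcE p u) (mcE p v)
    simp [D.compat]

theorem HermData.inner_apply (D : HermData) (p : S3 × S3) (u v : TangentSpace I2 p) :
    D.toAlmostHermitian.g.inner p u v = D.q (mcE p u) (mcE p v) := rfl

theorem HermData.mcE_J (D : HermData) (p : S3 × S3) (u : TangentSpace I2 p) :
    mcE p (D.toAlmostHermitian.J p u) = D.j (mcE p u) :=
  (mcE p).apply_symm_apply _

theorem HermData.isLeftInvariant (D : HermData) : D.toAlmostHermitian.IsLeftInvariant := by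
  intro a p u v
  constructor
  · rw [one_mul, D.inner_apply, D.inner_apply, mcE_mul_left, mcE_mul_left]
  · refine (mcE (a * p)).injective ?_
    rw [D.mcE_J, one_smul, mcE_mul_left, mcE_mul_left, D.mcE_J]

theorem AlmostHermitian.ext_of_eq {S S' : AlmostHermitian I2 (S3 × S3)}
    (hg : ∀ p u v, S.g.inner p u v = S'.g.inner p u v) (hJ : ∀ p u, S.J p u = S'.J p u) :
    S = S' := by
  obtain ⟨⟨gi, _, _, _, _⟩, J, _, _, _⟩ := S
  obtain ⟨⟨gi', _, _, _, _⟩, J', _, _, _⟩ := S'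
  have h1 : gi = gi' := by
    funext p
    exact ContinuousLinearMap.ext fun u ↦ ContinuousLinearMap.ext fun v ↦ hg p u v
  have h2 : J = J' := by
    funext p
    exact ContinuousLinearMap.ext fun u ↦ hJ p u
  subst h1 h2
  rfl

/-- Every left-invariant almost Hermitian structure comes from the Lie algebra. -/
theorem AlmostHermitian.IsLeftInvariant.exists_data {S : AlmostHermitian I2 (S3 × S3)}
    (hS : S.IsLeftInvariant) : ∃ D : HermData, S = D.toAlmostHermitian := by
  let m : R33 →L[ℝ] TangentSpace I2 (1 : S3 × S3) := ((mcE 1).symm : R33 →L[ℝ] _)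
  have hm : ∀ w, mcE 1 (m w) = w := (mcE 1).apply_symm_apply
  have hm' : ∀ u, m (mcE 1 u) = u := (mcE 1).symm_apply_apply
  let D : HermData :=
    { q := pullQ (S.g.inner 1) m
      j := (mcMap 1).comp ((S.J 1).comp m)
      symm := fun u v ↦ S.g.symm 1 _ _
      pos := fun u hu ↦ S.g.pos 1 _ fun h ↦ hu ((mcE 1).symm.map_eq_zero_iff.1 h)
      sq := fun u ↦ by
        change mcE 1 (S.J 1 (m (mcE 1 (S.J 1 (m u))))) = _
        rw [hm', S.J_sq, map_neg, hm]
      compat := fun u v ↦ by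
        change S.g.inner 1 (m (mcE 1 (S.J 1 (m u)))) (m (mcE 1 (S.J 1 (m v)))) = _
        rw [hm', hm', S.compat]
        rfl }
  -- Left translation by `p` carries the vector `w` at the identity to the value at `p * 1` of the
  -- left-invariant field. The product is kept unsimplified because the tangent spaces at `p * 1`
  -- and `p` are different types.
  have hL : ∀ (p : S3 × S3) (w : R33),
      mfderiv I2 I2 (fun q ↦ p * q) 1 (m w) = inv w (p * 1) := by
    intro p w
    refine (mcE (p * 1)).injective ?_
    rw [mcE_mul_left, hm, mcE_inv]
  have hg : ∀ (p p' : S3 × S3) (u v : R33), p' = p * 1 →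
      S.g.inner p' (inv u p') (inv v p') = D.q u v := by
    rintro p _ u v rfl
    have h := (hS p 1 (m u) (m v)).1
    rw [hL, hL, one_mul] at h
    exact h
  have hJ : ∀ (p p' : S3 × S3) (u : R33), p' = p * 1 → mcE p' (S.J p' (inv u p')) = D.j u := by
    rintro p _ u rfl
    have h := congrArg (mcE (p * 1)) (hS p 1 (m u) (m u)).2
    rw [hL, one_smul, mcE_mul_left] at h
    exact h
  refine ⟨D, AlmostHermitian.ext_of_eq (fun p u v ↦ ?_) fun p u ↦ (mcE p).injective ?_⟩
  · rw [D.inner_apply, ← hg p p _ _ (mul_one p).symm, inv_mcE, inv_mcE]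
  · rw [D.mcE_J, ← hJ p p _ (mul_one p).symm, inv_mcE]

/-- A map acting on the Maurer-Cartan form by a constant automorphism compares left-invariant
structures in the same way at every point. -/
theorem relates_of_mcE {F : S3 × S3 → S3 × S3} {a : S3 × S3}
    (hF : ∀ (p : S3 × S3) (u : TangentSpace I2 p), mcE (F p) (mfderiv I2 I2 F p u) = Ad2 a (mcE p u)) (c ε : ℝ) (D D' : HermData) :
    Relates F c ε D.toAlmostHermitian D'.toAlmostHermitian ↔
      ∀ u v, D'.q (Ad2 a u) (Ad2 a v) = c * D.q u v ∧ D'.j (Ad2 a u) = ε • Ad2 a (D.j u) := by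
  constructor
  · intro h u v
    obtain ⟨h1, h2⟩ := h 1 (inv u 1) (inv v 1)
    rw [D.inner_apply, D'.inner_apply, hF, hF, mcE_inv, mcE_inv] at h1
    have h3 := congrArg (mcE (F 1)) h2
    rw [D'.mcE_J, map_smul, hF, hF, D.mcE_J, mcE_inv] at h3
    exact ⟨h1, h3⟩
  · intro h p u v
    obtain ⟨h1, h2⟩ := h (mcE p u) (mcE p v)
    refine ⟨?_, (mcE (F p)).injective ?_⟩
    · rw [D.inner_apply, D'.inner_apply, hF, hF, h1]
    · rw [D'.mcE_J, map_smul, hF, hF, D.mcE_J, h2]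

theorem relates_conj (a : S3 × S3) (c ε : ℝ) (D D' : HermData) :
    Relates (fun p ↦ a * p * a⁻¹) c ε D.toAlmostHermitian D'.toAlmostHermitian ↔
      ∀ u v, D'.q (Ad2 a u) (Ad2 a v) = c * D.q u v ∧ D'.j (Ad2 a u) = ε • Ad2 a (D.j u) :=
  relates_of_mcE (fun p u ↦ mcE_two_sided a a p u) c ε D D'

theorem relates_groupAct (h : S3 × S3 × S3) (D : HermData) :
    Relates (groupAct h) 1 1 D.toAlmostHermitian D.toAlmostHermitian ↔
      ∀ u v, D.q (Ad2 (h.2.2, h.2.2) u) (Ad2 (h.2.2, h.2.2) v) = D.q u v ∧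
        D.j (Ad2 (h.2.2, h.2.2) u) = Ad2 (h.2.2, h.2.2) (D.j u) := by
  have := relates_of_mcE (F := groupAct h)
    (fun p u ↦ mcE_two_sided (h.1, h.2.1) (h.2.2, h.2.2) p u) 1 1 D D
  simpa using this

/-- The elements `(a₁, a₂, 1)` act by left translations. -/
theorem isLeftInvariant_of_groupAct {S : AlmostHermitian I2 (S3 × S3)}
    (hS : ∀ h : S3 × S3 × S3, Relates (groupAct h) 1 1 S S) : S.IsLeftInvariant := by
  intro a
  have h := hS (a.1, a.2, 1)
  have h2 : groupAct (a.1, a.2, 1) = fun p ↦ a * p := by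
    funext p
    simp [groupAct]
    rfl
  rwa [h2] at h

end Structures

/-! ### The nearly Kähler condition on the Lie algebra -/

section Nearly

open VectorField

theorem mvfderiv_bilin (q : R33 →L[ℝ] R33 →L[ℝ] ℝ) {F G : S3 × S3 → R33} {x : S3 × S3}
    (hF : MDifferentiableAt I2 𝓘(ℝ, R33) F x) (hG : MDifferentiableAt I2 𝓘(ℝ, R33) G x)
    (v : TangentSpace I2 x) :
    mvfderiv I2 (fun p ↦ q (F p) (G p)) x v =
      q (mvfderiv I2 F x v) (G x) + q (F x) (mvfderiv I2 G x v) := by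
  have hq : HasFDerivAt (fun p : R33 × R33 ↦ q p.1 p.2) (q.deriv₂ (F x, G x)) (F x, G x) :=
    q.hasFDerivAt_of_bilinear (hasFDerivAt_fst (𝕜 := ℝ) (p := (F x, G x)))
      (hasFDerivAt_snd (𝕜 := ℝ) (p := (F x, G x)))
  have h := hq.hasMFDerivAt.comp x (hF.hasMFDerivAt.prodMk hG.hasMFDerivAt)
  have h2 := congrArg (fun T ↦ T v) h.mfderiv
  refine h2.trans ?_
  change q.deriv₂ (F x, G x) (mfderiv I2 𝓘(ℝ, R33) F x v, mfderiv I2 𝓘(ℝ, R33) G x v) = _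
  rw [ContinuousLinearMap.coe_deriv₂, add_comm]
  rfl

theorem mvfderiv_clm (L : R33 →L[ℝ] R33) {F : S3 × S3 → R33} {x : S3 × S3}
    (hF : MDifferentiableAt I2 𝓘(ℝ, R33) F x) (v : TangentSpace I2 x) :
    mvfderiv I2 (fun p ↦ L (F p)) x v = L (mvfderiv I2 F x v) := by
  have h := L.hasMFDerivAt.comp x hF.hasMFDerivAt
  exact congrArg (fun T ↦ T v) h.mfderiv

theorem mcE_invConn (Γ : R33 →L[ℝ] R33 →L[ℝ] R33) (Y : ∀ p : S3 × S3, TangentSpace I2 p)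
    (p : S3 × S3) (v : TangentSpace I2 p) :
    mcE p (invConn Γ Y p v) =
      mvfderiv I2 (fun q ↦ mcE q (Y q)) p v + Γ (mcE p v) (mcE p (Y p)) :=
  (mcE p).apply_symm_apply _

theorem mvfderiv_const_inv (w : R33) (x : S3 × S3) :
    mvfderiv I2 (fun q ↦ mcE q (inv w q)) x = 0 := by
  simp only [mcE_inv]
  exact mfderiv_const

/-- Torsion is a tensor, so it can be evaluated on left-invariant fields with the given values,
whose coordinates have zero derivative. -/
theorem torsion_invConn {Γ : R33 →L[ℝ] R33 →L[ℝ] R33} (h : ∀ u v, Γ u v - Γ v u = brk u v) :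
    (invConn Γ).torsion = 0 := by
  funext p
  refine ContinuousLinearMap.ext fun u ↦ ContinuousLinearMap.ext fun v ↦ ?_
  have h1 := (invConn Γ).torsion_apply ((isSmoothField_inv (mcE p u)).diffFieldAt p)
    ((isSmoothField_inv (mcE p v)).diffFieldAt p)
  rw [inv_mcE, inv_mcE] at h1
  rw [h1]
  refine (mcE p).injective ?_
  rw [map_sub, map_sub, mcE_invConn, mcE_invConn, mcE_mlieBracket_inv, mvfderiv_const_inv,
    mvfderiv_const_inv, mcE_inv, mcE_inv, ← h]
  simp

/-- A bilinear map of finite-dimensional spaces is continuous. -/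
def bilinCLM {F : Type*} [NormedAddCommGroup F] [NormedSpace ℝ F] [FiniteDimensional ℝ F]
    (B : R33 →ₗ[ℝ] R33 →ₗ[ℝ] F) : R33 →L[ℝ] R33 →L[ℝ] F :=
  LinearMap.toContinuousLinearMap
    ((LinearMap.toContinuousLinearMap : (R33 →ₗ[ℝ] F) ≃ₗ[ℝ] _).toLinearMap ∘ₗ B)

theorem bilinCLM_apply {F : Type*} [NormedAddCommGroup F] [NormedSpace ℝ F] [FiniteDimensional ℝ F]
    (B : R33 →ₗ[ℝ] R33 →ₗ[ℝ] F) (u v : R33) : bilinCLM B u v = B u v := rfl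

theorem brk_add_left (u v w : R33) : brk (u + v) w = brk u w + brk v w := by
  simp [brk]

theorem brk_add_right (u v w : R33) : brk u (v + w) = brk u v + brk u w := by
  simp [brk]

theorem brk_smul_left (c : ℝ) (u v : R33) : brk (c • u) v = c • brk u v := by
  simp [brk]

theorem brk_smul_right (c : ℝ) (u v : R33) : brk u (c • v) = c • brk u v := by
  simp [brk]

theorem brk_swap (u v : R33) : brk v u = -brk u v := by
  simp [brk]

theorem brk_self (u : R33) : brk u u = 0 := by
  simp [brk]

/-- The Lie bracket of `R33` as a bilinear map. -/
def brkL : R33 →ₗ[ℝ] R33 →ₗ[ℝ] R33 :=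
  LinearMap.mk₂ ℝ brk brk_add_left brk_smul_left brk_add_right brk_smul_right

/-- The Maurer-Cartan equation. -/
theorem mcE_mlieBracket {X Y : ∀ p : S3 × S3, TangentSpace I2 p} {x : S3 × S3}
    (hX : DiffFieldAt X x) (hY : DiffFieldAt Y x) :
    mcE x (mlieBracket I2 X Y x) = mvfderiv I2 (fun q ↦ mcE q (Y q)) x (X x) -
      mvfderiv I2 (fun q ↦ mcE q (X q)) x (Y x) + brk (mcE x (X x)) (mcE x (Y x)) := by
  -- The connection with `Γ = ½ [·, ·]` is torsion-free; on arbitrary fields the vanishing of its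
  -- torsion expresses the bracket by derivatives of coordinates, and the two halves add up to
  -- `brk`.
  have h := (invConn (bilinCLM ((1 / 2 : ℝ) • brkL))).torsion_eq_zero_iff.1
    (torsion_invConn fun u v ↦ by
      simp only [bilinCLM_apply, LinearMap.smul_apply, brkL, LinearMap.mk₂_apply, brk_swap u v]
      module) hX hY
  rw [← h, map_sub, mcE_invConn, mcE_invConn]
  simp only [bilinCLM_apply, LinearMap.smul_apply, brkL, LinearMap.mk₂_apply,
    brk_swap (mcE x (X x)) (mcE x (Y x))]
  module

/-- The Koszul expression for `⟨∇_u v, w⟩`. -/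
def HermData.koszul (D : HermData) (u v w : R33) : ℝ :=
  (D.q (brk u v) w - D.q (brk v w) u + D.q (brk w u) v) / 2

/-- The nearly Kähler condition in terms of the Lie algebra. -/
def HermData.IsNK (D : HermData) : Prop :=
  ∀ w z, D.q (brk w (D.j w)) z - D.q (brk (D.j w) z) w + D.q (brk z w) (D.j w) =
    2 * D.q (brk w (D.j z)) w

theorem HermData.q_j_left (D : HermData) (u v : R33) : D.q (D.j u) v = -D.q u (D.j v) := by
  have h := D.compat u (D.j v)
  rw [D.sq, map_neg] at h
  linarith

/-- The right-hand side is `∇_w (J w) = J ∇_w w` paired with `z`, the outer `J` having been moved to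
`z` by skewness; two terms of the second Koszul expression then coincide and one vanishes. -/
theorem HermData.isNK_iff (D : HermData) :
    D.IsNK ↔ ∀ w z, D.koszul w (D.j w) z = -D.koszul w w (D.j z) := by
  refine forall₂_congr fun w z ↦ ?_
  unfold HermData.koszul
  rw [brk_self, brk_swap w (D.j z)]
  simp only [map_neg, map_zero, neg_apply, zero_apply]
  constructor <;> intro h <;> linarith

theorem HermData.q_eq_of_forall (D : HermData) {u v : R33} (h : ∀ w, D.q u w = D.q v w) :
    u = v := by
  by_contra hne
  have h1 := D.pos (u - v) (sub_ne_zero.2 hne)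
  have h2 := h (u - v)
  rw [← sub_eq_zero, ← sub_apply, ← map_sub] at h2
  exact h1.ne' h2

/-- The scalar product identifies `R33` with its dual, so the functional `D.koszul u v` is
represented by a vector, linear in `u` and `v`. -/
theorem HermData.exists_koszul (D : HermData) :
    ∃ Γ : R33 →L[ℝ] R33 →L[ℝ] R33, ∀ u v w, D.q (Γ u v) w = D.koszul u v w := by
  let Q : R33 →ₗ[ℝ] Module.Dual ℝ R33 :=
    LinearMap.mk₂ ℝ (fun u v ↦ D.q u v) (by simp) (by simp) (by simp) (by simp)
  have hQ : Function.Injective Q := fun u v h ↦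
    D.q_eq_of_forall fun w ↦ congrArg (fun T ↦ T w) h
  let e : R33 ≃ₗ[ℝ] Module.Dual ℝ R33 :=
    LinearEquiv.ofInjectiveOfFinrankEq Q hQ (Subspace.dual_finrank_eq).symm
  let K : R33 →ₗ[ℝ] R33 →ₗ[ℝ] Module.Dual ℝ R33 :=
    LinearMap.mk₂ ℝ (fun u v ↦
      { toFun := D.koszul u v
        map_add' := fun w w' ↦ by
          simp only [koszul, brk_add_left, brk_add_right, map_add, add_apply]
          ring
        map_smul' := fun c w ↦ by
          simp only [koszul, brk_smul_left, brk_smul_right, map_smul, smul_apply,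
            smul_eq_mul, RingHom.id_apply]
          ring })
      (fun u u' v ↦ LinearMap.ext fun w ↦ by
        simp only [koszul, brk_add_left, brk_add_right, map_add, add_apply,
          LinearMap.add_apply, LinearMap.coe_mk, AddHom.coe_mk]
        ring)
      (fun c u v ↦ LinearMap.ext fun w ↦ by
        simp only [koszul, brk_smul_left, brk_smul_right, map_smul, smul_apply,
          LinearMap.smul_apply, LinearMap.coe_mk, AddHom.coe_mk, smul_eq_mul]
        ring)
      (fun u v v' ↦ LinearMap.ext fun w ↦ by
        simp only [koszul, brk_add_left, brk_add_right, map_add, add_apply,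
          LinearMap.add_apply, LinearMap.coe_mk, AddHom.coe_mk]
        ring)
      (fun c u v ↦ LinearMap.ext fun w ↦ by
        simp only [koszul, brk_smul_left, brk_smul_right, map_smul, smul_apply,
          LinearMap.smul_apply, LinearMap.coe_mk, AddHom.coe_mk, smul_eq_mul]
        ring)
  refine ⟨bilinCLM (K.compr₂ e.symm.toLinearMap), fun u v w ↦ ?_⟩
  rw [bilinCLM_apply]
  exact congrArg (fun T ↦ T w) (e.apply_symm_apply (K u v))

/-- On left-invariant fields, metricity and zero torsion determine the connection by the Koszul
formula. Conversely, the connection built from that formula suffices: on a general field it adds the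
derivative of the coordinates, on which the metric and `J` act as constants. -/
theorem HermData.isNearlyKahler_iff (D : HermData) :
    D.toAlmostHermitian.IsNearlyKahler ↔ D.IsNK := by
  rw [D.isNK_iff]
  constructor
  · rintro ⟨nabla, ⟨ht, hm⟩, hJ⟩ w z
    let γ : R33 → R33 → R33 := fun u v ↦ mcE 1 (nabla (inv v) 1 (inv u 1))
    have h1 : ∀ u v, γ u v - γ v u = brk u v := by
      intro u v
      have h := nabla.torsion_eq_zero_iff.1 ht ((isSmoothField_inv u).diffFieldAt 1)
        ((isSmoothField_inv v).diffFieldAt 1)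
      rw [← mcE_mlieBracket_inv u v 1, ← h, map_sub]
    have h2 : ∀ u v w, D.q (γ u v) w + D.q v (γ u w) = 0 := by
      intro u v w
      have h := hm (inv v) (inv w) (isSmoothField_inv v) (isSmoothField_inv w) 1 (inv u 1)
      simp only [D.inner_apply, mcE_inv] at h
      rw [← h]
      have h0 : mvfderiv I2 (fun _ : S3 × S3 ↦ D.q v w) 1 = 0 := mfderiv_const
      rw [h0]
      rfl
    -- The Koszul argument: replace the brackets by differences of `γ` and use the skewness `h2` for
    -- the three cyclic orders.
    have h3 : ∀ u v w, D.q (γ u v) w = D.koszul u v w := by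
      intro u v w
      unfold HermData.koszul
      rw [← h1 u v, ← h1 v w, ← h1 w u]
      simp only [map_sub, sub_apply]
      have e1 := h2 u v w
      have e2 := h2 v w u
      have e3 := h2 w u v
      rw [D.symm v] at e1
      rw [D.symm w] at e2
      rw [D.symm u] at e3
      linarith
    have h4 : γ w (D.j w) = D.j (γ w w) := by
      have h := congrArg (mcE 1) (hJ (inv w) (isSmoothField_inv w) 1)
      rw [D.mcE_J] at h
      have h5 : (fun q ↦ D.toAlmostHermitian.J q (inv w q)) = inv (D.j w) := by
        funext q
        refine (mcE q).injective ?_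
        rw [D.mcE_J, mcE_inv, mcE_inv]
      rw [h5] at h
      exact h
    rw [← h3, ← h3, h4, D.q_j_left]
  · intro h
    obtain ⟨Γ, hΓ⟩ := D.exists_koszul
    refine ⟨invConn Γ, ⟨torsion_invConn fun u v ↦ D.q_eq_of_forall fun w ↦ ?_, ?_⟩, ?_⟩
    · rw [map_sub, sub_apply, hΓ, hΓ]
      unfold HermData.koszul
      rw [brk_swap u v, brk_swap w u, brk_swap v w]
      simp only [map_neg, neg_apply]
      ring
    · intro Y Z hY hZ p v
      simp only [D.inner_apply]
      rw [mvfderiv_bilin D.q (mdifferentiableAt_mcE (hY.diffFieldAt p))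
        (mdifferentiableAt_mcE (hZ.diffFieldAt p)), mcE_invConn, mcE_invConn]
      simp only [map_add, add_apply]
      rw [D.symm (mcE p (Y p)) (Γ _ _), hΓ, hΓ]
      unfold HermData.koszul
      rw [brk_swap (mcE p v) (mcE p (Y p)), brk_swap (mcE p v) (mcE p (Z p)),
        brk_swap (mcE p (Y p)) (mcE p (Z p))]
      simp only [map_neg, neg_apply]
      ring
    · intro X hX p
      refine (mcE p).injective ?_
      rw [D.mcE_J, mcE_invConn, mcE_invConn]
      simp only [D.mcE_J]
      rw [mvfderiv_clm D.j (mdifferentiableAt_mcE (hX.diffFieldAt p)), map_add]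
      -- The derivative terms agree because `j` is constant; the remaining term involves only the
      -- values at `p`, where the hypothesis applies.
      congr 1
      refine D.q_eq_of_forall fun z ↦ ?_
      rw [D.q_j_left, hΓ, hΓ, h]

end Nearly

/-! ### Rotations and frames of `ℝ³` -/

section Frames

open Matrix

/-- `A` is an orthonormal family. -/
def IsON (A : Fin 3 → R3) : Prop := ∀ i j, A i ⬝ᵥ A j = if i = j then 1 else 0

/-- The family `B` diagonalises `Mᵀ M`, so the vectors `M B i` are orthogonal with squared lengths
the eigenvalues. The nonzero ones are normalised and completed to an orthonormal basis `A`; the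
others satisfy `M B i = 0`. -/
theorem exists_svd (M : Matrix (Fin 3) (Fin 3) ℝ) :
    ∃ (A B : Fin 3 → R3) (l : Fin 3 → ℝ), IsON A ∧ IsON B ∧ (∀ i, 0 ≤ l i) ∧
      ∀ i j, A i ⬝ᵥ M *ᵥ B j = if i = j then l i else 0 := by
  have hS : (Mᵀ * M).IsHermitian := by
    rw [Matrix.IsHermitian, conjTranspose_eq_transpose_of_trivial, transpose_mul, transpose_transpose]
  let b := hS.eigenvectorBasis
  let B : Fin 3 → R3 := fun i ↦ WithLp.ofLp (b i)
  have hinner : ∀ x y : EuclideanSpace ℝ (Fin 3), inner ℝ x y = WithLp.ofLp x ⬝ᵥ WithLp.ofLp y := by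
    intro x y
    simp [PiLp.inner_apply, dotProduct, mul_comm]
  have hON : ∀ c : OrthonormalBasis (Fin 3) ℝ (EuclideanSpace ℝ (Fin 3)),
      IsON fun i ↦ WithLp.ofLp (c i) := by
    intro c i j
    rw [← hinner]
    exact orthonormal_iff_ite.1 c.orthonormal i j
  have hB : IsON B := hON b
  have hMB : ∀ i j, (M *ᵥ B i) ⬝ᵥ (M *ᵥ B j) = if i = j then hS.eigenvalues i else 0 := by
    intro i j
    have h1 : (Mᵀ * M) *ᵥ B j = hS.eigenvalues j • B j := hS.mulVec_eigenvectorBasis j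
    calc (M *ᵥ B i) ⬝ᵥ (M *ᵥ B j) = B i ⬝ᵥ ((Mᵀ * M) *ᵥ B j) := by
          rw [← mulVec_mulVec, dotProduct_mulVec (B i), vecMul_transpose]
      _ = _ := by
          rw [h1, dotProduct_smul, hB]
          split_ifs with h <;> simp [h]
  have heig : ∀ i, 0 ≤ hS.eigenvalues i := by
    intro i
    have h := hMB i i
    rw [if_pos rfl] at h
    rw [← h]
    exact Finset.sum_nonneg fun k _ ↦ mul_self_nonneg _
  let s : Set (Fin 3) := {i | hS.eigenvalues i ≠ 0}
  let v : Fin 3 → EuclideanSpace ℝ (Fin 3) := fun i ↦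
    WithLp.toLp 2 ((√(hS.eigenvalues i))⁻¹ • (M *ᵥ B i))
  have hv : Orthonormal ℝ (s.domRestrict v) := by
    rw [orthonormal_iff_ite]
    rintro ⟨i, hi⟩ ⟨j, hj⟩
    change inner ℝ (v i) (v j) = _
    rw [hinner]
    simp only [v, smul_dotProduct, dotProduct_smul, hMB, Subtype.mk.injEq]
    split_ifs with h
    · subst h
      have h0 : √(hS.eigenvalues i) ≠ 0 := (Real.sqrt_ne_zero (heig i)).2 hi
      have h2 := Real.mul_self_sqrt (heig i)
      simp only [smul_eq_mul]
      field_simp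
      rw [sq, h2]
    · simp
  obtain ⟨c, hc⟩ := hv.exists_orthonormalBasis_extension_of_card_eq (by simp)
  refine ⟨fun i ↦ WithLp.ofLp (c i), B, fun i ↦ √(hS.eigenvalues i), hON c, hB,
    fun i ↦ Real.sqrt_nonneg _, fun i j ↦ ?_⟩
  have hMv : M *ᵥ B j = √(hS.eigenvalues j) • WithLp.ofLp (c j) := by
    by_cases hj : hS.eigenvalues j = 0
    · have h := hMB j j
      rw [if_pos rfl, hj, dotProduct_self_eq_zero] at h
      rw [h, hj, Real.sqrt_zero, zero_smul]
    · have h0 : √(hS.eigenvalues j) ≠ 0 := (Real.sqrt_ne_zero (heig j)).2 hj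
      rw [hc j hj]
      simp [v, smul_smul, h0]
  rw [hMv, dotProduct_smul]
  have := hON c i j
  dsimp only at this ⊢
  rw [this]
  split_ifs with h <;> simp [h]

/-- A right-handed frame of `ℝ³`. -/
structure IsFrame (A : Fin 3 → R3) : Prop where
  c01 : A 0 ⨯₃ A 1 = A 2
  c12 : A 1 ⨯₃ A 2 = A 0
  c20 : A 2 ⨯₃ A 0 = A 1
  ne : A 0 ≠ 0

/-- Each vector is the cross product of the other two, hence orthogonal to them, and each squared
length is the product of the other two. As one of them is positive, all are 1. -/
theorem IsFrame.isON {A : Fin 3 → R3} (h : IsFrame A) : IsON A := by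
  have o01 : A 0 ⬝ᵥ A 1 = 0 := by rw [← h.c12, dotProduct_comm, dot_self_cross]
  have o02 : A 0 ⬝ᵥ A 2 = 0 := by rw [← h.c01, dot_self_cross]
  have o12 : A 1 ⬝ᵥ A 2 = 0 := by rw [← h.c01, dot_cross_self]
  have n2 : A 2 ⬝ᵥ A 2 = (A 0 ⬝ᵥ A 0) * (A 1 ⬝ᵥ A 1) := by
    conv_lhs => rw [← h.c01]
    rw [cross_dot_cross, o01]; simp
  have n0 : A 0 ⬝ᵥ A 0 = (A 1 ⬝ᵥ A 1) * (A 2 ⬝ᵥ A 2) := by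
    conv_lhs => rw [← h.c12]
    rw [cross_dot_cross, o12]; simp
  have n1 : A 1 ⬝ᵥ A 1 = (A 2 ⬝ᵥ A 2) * (A 0 ⬝ᵥ A 0) := by
    conv_lhs => rw [← h.c20]
    rw [cross_dot_cross, dotProduct_comm (A 2), o02]; simp
  have p : ∀ i, 0 ≤ A i ⬝ᵥ A i := fun i ↦ Finset.sum_nonneg fun k _ ↦ mul_self_nonneg _
  have p0 : 0 < A 0 ⬝ᵥ A 0 := lt_of_le_of_ne (p 0) fun h0 ↦ h.ne (dotProduct_self_eq_zero.1 h0.symm)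
  have key : ∀ x y z : ℝ, 0 < x → 0 ≤ y → 0 ≤ z → z = x * y → x = y * z → y = z * x →
      x = 1 ∧ y = 1 ∧ z = 1 := by
    intro x y z hx hy hz h1 h2 h3
    have hxy : x = y := by
      have e : (x - y) * (x + y) = 0 := by linear_combination x * h2 - y * h3
      rcases mul_eq_zero.1 e with h | h <;> linarith
    subst hxy
    have hz1 : z = 1 := mul_left_cancel₀ hx.ne' (by linarith)
    have hx1 : (x - 1) * (x + 1) = 0 := by linear_combination hz1 - h1
    rcases mul_eq_zero.1 hx1 with h | h
    · exact ⟨by linarith, by linarith, hz1⟩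
    · linarith
  obtain ⟨x0, x1, x2⟩ := key _ _ _ p0 (p 1) (p 2) n2 n0 n1
  intro i j
  fin_cases i <;> fin_cases j <;>
    simp [x0, x1, x2, o01, o02, o12, dotProduct_comm (A 1) (A 0), dotProduct_comm (A 2) (A 0),
      dotProduct_comm (A 2) (A 1)]

theorem IsON.neg {A : Fin 3 → R3} (h : IsON A) : IsON (-A) := by
  intro i j
  rw [Pi.neg_apply, Pi.neg_apply, neg_dotProduct, dotProduct_neg, neg_neg, h]

theorem IsON.isFrame {A : Fin 3 → R3} (h : IsON A) (h2 : A 0 ⨯₃ A 1 = A 2) : IsFrame A := by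
  have o01 : A 0 ⬝ᵥ A 1 = 0 := h 0 1
  have o00 : A 0 ⬝ᵥ A 0 = 1 := h 0 0
  have o11 : A 1 ⬝ᵥ A 1 = 1 := h 1 1
  refine ⟨h2, ?_, ?_, ?_⟩
  · rw [← h2]
    have : A 1 ⨯₃ (A 0 ⨯₃ A 1) = (A 1 ⬝ᵥ A 1) • A 0 - (A 0 ⬝ᵥ A 1) • A 1 := by
      ext i
      fin_cases i <;> simp [cross_apply, dotProduct, Fin.sum_univ_three] <;> ring
    rw [this, o11, o01]; simp
  · rw [← h2]
    have : (A 0 ⨯₃ A 1) ⨯₃ A 0 = (A 0 ⬝ᵥ A 0) • A 1 - (A 0 ⬝ᵥ A 1) • A 0 := by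
      ext i
      fin_cases i <;> simp [cross_apply, dotProduct, Fin.sum_univ_three] <;> ring
    rw [this, o00, o01]; simp
  · intro h0
    rw [h0] at o00
    simp at o00

/-- The cross product of `A 0` and `A 1` is `t A 2`, where `t` is the determinant, so `t = ±1`; in
odd dimension negating the whole family reverses the orientation. -/
theorem IsON.isFrame_or {A : Fin 3 → R3} (h : IsON A) : IsFrame A ∨ IsFrame (-A) := by
  set t := (A 0 ⨯₃ A 1) ⬝ᵥ A 2 with ht
  have hdet : t ^ 2 = 1 := by
    have h1 : (Matrix.of A) * (Matrix.of A)ᵀ = 1 := by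
      ext i j
      rw [Matrix.one_apply, ← h i j]
      rfl
    have h2 := congrArg det h1
    rw [det_mul, det_transpose, det_one] at h2
    have h3 : t = det (Matrix.of A) := by
      rw [ht, det_fin_three, dotProduct, Fin.sum_univ_three]
      simp [cross_apply]
      ring
    rw [h3, sq, h2]
  have o01 : A 0 ⬝ᵥ A 1 = 0 := h 0 1
  have o00 : A 0 ⬝ᵥ A 0 = 1 := h 0 0
  have o11 : A 1 ⬝ᵥ A 1 = 1 := h 1 1
  have o22 : A 2 ⬝ᵥ A 2 = 1 := h 2 2
  have hc : A 0 ⨯₃ A 1 = t • A 2 := by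
    rw [← sub_eq_zero, ← dotProduct_self_eq_zero]
    simp only [sub_dotProduct, dotProduct_sub, smul_dotProduct, dotProduct_smul, smul_eq_mul, o22,
      dotProduct_comm (A 2) (A 0 ⨯₃ A 1), ← ht]
    rw [cross_dot_cross, o01, o00, o11]
    linarith
  have h1 : (t - 1) * (t + 1) = 0 := by linarith
  rcases mul_eq_zero.1 h1 with h1 | h1
  · left
    refine h.isFrame ?_
    rw [hc, show t = 1 by linarith, one_smul]
  · right
    refine h.neg.isFrame ?_
    rw [Pi.neg_apply, Pi.neg_apply, Pi.neg_apply, map_neg, map_neg, LinearMap.neg_apply, neg_neg, hc,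
      show t = -1 by linarith, neg_one_smul]

theorem imQ_mul (x y : R3) :
    imQ x * imQ y = mkQ (-(x ⬝ᵥ y) / 4) 0 0 0 + (1 / 2 : ℝ) • imQ (x ⨯₃ y) := by
  ext <;> simp [imQ_apply, cross_apply, dotProduct, Fin.sum_univ_three] <;> ring

/-- The imaginary quaternions `2 imQ (A i)` satisfy the multiplication rules of `i`, `j`, `k`, so
`exists_Ad_eq` applies; the factor 2 undoes the normalisation of `imQ`. -/
theorem exists_Ad_frame {A : Fin 3 → R3} (h : IsFrame A) :
    ∃ g : S3, ∀ i, Ad g (Pi.single i 1) = A i := by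
  have hON := h.isON
  have o01 : A 0 ⬝ᵥ A 1 = 0 := hON 0 1
  have o10 : A 1 ⬝ᵥ A 0 = 0 := hON 1 0
  have o00 : A 0 ⬝ᵥ A 0 = 1 := hON 0 0
  have o11 : A 1 ⬝ᵥ A 1 = 1 := hON 1 1
  have hm : ∀ x y : R3, ((2 : ℝ) • imQ x) * ((2 : ℝ) • imQ y) =
      mkQ (-(x ⬝ᵥ y)) 0 0 0 + (2 : ℝ) • imQ (x ⨯₃ y) := by
    intro x y
    rw [smul_mul_smul_comm, imQ_mul]
    ext <;> simp <;> ring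
  have hsq : ∀ x : R3, x ⬝ᵥ x = 1 → ((2 : ℝ) • imQ x) * ((2 : ℝ) • imQ x) = -1 := by
    intro x hx
    rw [hm, hx, cross_self]
    ext <;> simp
  have hz : mkQ (-(0 : ℝ)) 0 0 0 = 0 := by ext <;> simp
  have hre : ∀ x : R3, ((2 : ℝ) • imQ x).re = 0 := by
    intro x
    simp [imQ_apply]
  obtain ⟨g, hg0, hg1⟩ := exists_Ad_eq (a := (2 : ℝ) • imQ (A 0)) (b := (2 : ℝ) • imQ (A 1))
    (c := (2 : ℝ) • imQ (A 2)) (hsq _ o00) (hsq _ o11)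
    (by rw [hm, o01, h.c01, hz, zero_add])
    (by rw [hm, o10, ← cross_anticomm, h.c01, hz, zero_add, map_neg, smul_neg])
    (hre _) (hre _) (hre _)
  have hs0 : imQ (Pi.single 0 1) = (1 / 2 : ℝ) • mkQ 0 1 0 0 := by
    ext <;> simp [imQ_apply]
  have hs1 : imQ (Pi.single 1 1) = (1 / 2 : ℝ) • mkQ 0 0 1 0 := by
    ext <;> simp [imQ_apply]
  have e0 : Ad g (Pi.single 0 1) = A 0 := by
    apply imQ_injective
    rw [imQ_Ad, hs0, ← mul_assoc, mul_smul_comm, hg0, smul_mul_assoc, mul_assoc, self_mul_star_S3,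
      mul_one, smul_smul]
    norm_num
  have e1 : Ad g (Pi.single 1 1) = A 1 := by
    apply imQ_injective
    rw [imQ_Ad, hs1, ← mul_assoc, mul_smul_comm, hg1, smul_mul_assoc, mul_assoc, self_mul_star_S3,
      mul_one, smul_smul]
    norm_num
  have e2 : Ad g (Pi.single 2 1) = A 2 := by
    have : (Pi.single 2 1 : R3) = Pi.single 0 1 ⨯₃ Pi.single 1 1 := by
      ext i; fin_cases i <;> simp [cross_apply]
    rw [this, Ad_cross, e0, e1, h.c01]
  refine ⟨g, fun i ↦ ?_⟩
  fin_cases i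
  exacts [e0, e1, e2]

theorem isFrame_Ad (g : S3) : IsFrame fun i ↦ Ad g (Pi.single i 1) := by
  constructor
  · rw [← Ad_cross]; congr 1; ext i; fin_cases i <;> simp [cross_apply]
  · rw [← Ad_cross]; congr 1; ext i; fin_cases i <;> simp [cross_apply]
  · rw [← Ad_cross]; congr 1; ext i; fin_cases i <;> simp [cross_apply]
  · intro h0
    have h1 := Ad_dot g (Pi.single 0 1) (Pi.single 0 1)
    rw [h0] at h1
    simp at h1

/-- Rotations suffice at the price of one common sign: replacing a left-handed family by its
negative changes the sign of all `l i` together, which preserves the products `l i * l j`. -/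
theorem exists_svd_Ad (M : Matrix (Fin 3) (Fin 3) ℝ) :
    ∃ (g h : S3) (l : Fin 3 → ℝ), (∀ i j, 0 ≤ l i * l j) ∧
      ∀ i j, Ad g (Pi.single i 1) ⬝ᵥ M *ᵥ Ad h (Pi.single j 1) = if i = j then l i else 0 := by
  obtain ⟨A, B, l, hA, hB, hl, h⟩ := exists_svd M
  have hl2 : ∀ i j, 0 ≤ l i * l j := fun i j ↦ mul_nonneg (hl i) (hl j)
  rcases hA.isFrame_or with hA | hA <;> rcases hB.isFrame_or with hB | hB <;>
    obtain ⟨a, ha⟩ := exists_Ad_frame hA <;> obtain ⟨b, hb⟩ := exists_Ad_frame hB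
  · exact ⟨a, b, l, hl2, fun i j ↦ by rw [ha, hb, h]⟩
  · refine ⟨a, b, -l, by simpa using hl2, fun i j ↦ ?_⟩
    rw [ha, hb, Pi.neg_apply, mulVec_neg, dotProduct_neg, h]; split_ifs <;> simp
  · refine ⟨a, b, -l, by simpa using hl2, fun i j ↦ ?_⟩
    rw [ha, hb, Pi.neg_apply, neg_dotProduct, h]; split_ifs <;> simp
  · refine ⟨a, b, l, hl2, fun i j ↦ ?_⟩
    rw [ha, hb, Pi.neg_apply, Pi.neg_apply, neg_dotProduct, mulVec_neg, dotProduct_neg, h, neg_neg]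

end Frames

/-! ### Classification of nearly Kähler structures on the Lie algebra -/

section Classification

open Matrix

variable {D : HermData}

/-- The Kähler form on the Lie algebra. -/
def HermData.om (D : HermData) (u v : R33) : ℝ := D.q (D.j u) v

theorem HermData.om_swap (D : HermData) (u v : R33) : D.om v u = -D.om u v := by
  rw [HermData.om, HermData.om, D.q_j_left, D.symm]

theorem HermData.om_j (D : HermData) (u v : R33) : D.om u (D.j v) = D.q u v := D.compat u v

theorem HermData.q_j_right (D : HermData) (u v : R33) : D.q u (D.j v) = -D.om u v := by
  rw [HermData.om, D.q_j_left, neg_neg]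

theorem HermData.om_add_left (D : HermData) (u u' v : R33) :
    D.om (u + u') v = D.om u v + D.om u' v := by simp [HermData.om]

theorem HermData.om_smul_left (D : HermData) (c : ℝ) (u v : R33) :
    D.om (c • u) v = c * D.om u v := by simp [HermData.om]

theorem HermData.om_add_right (D : HermData) (u v v' : R33) :
    D.om u (v + v') = D.om u v + D.om u v' := by simp [HermData.om]

theorem HermData.om_smul_right (D : HermData) (c : ℝ) (u v : R33) :
    D.om u (c • v) = c * D.om u v := by simp [HermData.om]

/-- Up to sign, the differential of the Kähler form. -/
def HermData.rho (D : HermData) (u v w : R33) : ℝ :=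
  D.om (brk u v) w + D.om (brk v w) u + D.om (brk w u) v

/-- The tensor `⟨(∇_u J) v, w⟩`. -/
def HermData.T (D : HermData) (u v w : R33) : ℝ := D.koszul u (D.j v) w + D.koszul u v (D.j w)

theorem HermData.koszul_skew (D : HermData) (u v w : R33) :
    D.koszul u w v = -D.koszul u v w := by
  unfold HermData.koszul
  rw [brk_swap u v, brk_swap v w, brk_swap w u]
  simp only [map_neg, _root_.neg_apply]
  ring

theorem HermData.T_skew_right (D : HermData) (u v w : R33) : D.T u w v = -D.T u v w := by
  unfold HermData.T
  rw [D.koszul_skew u v (D.j w), D.koszul_skew u (D.j v) w]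
  ring

theorem HermData.koszul_add_left (D : HermData) (u u' v w : R33) :
    D.koszul (u + u') v w = D.koszul u v w + D.koszul u' v w := by
  simp only [koszul, brk_add_left, brk_add_right, map_add, _root_.add_apply]
  ring

theorem HermData.koszul_add_mid (D : HermData) (u v v' w : R33) :
    D.koszul u (v + v') w = D.koszul u v w + D.koszul u v' w := by
  simp only [koszul, brk_add_left, brk_add_right, map_add, _root_.add_apply]
  ring

theorem HermData.koszul_neg_mid (D : HermData) (u v w : R33) :
    D.koszul u (-v) w = -D.koszul u v w := by
  have h := D.koszul_add_mid u v (-v) w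
  have h0 : D.koszul u 0 w = 0 := by
    simp [koszul, brk, Prod.mk_zero_zero]
  rw [add_neg_cancel, h0] at h
  linarith

theorem HermData.koszul_neg_right (D : HermData) (u v w : R33) :
    D.koszul u v (-w) = -D.koszul u v w := by
  rw [D.koszul_skew, D.koszul_neg_mid, D.koszul_skew u v w, neg_neg]

theorem HermData.T_j (D : HermData) (u v w : R33) : D.T u (D.j v) w = D.T u v (D.j w) := by
  unfold HermData.T
  rw [D.sq, D.sq, D.koszul_neg_mid, D.koszul_neg_right]
  ring

theorem HermData.T_add_left (D : HermData) (u u' v w : R33) :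
    D.T (u + u') v w = D.T u v w + D.T u' v w := by
  simp only [T, koszul_add_left]
  ring

theorem HermData.T_add_mid (D : HermData) (u v v' w : R33) :
    D.T u (v + v') w = D.T u v w + D.T u v' w := by
  simp only [T, koszul_add_mid, map_add]
  ring

theorem HermData.IsNK.T_self (h : D.IsNK) (w z : R33) : D.T w w z = 0 := by
  unfold HermData.T
  rw [D.isNK_iff.1 h]
  ring

/-- Polarisation of `(∇_w J) w = 0`. -/
theorem HermData.IsNK.T_skew (h : D.IsNK) (u v w : R33) : D.T v u w = -D.T u v w := by
  have h1 := h.T_self (u + v) w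
  rw [D.T_add_left, D.T_add_mid, D.T_add_mid, h.T_self, h.T_self] at h1
  linarith

theorem HermData.T_cyclic_sum (D : HermData) (u v w : R33) :
    D.T u v w + D.T v w u + D.T w u v = -D.rho u v w := by
  simp only [T, koszul, rho]
  simp only [D.q_j_right]
  ring

/-- Total skewness makes the three cyclic terms equal; in other words `3 ∇ω = dω`. -/
theorem HermData.IsNK.three_T (h : D.IsNK) (u v w : R33) : 3 * D.T u v w = -D.rho u v w := by
  rw [← D.T_cyclic_sum u v w, D.T_skew_right v u w, h.T_skew u v w, h.T_skew u w v,
    D.T_skew_right u v w]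
  ring

/-- Inherited from `T_j`. Together with `rho_j_left` it says that `dω` has type (3,0) + (0,3), the
source of all linear restrictions on `J`. -/
theorem HermData.IsNK.rho_j_right (h : D.IsNK) (u v w : R33) :
    D.rho u (D.j v) w = D.rho u v (D.j w) := by
  have h1 := h.three_T u (D.j v) w
  have h2 := h.three_T u v (D.j w)
  rw [D.T_j] at h1
  linarith

theorem HermData.IsNK.rho_j_left (h : D.IsNK) (u v w : R33) :
    D.rho (D.j u) v w = D.rho u (D.j v) w := by
  have h1 := h.three_T (D.j u) v w
  have h2 := h.three_T u (D.j v) w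
  rw [h.T_skew v (D.j u) w, D.T_j, h.T_skew u v, neg_neg] at h1
  rw [D.T_j] at h2
  linarith

theorem HermData.rho_self (D : HermData) (u w : R33) : D.rho u u w = 0 := by
  unfold HermData.rho
  rw [brk_self, brk_swap w u]
  simp [HermData.om]

/-! #### Coordinates -/

/-- The basis vectors of the first factor. -/
def ee (i : Fin 3) : R33 := (Pi.single i 1, 0)

/-- The basis vectors of the second factor. -/
def ff (i : Fin 3) : R33 := (0, Pi.single i 1)

theorem eq_sum_ee_ff (u : R33) : u = u.1 0 • ee 0 + u.1 1 • ee 1 + u.1 2 • ee 2 +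
    (u.2 0 • ff 0 + u.2 1 • ff 1 + u.2 2 • ff 2) := by
  ext i <;> fin_cases i <;> simp [ee, ff]

/-- In the standard basis, the mixed part of the Kähler form is diagonal. -/
def HermData.IsDiag (D : HermData) (l : Fin 3 → ℝ) : Prop :=
  ∀ i j, D.om (ee i) (ff j) = if i = j then l i else 0

theorem HermData.om_self (D : HermData) (u : R33) : D.om u u = 0 := by
  have := D.om_swap u u
  linarith

theorem HermData.IsDiag.om_eq {l : Fin 3 → ℝ} (h : D.IsDiag l) (u v : R33) :
    D.om u v = l 0 * (u.1 0 * v.2 0 - u.2 0 * v.1 0) + l 1 * (u.1 1 * v.2 1 - u.2 1 * v.1 1) +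
      l 2 * (u.1 2 * v.2 2 - u.2 2 * v.1 2) +
      (D.om (ee 1) (ee 2) * (u.1 1 * v.1 2 - u.1 2 * v.1 1) +
        D.om (ee 2) (ee 0) * (u.1 2 * v.1 0 - u.1 0 * v.1 2) +
        D.om (ee 0) (ee 1) * (u.1 0 * v.1 1 - u.1 1 * v.1 0)) +
      (D.om (ff 1) (ff 2) * (u.2 1 * v.2 2 - u.2 2 * v.2 1) +
        D.om (ff 2) (ff 0) * (u.2 2 * v.2 0 - u.2 0 * v.2 2) +
        D.om (ff 0) (ff 1) * (u.2 0 * v.2 1 - u.2 1 * v.2 0)) := by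
  have hfe : ∀ i j, D.om (ff i) (ee j) = -D.om (ee j) (ff i) := fun i j ↦ D.om_swap _ _
  conv_lhs => rw [eq_sum_ee_ff u, eq_sum_ee_ff v]
  generalize u.1 0 = x0, u.1 1 = x1, u.1 2 = x2, u.2 0 = y0, u.2 1 = y1, u.2 2 = y2
  simp only [D.om_add_left, D.om_smul_left, D.om_add_right, D.om_smul_right, D.om_self]
  rw [hfe 0 0, hfe 0 1, hfe 0 2, hfe 1 0, hfe 1 1, hfe 1 2, hfe 2 0, hfe 2 1, hfe 2 2]
  rw [D.om_swap (ee 0) (ee 1), D.om_swap (ee 1) (ee 2), D.om_swap (ee 2) (ee 0),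
    D.om_swap (ff 0) (ff 1), D.om_swap (ff 1) (ff 2), D.om_swap (ff 2) (ff 0)]
  rw [h 0 0, h 0 1, h 0 2, h 1 0, h 1 1, h 1 2, h 2 0, h 2 1, h 2 2]
  simp only [Fin.isValue, reduceIte, zero_ne_one, one_ne_zero, Fin.reduceEq]
  ring

/-- The summands of `rho` in coordinates. -/
def triple (l : Fin 3 → ℝ) (x y z : R3) : ℝ :=
  l 0 * ((x 1 * y 2 - x 2 * y 1) * z 0) + l 1 * ((x 2 * y 0 - x 0 * y 2) * z 1) +
    l 2 * ((x 0 * y 1 - x 1 * y 0) * z 2)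

/-- The six coefficients of the pure parts cancel: an invariant 2-form on `S³` is closed, by the
Jacobi identity for the cross product. -/
theorem HermData.IsDiag.rho_eq {l : Fin 3 → ℝ} (h : D.IsDiag l) (u v w : R33) :
    D.rho u v w = triple l u.1 v.1 w.2 + triple l v.1 w.1 u.2 + triple l w.1 u.1 v.2 -
      triple l u.2 v.2 w.1 - triple l v.2 w.2 u.1 - triple l w.2 u.2 v.1 := by
  have key := h.om_eq
  generalize D.om (ee 1) (ee 2) = a0, D.om (ee 2) (ee 0) = a1, D.om (ee 0) (ee 1) = a2,
    D.om (ff 1) (ff 2) = b0, D.om (ff 2) (ff 0) = b1, D.om (ff 0) (ff 1) = b2 at key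
  simp only [HermData.rho, key, brk, cross_apply, triple]
  simp
  ring

end Classification

/-! ### Diagonal mixed part with nonzero entries: determination of `J` and the metric. -/

section Classification

open Matrix

variable {D : HermData}

/-- The form `rho` in coordinates. -/
def rhoF (l : Fin 3 → ℝ) (u v w : R33) : ℝ :=
  triple l u.1 v.1 w.2 + triple l v.1 w.1 u.2 + triple l w.1 u.1 v.2 -
    triple l u.2 v.2 w.1 - triple l v.2 w.2 u.1 - triple l w.2 u.2 v.1

/-- Contracting `rhoF` with `ee i` leaves a 2-form whose kernel is the plane of `ee i` and `ff i`;
testing it on basis vectors kills the other four coordinates. -/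
theorem eq_smul_ee_of_rhoF {l : Fin 3 → ℝ} (hl : ∀ i, l i ≠ 0) (i : Fin 3) (p : R33)
    (h : ∀ w, rhoF l (ee i) p w = 0) : p = p.1 i • ee i + p.2 i • ff i := by
  have he := fun k ↦ h (ee k)
  have hf := fun k ↦ h (ff k)
  have l0 := hl 0
  have l1 := hl 1
  have l2 := hl 2
  have e0 := he 0
  have e1 := he 1
  have e2 := he 2
  have f0 := hf 0
  have f1 := hf 1
  have f2 := hf 2
  fin_cases i <;> simp [rhoF, triple, ee, ff, l0, l1, l2] at e0 e1 e2 f0 f1 f2 <;>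
    ext k <;> fin_cases k <;> simp [ee, ff, *] <;> simp_all

theorem eq_smul_ff_of_rhoF {l : Fin 3 → ℝ} (hl : ∀ i, l i ≠ 0) (i : Fin 3) (p : R33)
    (h : ∀ w, rhoF l (ff i) p w = 0) : p = p.1 i • ee i + p.2 i • ff i := by
  have he := fun k ↦ h (ee k)
  have hf := fun k ↦ h (ff k)
  have l0 := hl 0
  have l1 := hl 1
  have l2 := hl 2
  have e0 := he 0
  have e1 := he 1
  have e2 := he 2
  have f0 := hf 0
  have f1 := hf 1
  have f2 := hf 2
  fin_cases i <;> simp [rhoF, triple, ee, ff, l0, l1, l2] at e0 e1 e2 f0 f1 f2 <;>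
    ext k <;> fin_cases k <;> simp [ee, ff, *] <;> simp_all

theorem HermData.no_real_eigenvector (D : HermData) {u : R33} (hu : u ≠ 0) (t : ℝ) :
    D.j u ≠ t • u := by
  intro h
  have h1 := D.sq u
  rw [h, map_smul, h, smul_smul] at h1
  have h2 : (t * t + 1) • u = 0 := by
    rw [add_smul, h1, one_smul, neg_add_cancel]
  rcases smul_eq_zero.1 h2 with h3 | h3
  · nlinarith
  · exact hu h3

theorem ee_ne_zero (i : Fin 3) : ee i ≠ 0 := by
  intro h
  have := congrFun (congrArg Prod.fst h) i
  simp [ee] at this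

/-- Coefficients of `J` when the mixed part of the Kähler form is diagonal and invertible. -/
theorem HermData.IsNK.exists_coeff (hD : D.IsNK) {l : Fin 3 → ℝ} (h : D.IsDiag l)
    (hl : ∀ i, l i ≠ 0) : ∃ a b c : Fin 3 → ℝ, (∀ i, D.j (ee i) = a i • ee i + c i • ff i) ∧
      (∀ i, D.j (ff i) = b i • ee i - a i • ff i) ∧ (∀ i, a i ^ 2 + b i * c i = -1) := by
  have hr : ∀ u v w, D.rho u v w = rhoF l u v w := h.rho_eq
  have hE : ∀ i, D.j (ee i) = (D.j (ee i)).1 i • ee i + (D.j (ee i)).2 i • ff i := by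
    intro i
    refine eq_smul_ee_of_rhoF hl i _ fun w ↦ ?_
    -- Moving `J` to the last argument leaves `rho` with a repeated argument.
    rw [← hr, hD.rho_j_right, D.rho_self]
  have hF : ∀ i, D.j (ff i) = (D.j (ff i)).1 i • ee i + (D.j (ff i)).2 i • ff i := by
    intro i
    refine eq_smul_ff_of_rhoF hl i _ fun w ↦ ?_
    rw [← hr, hD.rho_j_right, D.rho_self]
  have key : ∀ i, (D.j (ff i)).2 i = -(D.j (ee i)).1 i ∧
      (D.j (ee i)).1 i ^ 2 + (D.j (ff i)).1 i * (D.j (ee i)).2 i = -1 := by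
    intro i
    have h1 := D.sq (ee i)
    have hEi := hE i
    have hFi := hF i
    generalize (D.j (ee i)).1 i = a at *
    generalize (D.j (ee i)).2 i = c at *
    generalize (D.j (ff i)).1 i = b at *
    generalize (D.j (ff i)).2 i = d at *
    rw [hEi, map_add, map_smul, map_smul, hEi, hFi] at h1
    have x1 := congrFun (congrArg Prod.fst h1) i
    have x2 := congrFun (congrArg Prod.snd h1) i
    simp [ee, ff] at x1 x2
    -- With `c = 0` the first coordinate of `J² = -1` would read `a² = -1`. The second one then
    -- gives trace zero.
    have hc : c ≠ 0 := by
      rintro rfl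
      nlinarith
    refine ⟨?_, by linarith⟩
    have : c * (a + d) = 0 := by linarith
    have := (mul_eq_zero.1 this).resolve_left hc
    linarith
  refine ⟨fun i ↦ (D.j (ee i)).1 i, fun i ↦ (D.j (ff i)).1 i, fun i ↦ (D.j (ee i)).2 i, hE,
    fun i ↦ ?_, fun i ↦ (key i).2⟩
  conv_lhs => rw [hF i, (key i).1]
  rw [neg_smul, sub_eq_add_neg]

theorem brk_ee (i : Fin 3) : brk (ee i) (ee (i + 1)) = ee (i + 2) := by
  ext k <;> fin_cases i <;> fin_cases k <;> simp [brk, ee, cross_apply]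

theorem brk_ff (i : Fin 3) : brk (ff i) (ff (i + 1)) = ff (i + 2) := by
  ext k <;> fin_cases i <;> fin_cases k <;> simp [brk, ff, cross_apply]

theorem brk_ee_ff (i k : Fin 3) : brk (ee i) (ff k) = 0 := by
  simp [brk, ee, ff, Prod.mk_zero_zero]

theorem brk_ff_ee (i k : Fin 3) : brk (ff i) (ee k) = 0 := by
  simp [brk, ee, ff, Prod.mk_zero_zero]

/-- Each quadratic equation, simplified by the linear ones, fixes a combination of the products `a i
* a j`; together they make all three products `1/3`, so the `a i` coincide. Then the `c i ^ 2`
coincide, hence so do the `l i ^ 2`, and the common sign makes the `l i` equal. The linear relations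
finally give `c = 2a`. -/
theorem coeff_eq {a c l : Fin 3 → ℝ} {k : ℝ} (hl : ∀ i, l i ≠ 0) (hs : ∀ i k, 0 ≤ l i * l k)
    (hc2 : ∀ i, c i ^ 2 = 1 + a i ^ 2) (hk : ∀ i, c i * l i = k)
    (A0 : (a 0 + a 2) * l 2 = c 0 * l 1) (B0 : (a 1 + a 2) * l 2 = c 1 * l 0)
    (B1 : (a 2 + a 0) * l 0 = c 2 * l 1) (B2 : (a 0 + a 1) * l 1 = c 0 * l 2)
    (T0 : 3 * ((-(a 1 * (a 2 * l 2)) + c 1 * (a 0 * l 0)) / 2 +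
      (a 2 * (a 2 * l 2) + -(c 2 * k)) / 2) = -l 2)
    (T1 : 3 * ((-(a 2 * (a 0 * l 0)) + c 2 * (a 1 * l 1)) / 2 +
      (a 0 * (a 0 * l 0) + -(c 0 * k)) / 2) = -l 0)
    (T2 : 3 * ((-(a 0 * (a 1 * l 1)) + c 0 * (a 2 * l 2)) / 2 +
      (a 1 * (a 1 * l 1) + -(c 1 * k)) / 2) = -l 1) :
    a 2 ^ 2 = 1 / 3 ∧ (∀ i, a i = a 2) ∧ ∀ i, c i = 2 * a 2 := by
  have l0 := hl 0
  have l1 := hl 1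
  have l2 := hl 2
  have p0 : a 0 * a 1 + a 0 * a 2 - a 1 * a 2 = 1 / 3 := by
    refine mul_right_cancel₀ l2 ?_
    linear_combination (2 / 3) * T0 + a 0 * B0 - c 2 * hk 2 + l 2 * hc2 2
  have p1 : a 1 * a 2 + a 1 * a 0 - a 2 * a 0 = 1 / 3 := by
    refine mul_right_cancel₀ l0 ?_
    linear_combination (2 / 3) * T1 + a 1 * B1 - c 0 * hk 0 + l 0 * hc2 0
  have p2 : a 2 * a 0 + a 2 * a 1 - a 0 * a 1 = 1 / 3 := by
    refine mul_right_cancel₀ l1 ?_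
    linear_combination (2 / 3) * T2 + a 2 * B2 - c 1 * hk 1 + l 1 * hc2 1
  have a01 : a 0 * a 1 = 1 / 3 := by linarith
  have a02 : a 0 * a 2 = 1 / 3 := by linarith
  have a12 : a 1 * a 2 = 1 / 3 := by linarith
  have ne0 : a 0 ≠ 0 := by
    intro h0; rw [h0] at a01; norm_num at a01
  have ne1 : a 1 ≠ 0 := by
    intro h0; rw [h0] at a12; norm_num at a12
  have x12 : a 1 = a 2 := mul_left_cancel₀ ne0 (a01.trans a02.symm)
  have x02 : a 0 = a 2 := mul_left_cancel₀ ne1 (by linarith)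
  have haa : ∀ i, a i = a 2 := by
    intro i
    fin_cases i; exacts [x02, x12, rfl]
  have ha3 : a 2 ^ 2 = 1 / 3 := by
    rw [x12] at a12
    linarith
  have hll : ∀ i j, l i = l j := by
    intro i j
    have e1 : (c i * l i) ^ 2 = (c j * l j) ^ 2 := by rw [hk, hk]
    rw [mul_pow, mul_pow, hc2, hc2, haa i, haa j, ha3] at e1
    have e2 : (l i - l j) * (l i + l j) = 0 := by linarith
    rcases mul_eq_zero.1 e2 with h1 | h1
    · linarith
    · have h2 := hs i j
      have h3 : l i = -l j := by linarith
      rw [h3] at h2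
      nlinarith [mul_self_pos.2 (hl j)]
  have hc : ∀ i, c i = 2 * a 2 := by
    have g0 : c 0 = 2 * a 2 := by
      refine mul_right_cancel₀ l1 ?_
      rw [← A0, x02, hll 2 1]; ring
    have g1 : c 1 = 2 * a 2 := by
      refine mul_right_cancel₀ l0 ?_
      rw [← B0, x12, hll 2 0]; ring
    have g2 : c 2 = 2 * a 2 := by
      refine mul_right_cancel₀ l1 ?_
      rw [← B1, x02, hll 0 1]; ring
    intro i
    fin_cases i; exacts [g0, g1, g2]
  exact ⟨ha3, haa, hc⟩

/-- The equations for the coefficients of `J`. -/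
theorem HermData.IsNK.exists_scalar (hD : D.IsNK) {l : Fin 3 → ℝ} (h : D.IsDiag l)
    (hl : ∀ i, l i ≠ 0) (hs : ∀ i k, 0 ≤ l i * l k) :
    ∃ a k : ℝ, 0 < k ∧ a ^ 2 = 1 / 3 ∧ (∀ i, D.j (ee i) = a • ee i + (2 * a) • ff i) ∧
      (∀ i, D.j (ff i) = (-2 * a) • ee i - a • ff i) ∧
      (∀ i j, D.q (ee i) (ee j) = if i = j then k else 0) ∧
      (∀ i j, D.q (ff i) (ff j) = if i = j then k else 0) ∧
      (∀ i j, D.q (ee i) (ff j) = if i = j then -k / 2 else 0) := by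
  obtain ⟨a, b, c, hE, hF, habc⟩ := hD.exists_coeff h hl
  have hr : ∀ u v w, D.rho u v w = rhoF l u v w := h.rho_eq
  have r1 : ∀ u v w, rhoF l (D.j u) v w = rhoF l u (D.j v) w := fun u v w ↦ by
    rw [← hr, ← hr, hD.rho_j_left]
  have r2 : ∀ u v w, rhoF l u (D.j v) w = rhoF l u v (D.j w) := fun u v w ↦ by
    rw [← hr, ← hr, hD.rho_j_right]
  have l0 := hl 0
  have l1 := hl 1
  have l2 := hl 2
  -- linear relations
  have A0 : (a 0 + a 2) * l 2 = c 0 * l 1 := by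
    have := (r1 (ee 0) (ee 1) (ff 2)).trans (r2 (ee 0) (ee 1) (ff 2))
    rw [hE, hF] at this
    simp [rhoF, triple, ee, ff] at this
    linarith
  have B0 : (a 1 + a 2) * l 2 = c 1 * l 0 := by
    have := (r2 (ee 0) (ee 1) (ff 2))
    rw [hE, hF] at this
    simp [rhoF, triple, ee, ff] at this
    linarith
  have A1 : (a 1 + a 0) * l 0 = c 1 * l 2 := by
    have := (r1 (ee 1) (ee 2) (ff 0)).trans (r2 (ee 1) (ee 2) (ff 0))
    rw [hE, hF] at this
    simp [rhoF, triple, ee, ff] at this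
    linarith
  have B1 : (a 2 + a 0) * l 0 = c 2 * l 1 := by
    have := (r2 (ee 1) (ee 2) (ff 0))
    rw [hE, hF] at this
    simp [rhoF, triple, ee, ff] at this
    linarith
  have A2 : (a 2 + a 1) * l 1 = c 2 * l 0 := by
    have := (r1 (ee 2) (ee 0) (ff 1)).trans (r2 (ee 2) (ee 0) (ff 1))
    rw [hE, hF] at this
    simp [rhoF, triple, ee, ff] at this
    linarith
  have B2 : (a 0 + a 1) * l 1 = c 0 * l 2 := by
    have := (r2 (ee 2) (ee 0) (ff 1))
    rw [hE, hF] at this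
    simp [rhoF, triple, ee, ff] at this
    linarith
  have C0 : -(a 0 + a 2) * l 2 = b 0 * l 1 := by
    have := (r1 (ff 0) (ff 1) (ee 2)).trans (r2 (ff 0) (ff 1) (ee 2))
    rw [hE, hF] at this
    simp [rhoF, triple, ee, ff] at this
    linarith
  have C1 : -(a 1 + a 0) * l 0 = b 1 * l 2 := by
    have := (r1 (ff 1) (ff 2) (ee 0)).trans (r2 (ff 1) (ff 2) (ee 0))
    rw [hE, hF] at this
    simp [rhoF, triple, ee, ff] at this
    linarith
  have C2 : -(a 2 + a 1) * l 1 = b 2 * l 0 := by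
    have := (r1 (ff 2) (ff 0) (ee 1)).trans (r2 (ff 2) (ff 0) (ee 1))
    rw [hE, hF] at this
    simp [rhoF, triple, ee, ff] at this
    linarith
  have hb : ∀ i, b i = -c i := by
    intro i
    fin_cases i
    · exact mul_right_cancel₀ l1 (by simp only [Fin.zero_eta, Fin.isValue]; linarith)
    · exact mul_right_cancel₀ l2 (by simp only [Fin.mk_one, Fin.isValue]; linarith)
    · exact mul_right_cancel₀ l0 (by simp only [Fin.reduceFinMk, Fin.isValue]; linarith)
  have hc2 : ∀ i, c i ^ 2 = 1 + a i ^ 2 := by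
    intro i
    have := habc i
    rw [hb] at this
    linarith
  have k12 : c 1 * l 1 = c 2 * l 2 :=
    mul_right_cancel₀ l0 (by linear_combination (-l 1) * B0 + l 2 * A2)
  have k02 : c 0 * l 0 = c 2 * l 2 :=
    mul_right_cancel₀ l1 (by linear_combination (-l 0) * A0 + l 2 * B1)
  -- This common value turns out to be the squared length of every basis vector.
  obtain ⟨k, hk⟩ : ∃ k, ∀ i, c i * l i = k :=
    ⟨c 2 * l 2, fun i ↦ by fin_cases i; exacts [k02, k12, rfl]⟩
  have hc0 : ∀ i, c i ≠ 0 := by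
    intro i h0
    have := hc2 i
    rw [h0] at this
    nlinarith [sq_nonneg (a i)]
  have hsum : ∀ i j, i ≠ j → a i + a j ≠ 0 := by
    have s01 : a 0 + a 1 ≠ 0 := by
      intro h0
      rw [h0, zero_mul] at B2
      exact mul_ne_zero (hc0 0) l2 B2.symm
    have s12 : a 1 + a 2 ≠ 0 := by
      intro h0
      rw [h0, zero_mul] at B0
      exact mul_ne_zero (hc0 1) l0 B0.symm
    have s02 : a 0 + a 2 ≠ 0 := by
      intro h0
      rw [h0, zero_mul] at A0
      exact mul_ne_zero (hc0 0) l1 A0.symm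
    intro i j hij
    fin_cases i <;> fin_cases j <;> first
      | exact absurd rfl hij | assumption | (rw [add_comm]; assumption)
  have hfe : ∀ i j, D.om (ff i) (ee j) = if j = i then -l j else 0 := by
    intro i j
    rw [D.om_swap, h j i]
    split_ifs <;> simp
  have omj : ∀ u v, D.om (D.j u) v = -D.om u (D.j v) := by
    intro u v
    rw [D.om_j, HermData.om, D.sq]
    simp
  -- The pure part vanishes: for `i ≠ j`, `J` being skew for `ω` gives `(a i + a j) ω(ee i, ee j) =
  -- 0`, and the first factor is nonzero.
  have hee : ∀ i j, D.om (ee i) (ee j) = 0 := by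
    intro i j
    rcases eq_or_ne i j with rfl | hij
    · exact D.om_self _
    · have := omj (ee i) (ee j)
      rw [hE, hE, D.om_add_left, D.om_add_right, D.om_smul_left, D.om_smul_left, D.om_smul_right,
        D.om_smul_right, hfe, h i j, if_neg hij, if_neg hij.symm] at this
      exact (mul_eq_zero.1 (show (a i + a j) * D.om (ee i) (ee j) = 0 by linarith)).resolve_left
        (hsum i j hij)
  have hff : ∀ i j, D.om (ff i) (ff j) = 0 := by
    intro i j
    rcases eq_or_ne i j with rfl | hij
    · exact D.om_self _
    · have := omj (ff i) (ff j)
      rw [hF, hF, sub_eq_add_neg, sub_eq_add_neg, ← neg_smul, ← neg_smul, D.om_add_left,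
        D.om_add_right, D.om_smul_left, D.om_smul_left, D.om_smul_right,
        D.om_smul_right, hfe, h i j, if_neg hij, if_neg hij.symm] at this
      exact (mul_eq_zero.1 (show (a i + a j) * D.om (ff i) (ff j) = 0 by linarith)).resolve_left
        (hsum i j hij)
  have qee : ∀ i j, D.q (ee i) (ee j) = if i = j then k else 0 := by
    intro i j
    rw [← D.om_j, hE, D.om_add_right, D.om_smul_right, D.om_smul_right, hee, h i j]
    split_ifs with hij
    · subst hij; rw [← hk i]; ring
    · ring
  have qff : ∀ i j, D.q (ff i) (ff j) = if i = j then k else 0 := by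
    intro i j
    rw [← D.om_j, hF, sub_eq_add_neg, ← neg_smul, D.om_add_right, D.om_smul_right, D.om_smul_right,
      hff, hfe, hb]
    split_ifs with hij hij' hij'
    · subst hij; rw [← hk j]; ring
    · exact absurd hij.symm hij'
    · exact absurd hij'.symm hij
    · ring
  have qef : ∀ i j, D.q (ee i) (ff j) = if i = j then -(a i * l i) else 0 := by
    intro i j
    rw [← D.om_j, hF, sub_eq_add_neg, ← neg_smul, D.om_add_right, D.om_smul_right, D.om_smul_right,
      hee, h i j]
    split_ifs with hij
    · subst hij; ring
    · ring
  have qfe : ∀ i j, D.q (ff i) (ee j) = if j = i then -(a j * l j) else 0 := by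
    intro i j
    rw [D.symm, qef]
  have hkpos : 0 < k := by
    have := D.pos (ee 0) (ee_ne_zero 0)
    rwa [qee, if_pos rfl] at this
  have e01 : brk (ee 0) (ee 1) = ee 2 := brk_ee 0
  have e12 : brk (ee 1) (ee 2) = ee 0 := brk_ee 1
  have e20 : brk (ee 2) (ee 0) = ee 1 := brk_ee 2
  have f01 : brk (ff 0) (ff 1) = ff 2 := brk_ff 0
  have f12 : brk (ff 1) (ff 2) = ff 0 := brk_ff 1
  have f20 : brk (ff 2) (ff 0) = ff 1 := brk_ff 2
  -- All scalar products are now known, so `3 T = -rho` on these triples gives three equations in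
  -- `a`, `c`, `l` and `k`.
  have T0 := hD.three_T (ee 0) (ee 1) (ff 2)
  have T1 := hD.three_T (ee 1) (ee 2) (ff 0)
  have T2 := hD.three_T (ee 2) (ee 0) (ff 1)
  have R0 : rhoF l (ee 0) (ee 1) (ff 2) = l 2 := by simp [rhoF, triple, ee, ff]
  have R1 : rhoF l (ee 1) (ee 2) (ff 0) = l 0 := by simp [rhoF, triple, ee, ff]
  have R2 : rhoF l (ee 2) (ee 0) (ff 1) = l 1 := by simp [rhoF, triple, ee, ff]
  rw [hr, R0, HermData.T, hE, hF] at T0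
  rw [hr, R1, HermData.T, hE, hF] at T1
  rw [hr, R2, HermData.T, hE, hF] at T2
  simp only [HermData.koszul, sub_eq_add_neg, ← neg_smul, brk_add_left, brk_add_right,
    brk_smul_left, brk_smul_right, brk_ee_ff, brk_ff_ee, e01, e12, e20, f01, f12,
    f20, map_add, map_smul, map_zero, _root_.add_apply, _root_.smul_apply,
    _root_.zero_apply, qee, qef, qfe] at T0 T1 T2
  simp [hb] at T0 T1 T2
  obtain ⟨ha3, haa, hc⟩ := coeff_eq hl hs hc2 hk A0 B0 B1 B2 T0 T1 T2
  refine ⟨a 2, k, hkpos, ha3, fun i ↦ ?_, fun i ↦ ?_, qee, qff, fun i j ↦ ?_⟩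
  · rw [hE, haa, hc]
  · rw [hF, haa, hb, hc, neg_mul]
  · rw [qef, haa]
    split_ifs
    · rw [← hk i, hc]; ring
    · rfl

end Classification

/-! ### Nonvanishing of the diagonal entries. -/

section Classification

open Matrix

variable {D : HermData}

theorem HermData.om_nondegenerate (D : HermData) {u : R33} (hu : u ≠ 0) :
    ∃ v, D.om u v ≠ 0 :=
  ⟨D.j u, by rw [D.om_j]; exact (D.pos u hu).ne'⟩

/-- Otherwise `ω` would be a sum of 2-forms on two spaces of odd dimension, hence degenerate: the
vector of coefficients of the first form, or `ee 0` if that vector is zero, lies in its kernel. -/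
theorem HermData.IsDiag.not_all_zero {l : Fin 3 → ℝ} (h : D.IsDiag l)
    (h0 : l 0 = 0) (h1 : l 1 = 0) (h2 : l 2 = 0) : False := by
  have key := h.om_eq
  generalize D.om (ee 1) (ee 2) = a0, D.om (ee 2) (ee 0) = a1, D.om (ee 0) (ee 1) = a2,
    D.om (ff 1) (ff 2) = b0, D.om (ff 2) (ff 0) = b1, D.om (ff 0) (ff 1) = b2 at key
  rw [h0, h1, h2] at key
  by_cases ha : a0 = 0 ∧ a1 = 0 ∧ a2 = 0
  · obtain ⟨v, hv⟩ := D.om_nondegenerate (ee_ne_zero 0)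
    apply hv
    rw [key]
    simp [ee, ha]
  · have hne : a0 • ee 0 + a1 • ee 1 + a2 • ee 2 ≠ 0 := by
      intro hw
      apply ha
      have hw1 := congrArg Prod.fst hw
      have x0 := congrFun hw1 0
      have x1 := congrFun hw1 1
      have x2 := congrFun hw1 2
      simp [ee] at x0 x1 x2
      exact ⟨x0, x1, x2⟩
    obtain ⟨v, hv⟩ := D.om_nondegenerate hne
    apply hv
    rw [key]
    simp [ee]
    ring

/-- If `l 2 = 0`, then `rho` is so degenerate that some line defined by it is preserved by `J`,
contradicting `J² = -1`. -/
theorem HermData.IsNK.diag_ne_zero (hD : D.IsNK) {l : Fin 3 → ℝ} (h : D.IsDiag l) : l 2 ≠ 0 := by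
  intro h2
  have hr : ∀ u v w, D.rho u v w = rhoF l u v w := h.rho_eq
  have r1 : ∀ u v w, rhoF l (D.j u) v w = rhoF l u (D.j v) w := fun u v w ↦ by
    rw [← hr, ← hr, hD.rho_j_left]
  have r2 : ∀ u v w, rhoF l u (D.j v) w = rhoF l u v (D.j w) := fun u v w ↦ by
    rw [← hr, ← hr, hD.rho_j_right]
  by_cases hsq : l 0 ^ 2 = l 1 ^ 2
  · by_cases h0 : l 0 = 0
    · refine h.not_all_zero h0 ?_ h2
      rw [h0, zero_pow two_ne_zero] at hsq
      exact pow_eq_zero_iff two_ne_zero |>.1 hsq.symm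
    · have h1 : l 1 ≠ 0 := by
        intro h1
        rw [h1, zero_pow two_ne_zero] at hsq
        exact h0 (pow_eq_zero_iff two_ne_zero |>.1 hsq)
      -- When `l 0 = ± l 1 ≠ 0`, this vector spans the kernel of `rho`, which is `J`-invariant.
      set v : R33 := l 0 • ee 2 + l 1 • ff 2 with hv
      have hker : ∀ y z, rhoF l v y z = 0 := by
        intro y z
        simp [rhoF, triple, hv, ee, ff, h2]
        linear_combination (z.1 1 * y.2 0 - y.1 1 * z.2 0) * hsq
      have hp : ∀ y z, rhoF l (D.j v) y z = 0 := fun y z ↦ by rw [r1, hker]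
      generalize hpj : D.j v = p at hp
      have x1 := hp (ee 0) (ee 2)
      have x2 := hp (ee 1) (ee 2)
      have x3 := hp (ff 0) (ff 2)
      have x4 := hp (ff 1) (ff 2)
      have x5 := hp (ee 0) (ff 1)
      simp [rhoF, triple, ee, ff, h2, h0, h1] at x1 x2 x3 x4 x5
      have hv0 : v ≠ 0 := by
        intro hw
        have := congrFun (congrArg Prod.fst hw) 2
        simp [hv, ee, ff] at this
        exact h0 this
      refine D.no_real_eigenvector hv0 (p.1 2 / l 0) ?_
      rw [hpj]
      ext k
      · fin_cases k <;> simp [hv, ee, ff, x3, x4, h0]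
      · fin_cases k <;> simp [hv, ee, ff, x1, x2]
        field_simp
        linarith
  -- When `l 0 ² ≠ l 1 ²`, the vectors `ee 0`, `ee 1` and `ff 0` all contract to zero against `ee
  -- 0`. Moving `J`, they do so against `J (ee 0)`, and this forces `J (ee 0)` onto the line of `ee
  -- 0`.
  · have hk : ∀ x : R33, (∀ w, rhoF l x (ee 0) w = 0) → ∀ w, rhoF l x (D.j (ee 0)) w = 0 :=
      fun x hx w ↦ by rw [r2, hx]
    have k0 := hk (ee 0) fun w ↦ by simp [rhoF, triple, ee]
    have k1 := hk (ee 1) fun w ↦ by simp [rhoF, triple, ee, h2]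
    have k2 := hk (ff 0) fun w ↦ by simp [rhoF, triple, ee, ff]
    generalize hp : D.j (ee 0) = p at k0 k1 k2
    have x1 := k0 (ee 2)
    have x2 := k0 (ff 2)
    have x3 := k1 (ee 2)
    have x4 := k1 (ff 2)
    have x5 := k0 (ff 1)
    have x6 := k1 (ff 0)
    have x7 := k2 (ee 2)
    have x8 := k2 (ff 2)
    simp only [rhoF, triple, ee, ff, h2] at x1 x2 x3 x4 x5 x6 x7 x8
    simp at x1 x2 x3 x4 x5 x6 x7 x8
    have cancel : ∀ t : ℝ, (l 0 = 0 ∨ t = 0) → (l 1 = 0 ∨ t = 0) → t = 0 := by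
      intro t e0 e1
      by_contra ht
      rw [e0.resolve_right ht, e1.resolve_right ht] at hsq
      exact hsq rfl
    have hne : l 0 ^ 2 - l 1 ^ 2 ≠ 0 := sub_ne_zero.2 hsq
    have y1 : p.1 1 = 0 := cancel _ x7 x8
    have y2 : p.1 2 = 0 := (mul_eq_zero.1
      (by linear_combination l 0 * x6 + l 1 * x5 : (l 0 ^ 2 - l 1 ^ 2) * p.1 2 = 0)).resolve_left hne
    have z0 : p.2 0 = 0 := cancel _ x3 x4
    have z1 : p.2 1 = 0 := cancel _ x2 x1
    have z2 : p.2 2 = 0 := (mul_eq_zero.1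
      (by linear_combination l 0 * x5 + l 1 * x6 : (l 0 ^ 2 - l 1 ^ 2) * p.2 2 = 0)).resolve_left hne
    refine D.no_real_eigenvector (ee_ne_zero 0) (p.1 0) ?_
    rw [hp]
    ext k <;> fin_cases k <;> simp [ee, y1, y2, z0, z1, z2]

end Classification

/-! ### Inner automorphisms and the normal form. -/

section Classification

open Matrix

theorem Ad2_inv_Ad2 (a : S3 × S3) (u : R33) : Ad2 a⁻¹ (Ad2 a u) = u := by
  refine Prod.ext ?_ ?_
  · exact Ad_inv_Ad _ _
  · exact Ad_inv_Ad _ _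

theorem Ad2_Ad2_inv (a : S3 × S3) (u : R33) : Ad2 a (Ad2 a⁻¹ u) = u := by
  refine Prod.ext ?_ ?_
  · exact Ad_Ad_inv _ _
  · exact Ad_Ad_inv _ _

theorem Ad2_brk (a : S3 × S3) (u v : R33) : Ad2 a (brk u v) = brk (Ad2 a u) (Ad2 a v) := by
  refine Prod.ext ?_ ?_
  · exact Ad_cross _ _ _
  · exact Ad_cross _ _ _

theorem Ad2_mul (a b : S3 × S3) (u : R33) : Ad2 (a * b) u = Ad2 a (Ad2 b u) := by
  refine Prod.ext ?_ ?_
  · exact Ad_mul _ _ _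
  · exact Ad_mul _ _ _

/-- The pullback of a Hermitian structure on the Lie algebra by an inner automorphism. -/
def HermData.pullAd (D : HermData) (a : S3 × S3) : HermData where
  q := pullQ D.q (Ad2 a)
  j := (Ad2 a⁻¹).comp (D.j.comp (Ad2 a))
  symm _ _ := D.symm _ _
  pos u hu := D.pos _ fun h ↦ hu (by
    have h1 := Ad2_inv_Ad2 a u
    rw [show Ad2 a u = 0 from h, map_zero] at h1
    exact h1.symm)
  sq u := by
    change Ad2 a⁻¹ (D.j (Ad2 a (Ad2 a⁻¹ (D.j (Ad2 a u))))) = -u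
    rw [Ad2_Ad2_inv, D.sq, map_neg, Ad2_inv_Ad2]
  compat u v := by
    change D.q (Ad2 a (Ad2 a⁻¹ (D.j (Ad2 a u)))) (Ad2 a (Ad2 a⁻¹ (D.j (Ad2 a v)))) = _
    rw [Ad2_Ad2_inv, Ad2_Ad2_inv, D.compat]
    rfl

theorem HermData.pullAd_q (D : HermData) (a : S3 × S3) (u v : R33) :
    (D.pullAd a).q u v = D.q (Ad2 a u) (Ad2 a v) := rfl

theorem HermData.Ad2_pullAd_j (D : HermData) (a : S3 × S3) (u : R33) :
    Ad2 a ((D.pullAd a).j u) = D.j (Ad2 a u) := Ad2_Ad2_inv _ _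

theorem HermData.pullAd_om (D : HermData) (a : S3 × S3) (u v : R33) :
    (D.pullAd a).om u v = D.om (Ad2 a u) (Ad2 a v) := by
  rw [HermData.om, HermData.om, D.pullAd_q, D.Ad2_pullAd_j]

theorem HermData.IsNK.pullAd {D : HermData} (h : D.IsNK) (a : S3 × S3) : (D.pullAd a).IsNK := by
  intro w z
  simp only [D.pullAd_q, Ad2_brk, D.Ad2_pullAd_j]
  exact h _ _

/-! #### The standard structure -/

/-- The standard scalar product. -/
def stdForm (u v : R33) : ℝ :=
  u.1 ⬝ᵥ v.1 + u.2 ⬝ᵥ v.2 - (u.1 ⬝ᵥ v.2 + u.2 ⬝ᵥ v.1) / 2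

/-- The standard scalar product as a bilinear map. -/
def stdQ : R33 →L[ℝ] R33 →L[ℝ] ℝ :=
  bilinCLM (LinearMap.mk₂ ℝ stdForm
    (fun u u' v ↦ by simp [stdForm, add_dotProduct]; ring)
    (fun c u v ↦ by simp [stdForm, smul_dotProduct]; ring)
    (fun u v v' ↦ by simp [stdForm, dotProduct_add]; ring)
    (fun c u v ↦ by simp [stdForm, dotProduct_smul]; ring))

theorem stdQ_apply (u v : R33) : stdQ u v = stdForm u v := rfl

/-- The standard complex structure, up to scale. -/
def stdJ : R33 →L[ℝ] R33 := LinearMap.toContinuousLinearMap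
  { toFun := fun u ↦ ((2 : ℝ) • u.2 - u.1, u.2 - (2 : ℝ) • u.1)
    map_add' := fun u v ↦ by ext i <;> simp <;> ring
    map_smul' := fun c u ↦ by ext i <;> simp <;> ring }

theorem stdJ_apply (u : R33) : stdJ u = ((2 : ℝ) • u.2 - u.1, u.2 - (2 : ℝ) • u.1) := rfl

theorem stdJ_stdJ (u : R33) : stdJ (stdJ u) = -((3 : ℝ) • u) := by
  ext i <;> simp [stdJ_apply] <;> ring

theorem stdForm_stdJ (u v : R33) : stdForm (stdJ u) (stdJ v) = 3 * stdForm u v := by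
  simp [stdJ_apply, stdForm, dotProduct, Fin.sum_univ_three]
  ring

theorem stdForm_pos {u : R33} (hu : u ≠ 0) : 0 < stdForm u u := by
  have h1 : stdForm u u = (u.1 ⬝ᵥ u.1 + u.2 ⬝ᵥ u.2 + (u.1 - u.2) ⬝ᵥ (u.1 - u.2)) / 2 := by
    simp [stdForm, dotProduct, Fin.sum_univ_three]
    ring
  have p : ∀ x : R3, 0 ≤ x ⬝ᵥ x := fun x ↦ Finset.sum_nonneg fun k _ ↦ mul_self_nonneg _
  have p1 := p u.1
  have p2 := p u.2
  have p3 := p (u.1 - u.2)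
  rw [h1]
  by_contra hle
  refine hu (Prod.ext ?_ ?_)
  · exact dotProduct_self_eq_zero.1 (by linarith)
  · exact dotProduct_self_eq_zero.1 (by linarith)

/-- The standard Hermitian structures on the Lie algebra. -/
def stdData (k s : ℝ) (hk : 0 < k) (hs : s ^ 2 = 1 / 3) : HermData where
  q := k • stdQ
  j := s • stdJ
  symm u v := by
    change k * stdForm u v = k * stdForm v u
    simp only [stdForm, dotProduct_comm v.1, dotProduct_comm v.2]
    ring
  pos u hu := mul_pos hk (stdForm_pos hu)
  sq u := by
    change s • stdJ (s • stdJ u) = -u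
    rw [map_smul, stdJ_stdJ, smul_smul, ← sq, hs, smul_neg, smul_smul]
    norm_num
  compat u v := by
    change k * stdForm (s • stdJ u) (s • stdJ v) = k * stdForm u v
    have h : stdForm (s • stdJ u) (s • stdJ v) = s ^ 2 * stdForm (stdJ u) (stdJ v) := by
      rw [← stdQ_apply, map_smul, map_smul, _root_.smul_apply, smul_eq_mul, smul_eq_mul, stdQ_apply]
      ring
    rw [h, stdForm_stdJ, hs]
    ring

theorem stdData_q (k s : ℝ) (hk : 0 < k) (hs : s ^ 2 = 1 / 3) (u v : R33) :
    (stdData k s hk hs).q u v = k * stdForm u v := rfl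

theorem stdData_j (k s : ℝ) (hk : 0 < k) (hs : s ^ 2 = 1 / 3) (u : R33) :
    (stdData k s hk hs).j u = s • stdJ u := rfl

theorem stdData_isNK (k s : ℝ) (hk : 0 < k) (hs : s ^ 2 = 1 / 3) : (stdData k s hk hs).IsNK := by
  intro w z
  simp only [stdData_q, stdData_j, stdJ_apply, stdForm, brk, cross_apply, dotProduct,
    Fin.sum_univ_three]
  simp
  ring

theorem stdData_om (k s : ℝ) (hk : 0 < k) (hs : s ^ 2 = 1 / 3) (u v : R33) :
    (stdData k s hk hs).om u v = -(3 / 2 * (k * s)) * (u.1 ⬝ᵥ v.2 - u.2 ⬝ᵥ v.1) := by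
  simp [HermData.om, stdData_q, stdData_j, stdJ_apply, stdForm, dotProduct, Fin.sum_univ_three]
  ring

theorem ext_ee_ff {F : Type*} [AddCommGroup F] [Module ℝ F] {f g : R33 →ₗ[ℝ] F}
    (h1 : ∀ i, f (ee i) = g (ee i)) (h2 : ∀ i, f (ff i) = g (ff i)) : f = g := by
  refine LinearMap.ext fun u ↦ ?_
  rw [eq_sum_ee_ff u]
  simp only [map_add, map_smul, h1, h2]

/-- Both structures are determined by their values on the basis, which `exists_scalar` supplies. -/
theorem HermData.IsNK.eq_std_of_isDiag {D : HermData} (hD : D.IsNK) {l : Fin 3 → ℝ}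
    (h : D.IsDiag l) (hl : ∀ i, l i ≠ 0) (hs : ∀ i k, 0 ≤ l i * l k) :
    ∃ k s hk hs, D = stdData k s hk hs := by
  obtain ⟨a, k, hk, ha, hE, hF, qee, qff, qef⟩ := hD.exists_scalar h hl hs
  have dd : ∀ i j : Fin 3, (Pi.single i 1 : R3) ⬝ᵥ Pi.single j 1 = if i = j then 1 else 0 := by
    intro i j
    rw [single_one_dotProduct, Pi.single_apply]
  -- The sign comes from `stdJ (ee i) = -ee i - 2 ff i`.
  refine ⟨k, -a, hk, by rw [neg_sq, ha], HermData.ext ?_ ?_⟩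
  · refine ContinuousLinearMap.coe_injective (ext_ee_ff (fun i ↦ ?_) fun i ↦ ?_) <;>
      refine ContinuousLinearMap.coe_injective (ext_ee_ff (fun j ↦ ?_) fun j ↦ ?_)
    · change D.q (ee i) (ee j) = k * stdForm (ee i) (ee j)
      rw [qee]
      simp [stdForm, ee, dd]
    · change D.q (ee i) (ff j) = k * stdForm (ee i) (ff j)
      rw [qef]
      simp [stdForm, ee, ff, dd]
      split_ifs <;> ring
    · change D.q (ff i) (ee j) = k * stdForm (ff i) (ee j)
      rw [D.symm, qef]
      simp [stdForm, ee, ff, dd, eq_comm (a := i)]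
      split_ifs <;> ring
    · change D.q (ff i) (ff j) = k * stdForm (ff i) (ff j)
      rw [qff]
      simp [stdForm, ff, dd]
  · refine ContinuousLinearMap.coe_injective (ext_ee_ff (fun i ↦ ?_) fun i ↦ ?_)
    · change D.j (ee i) = (-a) • stdJ (ee i)
      rw [hE]
      ext m <;> simp [stdJ_apply, ee, ff]
      ring
    · change D.j (ff i) = (-a) • stdJ (ff i)
      rw [hF]
      ext m <;> simp [stdJ_apply, ee, ff]
      ring

/-- A vanishing singular value is brought to the last place, so that only `l 2 = 0` has to be
excluded. -/
theorem exists_svd_Ad_sorted (M : Matrix (Fin 3) (Fin 3) ℝ) :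
    ∃ (g h : S3) (l : Fin 3 → ℝ), (∀ i j, 0 ≤ l i * l j) ∧ ((∀ i, l i ≠ 0) ∨ l 2 = 0) ∧
      ∀ i j, Ad g (Pi.single i 1) ⬝ᵥ M *ᵥ Ad h (Pi.single j 1) = if i = j then l i else 0 := by
  obtain ⟨g, h, l, hl, hM⟩ := exists_svd_Ad M
  by_cases h0 : ∀ i, l i ≠ 0
  · exact ⟨g, h, l, hl, Or.inl h0, hM⟩
  · push Not at h0
    obtain ⟨i₀, hi₀⟩ := h0
    -- A cyclic permutation of a right-handed frame is right-handed. The shift by `i₀ + 1` sends the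
    -- index 2 to `i₀` modulo 3.
    have hshift : ∀ g : S3, ∃ g' : S3, ∀ i,
        Ad g' (Pi.single i 1) = Ad g (Pi.single (i + (i₀ + 1)) 1) := by
      intro g
      have hf := isFrame_Ad g
      have hn : ∀ i, Ad g (Pi.single i 1) ≠ 0 := by
        intro i hi
        have h1 := Ad_dot g (Pi.single i 1) (Pi.single i 1)
        rw [hi] at h1
        simp at h1
      refine exists_Ad_frame (A := fun i ↦ Ad g (Pi.single (i + (i₀ + 1)) 1)) ?_
      obtain ⟨c1, c2, c3, -⟩ := hf
      fin_cases i₀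
      · exact ⟨c2, c3, c1, hn _⟩
      · exact ⟨c3, c1, c2, hn _⟩
      · exact ⟨c1, c2, c3, hn _⟩
    obtain ⟨g', hg'⟩ := hshift g
    obtain ⟨h', hh'⟩ := hshift h
    refine ⟨g', h', fun i ↦ l (i + (i₀ + 1)), fun i j ↦ hl _ _, Or.inr ?_, fun i j ↦ ?_⟩
    · have : 2 + (i₀ + 1) = i₀ := by fin_cases i₀ <;> rfl
      dsimp only
      rw [this, hi₀]
    · rw [hg', hh', hM]
      simp

/-- Classification of the nearly Kähler structures on the Lie algebra. -/
theorem HermData.IsNK.exists_pullAd_eq {D : HermData} (hD : D.IsNK) :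
    ∃ a k s hk hs, D.pullAd a = stdData k s hk hs := by
  let M : Matrix (Fin 3) (Fin 3) ℝ := Matrix.of fun i j ↦ D.om (ee i) (ff j)
  have hM : ∀ x y : R3, x ⬝ᵥ M *ᵥ y = D.om (x, 0) (0, y) := by
    intro x y
    rw [eq_sum_ee_ff (x, 0), eq_sum_ee_ff (0, y)]
    simp only [D.om_add_left, D.om_smul_left, D.om_add_right, D.om_smul_right]
    simp [dotProduct, mulVec, Fin.sum_univ_three, M]
    ring
  obtain ⟨g, h, l, hl, h2, hgh⟩ := exists_svd_Ad_sorted M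
  have hdiag : (D.pullAd (g, h)).IsDiag l := by
    intro i j
    rw [D.pullAd_om, ← hgh, hM]
    simp [Ad2_apply, ee, ff]
  have hnk := hD.pullAd (g, h)
  have hne := h2.resolve_right (hnk.diag_ne_zero hdiag)
  exact ⟨(g, h), hnk.eq_std_of_isDiag hdiag hne hl⟩

end Classification

/-! ### Invariant scalar products on the Lie algebra of `S³` -/

section AdInvariant

open Matrix

theorem mc_one_of_eq {p : S3} (hp : p = 1) (u : TangentSpace (𝓡 3) p) :
    mc 1 (show TangentSpace (𝓡 3) (1 : S3) from u) = mc p u := by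
  subst hp
  rfl

theorem mc_conj (h : S3) (u : TangentSpace (𝓡 3) (1 : S3)) :
    mc 1 (show TangentSpace (𝓡 3) (1 : S3) from
      mfderiv (𝓡 3) (𝓡 3) (fun x : S3 ↦ h * x * h⁻¹) 1 u) = Ad h (mc 1 u) := by
  have hid : MDifferentiableAt (𝓡 3) (𝓡 3) (fun x : S3 ↦ x) 1 := mdifferentiableAt_id
  have h1 := mdifferentiableAt_mul_S3 (mdifferentiableAt_const (I := 𝓡 3) (x := (1 : S3)) (c := h)) hid
  have h2 := mdifferentiableAt_const (I := 𝓡 3) (I' := 𝓡 3) (x := (1 : S3)) (c := h⁻¹)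
  refine (mc_one_of_eq (by simp) _).trans ?_
  refine (mc_mfderiv_mul h1 h2 u).trans ?_
  rw [mc_mfderiv_const, add_zero, inv_inv]
  congr 1
  refine (mc_mfderiv_mul (mdifferentiableAt_const (I := 𝓡 3) (x := (1 : S3)) (c := h)) hid u).trans ?_
  rw [mc_mfderiv_const, map_zero, zero_add]
  congr 1
  exact congrArg (fun T ↦ T u) mfderiv_id

instance (p : S3) : FiniteDimensional ℝ (TangentSpace (𝓡 3) p) :=
  inferInstanceAs (FiniteDimensional ℝ (EuclideanSpace ℝ (Fin 3)))

instance (p : S3) : T2Space (TangentSpace (𝓡 3) p) :=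
  inferInstanceAs (T2Space (EuclideanSpace ℝ (Fin 3)))

/-- The Maurer-Cartan form of `S³` as an isomorphism. -/
def mcL (p : S3) : TangentSpace (𝓡 3) p ≃L[ℝ] R3 :=
  (LinearEquiv.ofBijective (mc p).toLinearMap
    ⟨mc_injective p, mc_surjective p⟩).toContinuousLinearEquiv

theorem mcL_apply (p : S3) (u : TangentSpace (𝓡 3) p) : mcL p u = mc p u := rfl

theorem mc_mcL_symm (p : S3) (x : R3) : mc p ((mcL p).symm x) = x := (mcL p).apply_symm_apply x

/-- The scalar product as a bilinear map. -/
def dotL : R3 →L[ℝ] R3 →L[ℝ] ℝ :=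
  LinearMap.toContinuousLinearMap
    ((LinearMap.toContinuousLinearMap : (R3 →ₗ[ℝ] ℝ) ≃ₗ[ℝ] _).toLinearMap ∘ₗ
      (LinearMap.mk₂ ℝ (fun x y : R3 ↦ x ⬝ᵥ y) add_dotProduct smul_dotProduct dotProduct_add
        (fun c x y ↦ dotProduct_smul c x y)))

theorem isAdInvariantInner_of_eq {t : ℝ} (ht : 0 < t)
    {q : TangentSpace (𝓡 3) (1 : S3) →L[ℝ] TangentSpace (𝓡 3) (1 : S3) →L[ℝ] ℝ}
    (hq : ∀ u v, q u v = t * (mc 1 u ⬝ᵥ mc 1 v)) : IsAdInvariantInner q where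
  symm u v := by rw [hq, hq, dotProduct_comm]
  pos u hu := by
    rw [hq]
    refine mul_pos ht (lt_of_le_of_ne (Finset.sum_nonneg fun k _ ↦ mul_self_nonneg _) fun h ↦ ?_)
    have h1 := dotProduct_self_eq_zero.1 h.symm
    exact hu ((mcL 1).map_eq_zero_iff.1 h1)
  adInvariant h u v := by
    refine (hq _ _).trans ?_
    rw [hq, ← Ad_dot h (mc 1 u) (mc 1 v), ← mc_conj, ← mc_conj]

theorem exists_form_eq (t : ℝ) :
    ∃ q : TangentSpace (𝓡 3) (1 : S3) →L[ℝ] TangentSpace (𝓡 3) (1 : S3) →L[ℝ] ℝ,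
      ∀ u v, q u v = t * (mc 1 u ⬝ᵥ mc 1 v) :=
  ⟨pullQ (t • dotL) (mc 1), fun _ _ ↦ rfl⟩

/-- Invariance under the half-turns about two coordinate axes makes the form diagonal; invariance
under the cyclic rotation of the axes makes the diagonal constant. -/
theorem IsAdInvariantInner.exists_eq
    {q : TangentSpace (𝓡 3) (1 : S3) →L[ℝ] TangentSpace (𝓡 3) (1 : S3) →L[ℝ] ℝ}
    (h : IsAdInvariantInner q) : ∃ t : ℝ, 0 < t ∧ ∀ u v, q u v = t * (mc 1 u ⬝ᵥ mc 1 v) := by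
  let B : R3 →L[ℝ] R3 →L[ℝ] ℝ := pullQ q ((mcL 1).symm : R3 →L[ℝ] TangentSpace (𝓡 3) (1 : S3))
  have hqB : ∀ u v, q u v = B (mc 1 u) (mc 1 v) := by
    intro u v
    change q u v = q ((mcL 1).symm (mcL 1 u)) ((mcL 1).symm (mcL 1 v))
    rw [ContinuousLinearEquiv.symm_apply_apply, ContinuousLinearEquiv.symm_apply_apply]
  have hB : ∀ (g : S3) (x y : R3), B (Ad g x) (Ad g y) = B x y := by
    intro g x y
    have h1 := h.adInvariant g ((mcL 1).symm x) ((mcL 1).symm y)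
    have h2 := (hqB _ _).symm.trans h1
    rw [mc_conj, mc_conj, mc_mcL_symm, mc_mcL_symm] at h2
    exact h2
  have hs : ∀ x y, B x y = B y x := fun x y ↦ h.symm _ _
  let e : Fin 3 → R3 := fun i ↦ Pi.single i 1
  have hflip : ∀ (A : Fin 3 → R3), IsFrame A → ∀ i j, B (A i) (A j) = B (e i) (e j) := by
    intro A hA i j
    obtain ⟨g, hg⟩ := exists_Ad_frame hA
    rw [← hg, ← hg, hB]
  have frame1 : IsFrame ![e 0, -e 1, -e 2] := by
    refine ⟨?_, ?_, ?_, fun h0 ↦ ?_⟩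
    · ext i; fin_cases i <;> simp [e, cross_apply]
    · ext i; fin_cases i <;> simp [e, cross_apply]
    · ext i; fin_cases i <;> simp [e, cross_apply]
    · simpa [e] using congrFun h0 0
  have frame2 : IsFrame ![-e 0, -e 1, e 2] := by
    refine ⟨?_, ?_, ?_, fun h0 ↦ ?_⟩
    · ext i; fin_cases i <;> simp [e, cross_apply]
    · ext i; fin_cases i <;> simp [e, cross_apply]
    · ext i; fin_cases i <;> simp [e, cross_apply]
    · simpa [e] using congrFun h0 0
  have frame3 : IsFrame ![e 1, e 2, e 0] := by
    refine ⟨?_, ?_, ?_, fun h0 ↦ ?_⟩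
    · ext i; fin_cases i <;> simp [e, cross_apply]
    · ext i; fin_cases i <;> simp [e, cross_apply]
    · ext i; fin_cases i <;> simp [e, cross_apply]
    · simpa [e] using congrFun h0 1
  have b01 : B (e 0) (e 1) = 0 := by
    have := hflip _ frame1 0 1
    simp at this
    linarith
  have b02 : B (e 0) (e 2) = 0 := by
    have := hflip _ frame1 0 2
    simp at this
    linarith
  have b12 : B (e 1) (e 2) = 0 := by
    have := hflip _ frame2 1 2
    simp at this
    linarith
  have b11 : B (e 1) (e 1) = B (e 0) (e 0) := hflip _ frame3 0 0
  have b22 : B (e 2) (e 2) = B (e 0) (e 0) := (hflip _ frame3 1 1).trans b11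
  refine ⟨B (e 0) (e 0), ?_, fun u v ↦ ?_⟩
  · refine h.pos _ fun h0 ↦ ?_
    have h1 : e 0 = 0 := (mcL 1).symm.map_eq_zero_iff.1 h0
    simpa [e] using congrFun h1 0
  · rw [hqB]
    generalize mc 1 u = x
    generalize mc 1 v = y
    have hx : ∀ x : R3, x = x 0 • e 0 + x 1 • e 1 + x 2 • e 2 := by
      intro x
      ext i; fin_cases i <;> simp [e]
    conv_lhs => rw [hx x, hx y]
    simp only [map_add, map_smul, _root_.add_apply, _root_.smul_apply, smul_eq_mul, b01, b02, b12,
      hs (e 1) (e 0), hs (e 2) (e 0), hs (e 2) (e 1), b11, b22]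
    rw [dotProduct, Fin.sum_univ_three]
    ring

end AdInvariant

/-! ### Ledger-Obata structures -/

section LedgerObata

open Matrix

/-- The Maurer-Cartan form of `S³ × S³ × S³` at the identity. -/
def mc3 (v : TangentSpace I3 (1 : S3 × S3 × S3)) : R3 × R3 × R3 :=
  (mc 1 (show TangentSpace (𝓡 3) (1 : S3) from v.1),
    mc 1 (show TangentSpace (𝓡 3) (1 : S3) from v.2.1),
    mc 1 (show TangentSpace (𝓡 3) (1 : S3) from v.2.2))

theorem mc3_surjective : Function.Surjective mc3 := by
  rintro ⟨x, y, z⟩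
  obtain ⟨u, hu⟩ := mc_surjective 1 x
  obtain ⟨v, hv⟩ := mc_surjective 1 y
  obtain ⟨w, hw⟩ := mc_surjective 1 z
  exact ⟨(u, v, w), Prod.ext hu (Prod.ext hv hw)⟩

theorem mc3_injective : Function.Injective mc3 := by
  rintro ⟨u, v, w⟩ ⟨u', v', w'⟩ h
  have h1 : u = u' := mc_injective 1 (congrArg Prod.fst h)
  have h2 : v = v' := mc_injective 1 (congrArg (fun t ↦ t.2.1) h)
  have h3 : w = w' := mc_injective 1 (congrArg (fun t ↦ t.2.2) h)
  rw [h1, h2, h3]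

theorem mc3_add (u v : TangentSpace I3 (1 : S3 × S3 × S3)) : mc3 (u + v) = mc3 u + mc3 v :=
  Prod.ext (map_add (mc 1) _ _) (Prod.ext (map_add (mc 1) _ _) (map_add (mc 1) _ _))

theorem mc3_zero : mc3 0 = 0 :=
  Prod.ext (map_zero (mc 1)) (Prod.ext (map_zero (mc 1)) (map_zero (mc 1)))

theorem dCyclicAut_eq (v : TangentSpace I3 (1 : S3 × S3 × S3)) :
    dCyclicAut v = (v.2.1, v.2.2, v.1) := by
  have f1 : HasMFDerivAt I3 (𝓡 3) (fun h : S3 × S3 × S3 ↦ h.1) 1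
    (ContinuousLinearMap.fst ℝ (EuclideanSpace ℝ (Fin 3)) E33) := hasMFDerivAt_fst 1
  have f2 : HasMFDerivAt I3 ((𝓡 3).prod (𝓡 3)) (fun h : S3 × S3 × S3 ↦ h.2) 1
    (ContinuousLinearMap.snd ℝ (EuclideanSpace ℝ (Fin 3)) E33) := hasMFDerivAt_snd 1
  have f21 := (hasMFDerivAt_fst (I := 𝓡 3) (I' := 𝓡 3) (1 : S3 × S3)).comp (1 : S3 × S3 × S3) f2
  have f22 := (hasMFDerivAt_snd (I := 𝓡 3) (I' := 𝓡 3) (1 : S3 × S3)).comp (1 : S3 × S3 × S3) f2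
  exact congrArg (fun T ↦ T v) (f21.prodMk (f22.prodMk f1)).mfderiv

theorem mc3_dCyclicAut (v : TangentSpace I3 (1 : S3 × S3 × S3)) :
    mc3 (dCyclicAut v) = ((mc3 v).2.1, (mc3 v).2.2, (mc3 v).1) := by
  rw [dCyclicAut_eq]
  rfl

theorem mem_mSpace_iff (v : TangentSpace I3 (1 : S3 × S3 × S3)) :
    v ∈ mSpace ↔ (mc3 v).1 + (mc3 v).2.1 + (mc3 v).2.2 = 0 := by
  rw [mSpace, Set.mem_ofPred_eq, ← mc3_injective.eq_iff, mc3_add, mc3_add, mc3_zero,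
    mc3_dCyclicAut, mc3_dCyclicAut, mc3_dCyclicAut]
  constructor
  · intro h
    exact congrArg Prod.fst h
  · intro h
    refine Prod.ext h (Prod.ext ?_ ?_)
    · refine Eq.trans ?_ h
      dsimp only [Prod.fst_add, Prod.snd_add]
      abel
    · refine Eq.trans ?_ h
      dsimp only [Prod.fst_add, Prod.snd_add]
      abel

theorem mcE_quotientProj (v : TangentSpace I3 (1 : S3 × S3 × S3)) :
    mcE (quotientProj 1) (mfderiv I3 I2 quotientProj 1 v) =
      ((mc3 v).1 - (mc3 v).2.2, (mc3 v).2.1 - (mc3 v).2.2) := by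
  have f1 : HasMFDerivAt I3 (𝓡 3) (fun h : S3 × S3 × S3 ↦ h.1) 1
    (ContinuousLinearMap.fst ℝ (EuclideanSpace ℝ (Fin 3)) E33) := hasMFDerivAt_fst 1
  have f2 : HasMFDerivAt I3 ((𝓡 3).prod (𝓡 3)) (fun h : S3 × S3 × S3 ↦ h.2) 1
    (ContinuousLinearMap.snd ℝ (EuclideanSpace ℝ (Fin 3)) E33) := hasMFDerivAt_snd 1
  have f21 : HasMFDerivAt I3 (𝓡 3) (fun h : S3 × S3 × S3 ↦ h.2.1) 1 _ :=
    (hasMFDerivAt_fst (I := 𝓡 3) (I' := 𝓡 3) (1 : S3 × S3)).comp (1 : S3 × S3 × S3) f2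
  have f22 : HasMFDerivAt I3 (𝓡 3) (fun h : S3 × S3 × S3 ↦ h.2.2) 1 _ :=
    (hasMFDerivAt_snd (I := 𝓡 3) (I' := 𝓡 3) (1 : S3 × S3)).comp (1 : S3 × S3 × S3) f2
  have key : ∀ (F : S3 × S3 × S3 → S3) (T : TangentSpace I3 (1 : S3 × S3 × S3) →L[ℝ]
      TangentSpace (𝓡 3) (F 1)), HasMFDerivAt I3 (𝓡 3) F 1 T → ∀ v,
      mc (F 1 * (1 : S3 × S3 × S3).2.2⁻¹)
        (mfderiv I3 (𝓡 3) (fun h ↦ F h * h.2.2⁻¹) 1 v) = mc (F 1) (T v) - (mc3 v).2.2 := by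
    intro F T hF v
    refine (mc_mfderiv_mul hF.mdifferentiableAt
      (mdifferentiableAt_inv_S3 f22.mdifferentiableAt) v).trans ?_
    rw [mc_mfderiv_inv f22.mdifferentiableAt, hF.mfderiv, f22.mfderiv]
    have h1 : ((1 : S3 × S3 × S3).2.2 : S3) = 1 := rfl
    rw [h1, inv_one, inv_one, Ad_one, Ad_one, sub_eq_add_neg]
    rfl
  refine (mcE_mfderiv (mdifferentiableAt_mul_S3 f1.mdifferentiableAt
    (mdifferentiableAt_inv_S3 f22.mdifferentiableAt)) (mdifferentiableAt_mul_S3 f21.mdifferentiableAt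
    (mdifferentiableAt_inv_S3 f22.mdifferentiableAt)) v).trans ?_
  exact Prod.ext (key _ _ f1 v) (key _ _ f21 v)

theorem stdData_Ad2_diag (k s : ℝ) (hk : 0 < k) (hs : s ^ 2 = 1 / 3) (h : S3) (u v : R33) :
    (stdData k s hk hs).q (Ad2 (h, h) u) (Ad2 (h, h) v) = (stdData k s hk hs).q u v ∧
      (stdData k s hk hs).j (Ad2 (h, h) u) = Ad2 (h, h) ((stdData k s hk hs).j u) := by
  constructor
  · simp only [stdData_q, stdForm, Ad2_apply, Ad_dot]
  · simp [stdData_j, stdJ_apply, Ad2_apply, map_sub, map_smul]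

theorem inv_sqrt_three_sq : (1 / √3 : ℝ) ^ 2 = 1 / 3 := by
  rw [div_pow, one_pow, Real.sq_sqrt (by norm_num)]

/-- The derivative of the projection is `(x, y, z) ↦ (x - z, y - z)`. Its inverse onto `𝔪` sends
`(u, v)` to `(2u - v, 2v - u, -u - v) / 3`, on which the sum of squares is `2/3` of `stdForm`. In
these coordinates `ds` becomes `(u, v) ↦ (v - u, -u)`, that is `-1/2 + stdJ / 2`, so that `J = stdJ
/ √3`. -/
theorem isLedgerObata_iff {t : ℝ} (ht : 0 < t)
    {q : TangentSpace (𝓡 3) (1 : S3) →L[ℝ] TangentSpace (𝓡 3) (1 : S3) →L[ℝ] ℝ}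
    (hq : ∀ u v, q u v = t * (mc 1 u ⬝ᵥ mc 1 v)) (D : HermData) :
    IsLedgerObata q D.toAlmostHermitian ↔
      D = stdData (2 / 3 * t) (1 / √3) (by positivity) inv_sqrt_three_sq := by
  have hq3 : ∀ v w : TangentSpace I3 (1 : S3 × S3 × S3),
      q v.1 w.1 + q v.2.1 w.2.1 + q v.2.2 w.2.2 = t * ((mc3 v).1 ⬝ᵥ (mc3 w).1 +
        (mc3 v).2.1 ⬝ᵥ (mc3 w).2.1 + (mc3 v).2.2 ⬝ᵥ (mc3 w).2.2) := by
    intro v w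
    refine (congrArg₂ _ (congrArg₂ _ (hq _ _) (hq _ _)) (hq _ _)).trans ?_
    rw [mul_add, mul_add]
    rfl
  have h3 : (√3 : ℝ) ≠ 0 := by positivity
  have h3' : (√3 : ℝ) * √3 = 3 := Real.mul_self_sqrt (by norm_num)
  constructor
  · intro h
    -- lift a vector of the tangent space to `mSpace`
    have lift : ∀ u : R33, ∃ v ∈ mSpace, mc3 v = ((1 / 3 : ℝ) • ((2 : ℝ) • u.1 - u.2),
        (1 / 3 : ℝ) • ((2 : ℝ) • u.2 - u.1), -(1 / 3 : ℝ) • (u.1 + u.2)) ∧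
        mcE (quotientProj 1) (mfderiv I3 I2 quotientProj 1 v) = u := by
      intro u
      obtain ⟨v, hv⟩ := mc3_surjective ((1 / 3 : ℝ) • ((2 : ℝ) • u.1 - u.2),
        (1 / 3 : ℝ) • ((2 : ℝ) • u.2 - u.1), -(1 / 3 : ℝ) • (u.1 + u.2))
      refine ⟨v, ?_, hv, ?_⟩
      · rw [mem_mSpace_iff, hv]
        dsimp only
        module
      · rw [mcE_quotientProj, hv]
        refine Prod.ext ?_ ?_
        · dsimp only
          module
        · dsimp only
          module
    refine HermData.ext ?_ ?_
    · refine ContinuousLinearMap.ext fun u ↦ ContinuousLinearMap.ext fun u' ↦ ?_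
      obtain ⟨v, hv, hv3, hvu⟩ := lift u
      obtain ⟨v', hv', hv3', hvu'⟩ := lift u'
      have h1 := h.metric v hv v' hv'
      rw [D.inner_apply, hvu, hvu', hq3, hv3, hv3'] at h1
      rw [h1, stdData_q]
      simp [stdForm, dotProduct, Fin.sum_univ_three]
      ring
    · refine ContinuousLinearMap.ext fun u ↦ ?_
      obtain ⟨v, hv, hv3, hvu⟩ := lift u
      have h1 := congrArg (mcE (quotientProj 1)) (h.complex v hv)
      rw [map_add, map_smul, map_smul, D.mcE_J, hvu, mcE_quotientProj, mc3_dCyclicAut, hv3] at h1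
      rw [stdData_j, stdJ_apply]
      have h2 : D.j u = (2 / √3) • ((√3 / 2) • D.j u) := by
        rw [smul_smul, show 2 / √3 * (√3 / 2) = 1 by field_simp, one_smul]
      rw [h2, ← sub_eq_iff_eq_add'.2 h1]
      refine Prod.ext ?_ ?_
      · simp only [Prod.smul_fst, Prod.fst_sub]
        module
      · simp only [Prod.smul_snd, Prod.snd_sub]
        module
  · rintro rfl
    refine ⟨fun h ↦ ?_, fun v hv ↦ ?_, fun v hv w hw ↦ ?_⟩
    · rw [relates_groupAct]
      exact stdData_Ad2_diag _ _ _ _ _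
    · refine (mcE (quotientProj 1)).injective ?_
      rw [map_add, map_smul, map_smul, HermData.mcE_J, mcE_quotientProj, mcE_quotientProj,
        mc3_dCyclicAut, stdData_j, stdJ_apply, smul_smul,
        show √3 / 2 * (1 / √3) = 1 / 2 by field_simp]
      rw [mem_mSpace_iff] at hv
      have hz := eq_neg_of_add_eq_zero_right hv
      refine Prod.ext ?_ ?_
      · simp only [Prod.smul_fst, Prod.fst_add, hz]
        module
      · simp only [Prod.smul_snd, Prod.snd_add, hz]
        module
    · rw [mem_mSpace_iff] at hv hw
      have hz := eq_neg_of_add_eq_zero_right hv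
      have hz' := eq_neg_of_add_eq_zero_right hw
      rw [HermData.inner_apply, mcE_quotientProj, mcE_quotientProj, hq3, stdData_q, hz, hz']
      simp [stdForm, dotProduct, Fin.sum_univ_three]
      ring

theorem existsUnique_ledgerObata
    {q : TangentSpace (𝓡 3) (1 : S3) →L[ℝ] TangentSpace (𝓡 3) (1 : S3) →L[ℝ] ℝ}
    (h : IsAdInvariantInner q) : ∃! S : AlmostHermitian I2 (S3 × S3), IsLedgerObata q S := by
  obtain ⟨t, ht, hq⟩ := h.exists_eq
  refine ⟨_, (isLedgerObata_iff ht hq _).2 rfl, fun S hS ↦ ?_⟩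
  obtain ⟨D, rfl⟩ := (isLeftInvariant_of_groupAct hS.invariant).exists_data
  rw [(isLedgerObata_iff ht hq D).1 hS]

theorem IsLedgerObata.isNearlyKahler
    {q : TangentSpace (𝓡 3) (1 : S3) →L[ℝ] TangentSpace (𝓡 3) (1 : S3) →L[ℝ] ℝ}
    (h : IsAdInvariantInner q) {S : AlmostHermitian I2 (S3 × S3)} (hS : IsLedgerObata q S) :
    S.IsLeftInvariant ∧ S.IsNearlyKahler := by
  obtain ⟨t, ht, hq⟩ := h.exists_eq
  have hL := isLeftInvariant_of_groupAct hS.invariant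
  refine ⟨hL, ?_⟩
  obtain ⟨D, rfl⟩ := hL.exists_data
  rw [D.isNearlyKahler_iff, (isLedgerObata_iff ht hq D).1 hS]
  exact stdData_isNK _ _ _ _

/-- Conjugation by `a⁻¹` followed by conjugation by `b` passes through the normal forms, which
differ only in their two parameters. -/
theorem relates_of_pullAd_eq {D D' : HermData} {a b : S3 × S3} {k s k' s' : ℝ} {hk : 0 < k}
    {hs : s ^ 2 = 1 / 3} {hk' : 0 < k'} {hs' : s' ^ 2 = 1 / 3}
    (h : D.pullAd a = stdData k s hk hs) (h' : D'.pullAd b = stdData k' s' hk' hs') :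
    Relates (fun p ↦ (b * a⁻¹) * p * (b * a⁻¹)⁻¹) (k' / k) (s' / s) D.toAlmostHermitian
      D'.toAlmostHermitian := by
  have hs0 : s ≠ 0 := by
    rintro rfl
    norm_num at hs
  rw [relates_conj]
  intro u v
  rw [Ad2_mul, Ad2_mul, Ad2_mul, ← D'.pullAd_q, ← D'.Ad2_pullAd_j, h', stdData_q, stdData_j]
  constructor
  · have h1 : D.q u v = k * stdForm (Ad2 a⁻¹ u) (Ad2 a⁻¹ v) := by
      rw [← stdData_q k s hk hs, ← h, D.pullAd_q, Ad2_Ad2_inv, Ad2_Ad2_inv]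
    rw [h1]
    field_simp
  · have h1 : D.j u = Ad2 a (s • stdJ (Ad2 a⁻¹ u)) := by
      rw [← stdData_j k s hk hs, ← h, D.Ad2_pullAd_j, Ad2_Ad2_inv]
    rw [h1, Ad2_inv_Ad2]
    simp only [map_smul, smul_smul, div_mul_cancel₀ _ hs0]

theorem div_eq_one_or {s s' : ℝ} (hs : s ^ 2 = 1 / 3) (hs' : s' ^ 2 = 1 / 3) :
    s' / s = 1 ∨ s' / s = -1 := by
  refine mul_self_eq_one_iff.1 ?_
  rw [← sq, div_pow, hs, hs']
  norm_num

theorem exists_relates {S S' : AlmostHermitian I2 (S3 × S3)} (hS : S.IsLeftInvariant)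
    (hS' : S.IsNearlyKahler) (hT : S'.IsLeftInvariant) (hT' : S'.IsNearlyKahler) :
    ∃ (a : S3 × S3) (c ε : ℝ), 0 < c ∧ (ε = 1 ∨ ε = -1) ∧
      Relates (fun p ↦ a * p * a⁻¹) c ε S S' := by
  obtain ⟨D, rfl⟩ := hS.exists_data
  obtain ⟨D', rfl⟩ := hT.exists_data
  obtain ⟨a, k, s, hk, hs, h⟩ := (D.isNearlyKahler_iff.1 hS').exists_pullAd_eq
  obtain ⟨b, k', s', hk', hs', h'⟩ := (D'.isNearlyKahler_iff.1 hT').exists_pullAd_eq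
  exact ⟨b * a⁻¹, k' / k, s' / s, div_pos hk' hk, div_eq_one_or hs hs', relates_of_pullAd_eq h h'⟩

theorem HermData.pullAd_one (D : HermData) : D.pullAd 1 = D := by
  have h1 : ∀ u, Ad2 1 u = u := fun u ↦ Prod.ext (Ad_one _) (Ad_one _)
  refine HermData.ext ?_ ?_
  · refine ContinuousLinearMap.ext fun u ↦ ContinuousLinearMap.ext fun v ↦ ?_
    rw [D.pullAd_q, h1, h1]
  · refine ContinuousLinearMap.ext fun u ↦ ?_
    rw [← h1 ((D.pullAd 1).j u), D.Ad2_pullAd_j, h1]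

theorem exists_ledgerObata_relates {S : AlmostHermitian I2 (S3 × S3)} (hS : S.IsLeftInvariant)
    (hS' : S.IsNearlyKahler) :
    ∃ q, IsAdInvariantInner q ∧ ∃ S₀ : AlmostHermitian I2 (S3 × S3), IsLedgerObata q S₀ ∧
      ∃ (a : S3 × S3) (ε : ℝ), (ε = 1 ∨ ε = -1) ∧ Relates (fun p ↦ a * p * a⁻¹) 1 ε S S₀ := by
  obtain ⟨D, rfl⟩ := hS.exists_data
  obtain ⟨a, k, s, hk, hs, h⟩ := (D.isNearlyKahler_iff.1 hS').exists_pullAd_eq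
  -- Chosen so that the scale `2/3 * t` of the Ledger–Obata structure equals `k`.
  have ht : 0 < 3 / 2 * k := by positivity
  obtain ⟨q, hq⟩ := exists_form_eq (3 / 2 * k)
  have h' := HermData.pullAd_one (stdData (2 / 3 * (3 / 2 * k)) (1 / √3) (by positivity)
    inv_sqrt_three_sq)
  have hr := relates_of_pullAd_eq h h'
  rw [show 2 / 3 * (3 / 2 * k) / k = 1 by field_simp] at hr
  exact ⟨q, isAdInvariantInner_of_eq ht hq, _, (isLedgerObata_iff ht hq _).2 rfl, _, _,
    div_eq_one_or hs inv_sqrt_three_sq, hr⟩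

end LedgerObata

/-! ### Cyclic co-frames and the Kähler form -/

section Coframe

open Matrix VectorField

/-- The form `e i` of the co-frame given by `g`. -/
def coE (g : S3) (i : Fin 3) (p : S3 × S3) : TangentSpace I2 p →L[ℝ] ℝ :=
  -- The minus sign is needed because `dα(X, Y) = -α([X, Y])` for invariant forms, while the
  -- structure equations carry a plus sign.
  -((dotL (Ad g (Pi.single i 1))).comp ((ContinuousLinearMap.snd ℝ R3 R3).comp (mcMap p)))

/-- The form `f i` of the co-frame given by `g`. -/
def coF (g : S3) (i : Fin 3) (p : S3 × S3) : TangentSpace I2 p →L[ℝ] ℝ :=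
  -((dotL (Ad g (Pi.single i 1))).comp ((ContinuousLinearMap.fst ℝ R3 R3).comp (mcMap p)))

theorem coE_apply (g : S3) (i : Fin 3) (p : S3 × S3) (u : TangentSpace I2 p) :
    coE g i p u = -(Ad g (Pi.single i 1) ⬝ᵥ (mcE p u).2) := rfl

theorem coF_apply (g : S3) (i : Fin 3) (p : S3 × S3) (u : TangentSpace I2 p) :
    coF g i p u = -(Ad g (Pi.single i 1) ⬝ᵥ (mcE p u).1) := rfl

theorem mvfderiv_form (L : R33 →L[ℝ] ℝ) {F : S3 × S3 → R33} {x : S3 × S3}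
    (hF : MDifferentiableAt I2 𝓘(ℝ, R33) F x) (v : TangentSpace I2 x) :
    mvfderiv I2 (fun p ↦ L (F p)) x v = L (mvfderiv I2 F x v) := by
  have h := L.hasMFDerivAt.comp x hF.hasMFDerivAt
  exact congrArg (fun T ↦ T v) h.mfderiv

/-- The exterior derivative of left-invariant forms. -/
theorem extDerivOneForm_eq (L : R33 →L[ℝ] ℝ) (α : ∀ p : S3 × S3, TangentSpace I2 p →L[ℝ] ℝ)
    (hα : ∀ p u, α p u = L (mcE p u)) {X Y : ∀ p : S3 × S3, TangentSpace I2 p}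
    (hX : IsSmoothField X) (hY : IsSmoothField Y) (p : S3 × S3) :
    extDerivOneForm α X Y p = -L (brk (mcE p (X p)) (mcE p (Y p))) := by
  unfold extDerivOneForm
  simp only [hα]
  rw [mvfderiv_form L (mdifferentiableAt_mcE (hX.diffFieldAt p)),
    mvfderiv_form L (mdifferentiableAt_mcE (hY.diffFieldAt p)),
    mcE_mlieBracket (hX.diffFieldAt p) (hY.diffFieldAt p), map_add, map_sub]
  ring

theorem mfderiv_fst_eq_zero_iff (p : S3 × S3) (u : TangentSpace I2 p) :
    mfderiv I2 (𝓡 3) Prod.fst p u = 0 ↔ (mcE p u).1 = 0 := by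
  change _ ↔ mc p.1 (mfderiv I2 (𝓡 3) Prod.fst p u) = 0
  rw [← mcL_apply]
  exact ((mcL p.1).map_eq_zero_iff).symm

theorem mfderiv_snd_eq_zero_iff (p : S3 × S3) (u : TangentSpace I2 p) :
    mfderiv I2 (𝓡 3) Prod.snd p u = 0 ↔ (mcE p u).2 = 0 := by
  change _ ↔ mc p.2 (mfderiv I2 (𝓡 3) Prod.snd p u) = 0
  rw [← mcL_apply]
  exact ((mcL p.2).map_eq_zero_iff).symm

theorem Ad_dot_left (g : S3) (x y : R3) : Ad g x ⬝ᵥ y = x ⬝ᵥ Ad g⁻¹ y := by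
  rw [← Ad_dot g x, Ad_Ad_inv]

theorem frame_cross (g : S3) (i : Fin 3) (x y : R3) :
    Ad g (Pi.single i 1) ⬝ᵥ (x ⨯₃ y) =
      (Ad g (Pi.single (i + 1) 1) ⬝ᵥ x) * (Ad g (Pi.single (i + 2) 1) ⬝ᵥ y) -
        (Ad g (Pi.single (i + 1) 1) ⬝ᵥ y) * (Ad g (Pi.single (i + 2) 1) ⬝ᵥ x) := by
  simp only [Ad_dot_left, Ad_cross, single_one_dotProduct]
  fin_cases i <;> simp [cross_apply] <;> ring

theorem isCyclicCoframe_co (a : S3 × S3) : IsCyclicCoframe (coE a.2) (coF a.1) where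
  coframe p := by
    rw [Fintype.linearIndependent_iff]
    intro c hc
    have hval : ∀ u : R33, -(∑ i, c (Sum.inl i) * Ad a.2⁻¹ u.2 i) -
        ∑ i, c (Sum.inr i) * Ad a.1⁻¹ u.1 i = 0 := by
      intro u
      have h := congrArg (fun T : TangentSpace I2 p →L[ℝ] ℝ ↦ T (inv u p)) hc
      simp only [Fintype.sum_sum_type, Sum.elim_inl, Sum.elim_inr, _root_.add_apply,
        _root_.sum_apply, _root_.smul_apply, coE_apply, coF_apply, mcE_inv, Ad_dot_left,
        single_one_dotProduct, smul_eq_mul, _root_.zero_apply] at h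
      rw [← h, sub_eq_add_neg, ← Finset.sum_neg_distrib, ← Finset.sum_neg_distrib]
      simp
    rintro (k | k)
    · have h := hval (0, Ad a.2 (Pi.single k 1))
      simpa [Pi.single_apply] using h
    · have h := hval (Ad a.1 (Pi.single k 1), 0)
      simpa [Pi.single_apply] using h
  invariant_e i b p u := by
    rw [coE_apply, coE_apply, mcE_mul_left]
  invariant_f i b p u := by
    rw [coF_apply, coF_apply, mcE_mul_left]
  vanish_e i p u h := by
    rw [coE_apply, (mfderiv_snd_eq_zero_iff p u).1 h, dotProduct_zero, neg_zero]
  vanish_f i p u h := by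
    rw [coF_apply, (mfderiv_fst_eq_zero_iff p u).1 h, dotProduct_zero, neg_zero]
  deriv_e i X Y hX hY p := by
    rw [extDerivOneForm_eq (-((dotL (Ad a.2 (Pi.single i 1))).comp (ContinuousLinearMap.snd ℝ R3 R3)))
      (coE a.2 i) (fun p u ↦ rfl) hX hY]
    simp only [wedge, coE_apply]
    change - -(Ad a.2 (Pi.single i 1) ⬝ᵥ ((mcE p (X p)).2 ⨯₃ (mcE p (Y p)).2)) = _
    rw [frame_cross]
    ring
  deriv_f i X Y hX hY p := by
    rw [extDerivOneForm_eq (-((dotL (Ad a.1 (Pi.single i 1))).comp (ContinuousLinearMap.fst ℝ R3 R3)))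
      (coF a.1 i) (fun p u ↦ rfl) hX hY]
    simp only [wedge, coF_apply]
    change - -(Ad a.1 (Pi.single i 1) ⬝ᵥ ((mcE p (X p)).1 ⨯₃ (mcE p (Y p)).1)) = _
    rw [frame_cross]
    ring

theorem invariant_form_eq {α : ∀ p : S3 × S3, TangentSpace I2 p →L[ℝ] ℝ}
    (h : ∀ (a p : S3 × S3) (u : TangentSpace I2 p),
      α (a * p) (mfderiv I2 I2 (fun q ↦ a * q) p u) = α p u) (p : S3 × S3) (u : TangentSpace I2 p) :
    α p u = α 1 (inv (mcE p u) 1) := by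
  have key : ∀ (p p' : S3 × S3) (w : R33), p' = p * 1 → α p' (inv w p') = α 1 (inv w 1) := by
    rintro p _ w rfl
    rw [← h p 1 (inv w 1)]
    congr 1
    refine (mcE (p * 1)).injective ?_
    rw [mcE_mul_left, mcE_inv, mcE_inv]
  rw [← key p p _ (mul_one p).symm, inv_mcE]

theorem eq_of_forall_dot_cross {x y : R3} (h : ∀ v w : R3, x ⬝ᵥ (v ⨯₃ w) = y ⬝ᵥ (v ⨯₃ w)) :
    x = y := by
  have h0 := h (Pi.single 1 1) (Pi.single 2 1)
  have h1 := h (Pi.single 2 1) (Pi.single 0 1)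
  have h2 := h (Pi.single 0 1) (Pi.single 1 1)
  simp [cross_apply, dotProduct, Fin.sum_univ_three] at h0 h1 h2
  ext i
  fin_cases i
  exacts [h0, h1, h2]

/-- Forms on one factor satisfying the structure equations come from a rotation. -/
theorem exists_Ad_of_structure (A : Fin 3 → R3) (hne : A 0 ≠ 0)
    (h : ∀ (i : Fin 3) (v w : R3), -(A i ⬝ᵥ (v ⨯₃ w)) =
      (A (i + 1) ⬝ᵥ v) * (A (i + 2) ⬝ᵥ w) - (A (i + 1) ⬝ᵥ w) * (A (i + 2) ⬝ᵥ v)) :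
    ∃ g : S3, ∀ i, A i = -Ad g (Pi.single i 1) := by
  have hA : ∀ i, (-A (i + 1)) ⨯₃ (-A (i + 2)) = -A i := by
    intro i
    refine eq_of_forall_dot_cross fun v w ↦ ?_
    rw [cross_dot_cross, neg_dotProduct (A i), h i v w]
    simp only [neg_dotProduct]
    ring
  -- The indices are modulo 3: `hA 2` is the relation for the vectors 0 and 1.
  have hf : IsFrame (-A) := ⟨hA 2, hA 0, hA 1, by simpa using hne⟩
  obtain ⟨g, hg⟩ := exists_Ad_frame hf
  refine ⟨g, fun i ↦ ?_⟩
  rw [hg, Pi.neg_apply, neg_neg]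

theorem IsCyclicCoframe.exists_eq {e f : Fin 3 → ∀ p : S3 × S3, TangentSpace I2 p →L[ℝ] ℝ}
    (h : IsCyclicCoframe e f) : ∃ a : S3 × S3, e = coE a.2 ∧ f = coF a.1 := by
  have he : ∀ i p u, e i p u = e i 1 (inv (mcE p u) 1) := fun i ↦ invariant_form_eq (h.invariant_e i)
  have hf : ∀ i p u, f i p u = f i 1 (inv (mcE p u) 1) := fun i ↦ invariant_form_eq (h.invariant_f i)
  let ι : R33 →L[ℝ] TangentSpace I2 (1 : S3 × S3) := ((mcE 1).symm : R33 →L[ℝ] _)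
  let α : Fin 3 → R33 →L[ℝ] ℝ := fun i ↦ (e i 1).comp ι
  let β : Fin 3 → R33 →L[ℝ] ℝ := fun i ↦ (f i 1).comp ι
  have heα : ∀ i p u, e i p u = α i (mcE p u) := he
  have hfβ : ∀ i p u, f i p u = β i (mcE p u) := hf
  let A : Fin 3 → R3 := fun i k ↦ α i (ff k)
  let B : Fin 3 → R3 := fun i k ↦ β i (ee k)
  have hα0 : ∀ i k, α i (ee k) = 0 := fun i k ↦
    h.vanish_e i 1 (inv (ee k) 1) ((mfderiv_snd_eq_zero_iff _ _).2 (by rw [mcE_inv]; rfl))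
  have hβ0 : ∀ i k, β i (ff k) = 0 := fun i k ↦
    h.vanish_f i 1 (inv (ff k) 1) ((mfderiv_fst_eq_zero_iff _ _).2 (by rw [mcE_inv]; rfl))
  have hα : ∀ i w, α i w = A i ⬝ᵥ w.2 := by
    intro i w
    conv_lhs => rw [eq_sum_ee_ff w]
    simp only [map_add, map_smul, hα0, smul_eq_mul, dotProduct, Fin.sum_univ_three, A]
    ring
  have hβ : ∀ i w, β i w = B i ⬝ᵥ w.1 := by
    intro i w
    conv_lhs => rw [eq_sum_ee_ff w]
    simp only [map_add, map_smul, hβ0, smul_eq_mul, dotProduct, Fin.sum_univ_three, B]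
    ring
  have hA0 : A 0 ≠ 0 := by
    intro h0
    refine (h.coframe 1).ne_zero (Sum.inl 0) (ContinuousLinearMap.ext fun u ↦ ?_)
    rw [Sum.elim_inl, heα, hα, h0, zero_dotProduct]
    rfl
  have hB0 : B 0 ≠ 0 := by
    intro h0
    refine (h.coframe 1).ne_zero (Sum.inr 0) (ContinuousLinearMap.ext fun u ↦ ?_)
    rw [Sum.elim_inr, hfβ, hβ, h0, zero_dotProduct]
    rfl
  obtain ⟨g, hg⟩ := exists_Ad_of_structure A hA0 fun i v w ↦ by
    -- Left-invariant fields tangent to the second factor turn the structure equations into the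
    -- algebraic ones.
    have h1 := h.deriv_e i (inv (0, v)) (inv (0, w)) (isSmoothField_inv _) (isSmoothField_inv _) 1
    rw [extDerivOneForm_eq (α i) (e i) (heα i) (isSmoothField_inv _) (isSmoothField_inv _)] at h1
    simpa only [wedge, heα, mcE_inv, hα, brk] using h1
  obtain ⟨g', hg'⟩ := exists_Ad_of_structure B hB0 fun i v w ↦ by
    have h1 := h.deriv_f i (inv (v, 0)) (inv (w, 0)) (isSmoothField_inv _) (isSmoothField_inv _) 1
    rw [extDerivOneForm_eq (β i) (f i) (hfβ i) (isSmoothField_inv _) (isSmoothField_inv _)] at h1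
    simpa only [wedge, hfβ, mcE_inv, hβ, brk] using h1
  refine ⟨(g', g), ?_, ?_⟩
  · funext i p
    refine ContinuousLinearMap.ext fun u ↦ ?_
    rw [heα, hα, hg, coE_apply, neg_dotProduct]
  · funext i p
    refine ContinuousLinearMap.ext fun u ↦ ?_
    rw [hfβ, hβ, hg', coF_apply, neg_dotProduct]

theorem HermData.kahlerForm_eq (D : HermData) (p : S3 × S3) (u v : TangentSpace I2 p) :
    D.toAlmostHermitian.kahlerForm p u v = D.om (mcE p u) (mcE p v) := by
  rw [AlmostHermitian.kahlerForm, D.inner_apply, D.mcE_J]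
  rfl

/-- Rotating by `a⁻¹` turns the co-frame into minus the standard coordinates, and these two signs
cancel in the wedge products. The sign `-c` remains because the `e i` live on the second factor and
the `f i` on the first. -/
theorem hasDiagonalKahlerForm_iff (D : HermData) (a : S3 × S3) (c : ℝ) :
    HasDiagonalKahlerForm D.toAlmostHermitian (coE a.2) (coF a.1) c ↔
      ∀ u v, (D.pullAd a).om u v = -c * (u.1 ⬝ᵥ v.2 - u.2 ⬝ᵥ v.1) := by
  have hw : ∀ (p : S3 × S3) (u v : TangentSpace I2 p),
      c * ∑ i, wedge (coE a.2 i p) (coF a.1 i p) u v =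
        -c * ((Ad2 a⁻¹ (mcE p u)).1 ⬝ᵥ (Ad2 a⁻¹ (mcE p v)).2 -
          (Ad2 a⁻¹ (mcE p u)).2 ⬝ᵥ (Ad2 a⁻¹ (mcE p v)).1) := by
    intro p u v
    simp only [wedge, coE_apply, coF_apply, Ad_dot_left, single_one_dotProduct]
    simp only [Ad2_apply, Prod.fst_inv, Prod.snd_inv, dotProduct, Fin.sum_univ_three]
    ring
  constructor
  · intro h u v
    have h1 := h 1 (inv (Ad2 a u) 1) (inv (Ad2 a v) 1)
    rw [D.kahlerForm_eq, hw, mcE_inv, mcE_inv, Ad2_inv_Ad2, Ad2_inv_Ad2] at h1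
    rw [D.pullAd_om, h1]
  · intro h p u v
    rw [D.kahlerForm_eq, hw, ← h, D.pullAd_om, Ad2_Ad2_inv, Ad2_Ad2_inv]

theorem exists_coframe {S : AlmostHermitian I2 (S3 × S3)} (hS : S.IsLeftInvariant)
    (hS' : S.IsNearlyKahler) :
    ∃ e f, IsCyclicCoframe e f ∧ ∃ l ε : ℝ, 0 < l ∧ (ε = 1 ∨ ε = -1) ∧
      HasDiagonalKahlerForm S e f (ε * l) := by
  obtain ⟨D, rfl⟩ := hS.exists_data
  obtain ⟨a, k, s, hk, hs, h⟩ := (D.isNearlyKahler_iff.1 hS').exists_pullAd_eq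
  refine ⟨coE a.2, coF a.1, isCyclicCoframe_co a, ?_⟩
  have hform : HasDiagonalKahlerForm D.toAlmostHermitian (coE a.2) (coF a.1) (3 / 2 * (k * s)) := by
    rw [hasDiagonalKahlerForm_iff, h]
    exact stdData_om k s hk hs
  have hs0 : s ≠ 0 := by
    rintro rfl
    norm_num at hs
  rcases lt_or_gt_of_ne hs0 with hneg | hpos
  · refine ⟨3 / 2 * (k * -s), -1, by have := neg_pos.2 hneg; positivity, Or.inr rfl, ?_⟩
    rwa [show -1 * (3 / 2 * (k * -s)) = 3 / 2 * (k * s) by ring]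
  · exact ⟨3 / 2 * (k * s), 1, by positivity, Or.inl rfl, by rwa [one_mul]⟩

theorem HermData.pullAd_pullAd_inv (D : HermData) (a : S3 × S3) : (D.pullAd a⁻¹).pullAd a = D := by
  refine HermData.ext ?_ ?_
  · refine ContinuousLinearMap.ext fun u ↦ ContinuousLinearMap.ext fun v ↦ ?_
    rw [pullAd_q, pullAd_q, Ad2_inv_Ad2, Ad2_inv_Ad2]
  · refine ContinuousLinearMap.ext fun u ↦ ?_
    rw [← Ad2_inv_Ad2 a (((D.pullAd a⁻¹).pullAd a).j u), Ad2_pullAd_j, Ad2_pullAd_j, Ad2_inv_Ad2]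

theorem exists_parameters {c : ℝ} (hc : c ≠ 0) :
    ∃ k s : ℝ, 0 < k ∧ s ^ 2 = 1 / 3 ∧ k * s = 2 / 3 * c := by
  have h3 : (√3 : ℝ) ^ 2 = 3 := Real.sq_sqrt (by norm_num)
  have h3' : (√3 : ℝ) ≠ 0 := by positivity
  have hc' : |c| ≠ 0 := abs_ne_zero.2 hc
  -- Since `|s| = 1/√3` and `k > 0`, the modulus of `c` fixes `k` and its sign fixes that of `s`.
  refine ⟨2 / √3 * |c|, c / (√3 * |c|), by positivity, ?_, ?_⟩
  · rw [div_pow, mul_pow, h3, sq_abs]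
    field_simp
  · field_simp
    rw [h3]

theorem parameters_unique {k s k' s' : ℝ} (hk : 0 < k) (hs : s ^ 2 = 1 / 3) (hk' : 0 < k')
    (hs' : s' ^ 2 = 1 / 3) (h : k * s = k' * s') : k = k' ∧ s = s' := by
  have h1 : k ^ 2 = k' ^ 2 := by
    have h2 := congrArg (· ^ 2) h
    simp only [mul_pow, hs, hs'] at h2
    linarith
  have hkk : k = k' := (pow_left_inj₀ hk.le hk'.le two_ne_zero).1 h1
  subst hkk
  exact ⟨rfl, mul_left_cancel₀ hk.ne' h⟩

theorem existsUnique_of_coframe {e f : Fin 3 → ∀ p : S3 × S3, TangentSpace I2 p →L[ℝ] ℝ}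
    (h : IsCyclicCoframe e f) {c : ℝ} (hc : c ≠ 0) :
    ∃! S : AlmostHermitian I2 (S3 × S3),
      S.IsLeftInvariant ∧ S.IsNearlyKahler ∧ HasDiagonalKahlerForm S e f c := by
  obtain ⟨a, rfl, rfl⟩ := h.exists_eq
  -- the Kähler form determines the parameters
  have hstd : ∀ D : HermData, D.IsNK →
      HasDiagonalKahlerForm D.toAlmostHermitian (coE a.2) (coF a.1) c →
      ∃ k s hk hs, D.pullAd a = stdData k s hk hs ∧ k * s = 2 / 3 * c := by
    intro D hD hform
    rw [hasDiagonalKahlerForm_iff] at hform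
    -- The form is already diagonal with equal nonzero entries, so no singular value decomposition
    -- is needed and the given co-frame is kept.
    have hdiag : (D.pullAd a).IsDiag fun _ ↦ -c := by
      intro i j
      rw [hform]
      simp [ee, ff, Pi.single_apply, eq_comm]
    obtain ⟨k, s, hk, hs, hD'⟩ := (hD.pullAd a).eq_std_of_isDiag hdiag (fun _ ↦ neg_ne_zero.2 hc)
      fun _ _ ↦ mul_self_nonneg _
    refine ⟨k, s, hk, hs, hD', ?_⟩
    have h1 := hform (ee 0) (ff 0)
    rw [hD', stdData_om] at h1
    simp [ee, ff] at h1
    linarith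
  obtain ⟨k₀, s₀, hk₀, hs₀, hks₀⟩ := exists_parameters hc
  refine ⟨((stdData k₀ s₀ hk₀ hs₀).pullAd a⁻¹).toAlmostHermitian,
    ⟨HermData.isLeftInvariant _, ?_, ?_⟩, ?_⟩
  · rw [HermData.isNearlyKahler_iff]
    exact (stdData_isNK _ _ _ _).pullAd _
  · rw [hasDiagonalKahlerForm_iff, HermData.pullAd_pullAd_inv]
    intro u v
    rw [stdData_om, hks₀]
    ring
  · rintro S ⟨hS1, hS2, hS3⟩
    obtain ⟨D, rfl⟩ := hS1.exists_data
    obtain ⟨k, s, hk, hs, hD, hks⟩ := hstd D (D.isNearlyKahler_iff.1 hS2) hS3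
    obtain ⟨rfl, rfl⟩ := parameters_unique hk hs hk₀ hs₀ (hks.trans hks₀.symm)
    rw [← hD]
    congr 1
    have h1 := D.pullAd_pullAd_inv a⁻¹
    rw [inv_inv] at h1
    exact h1.symm

end Coframe

end NearlyKahler

end

/-! ### The main theorem. -/

open NearlyKahler in
theorem mainTheorem4 :
    -- the Ledger-Obata structures exist, are determined by `q`, are left-invariant nearly Kähler
    (∃ q, IsAdInvariantInner q) ∧
    (∀ q, IsAdInvariantInner q → ∃! S : AlmostHermitian I2 (S3 × S3), IsLedgerObata q S) ∧
    (∀ q, IsAdInvariantInner q → ∀ S : AlmostHermitian I2 (S3 × S3), IsLedgerObata q S →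
      S.IsLeftInvariant ∧ S.IsNearlyKahler) ∧
    -- uniqueness up to homothety, sign and conjugation
    (∀ S S' : AlmostHermitian I2 (S3 × S3),
      S.IsLeftInvariant → S.IsNearlyKahler → S'.IsLeftInvariant → S'.IsNearlyKahler →
      ∃ (a : S3 × S3) (c ε : ℝ), 0 < c ∧ (ε = 1 ∨ ε = -1) ∧
        Relates (fun p ↦ a * p * a⁻¹) c ε S S') ∧
    -- every left-invariant nearly Kähler structure is a Ledger-Obata structure
    (∀ S : AlmostHermitian I2 (S3 × S3), S.IsLeftInvariant → S.IsNearlyKahler →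
      ∃ q, IsAdInvariantInner q ∧ ∃ S₀ : AlmostHermitian I2 (S3 × S3), IsLedgerObata q S₀ ∧
        ∃ (a : S3 × S3) (ε : ℝ), (ε = 1 ∨ ε = -1) ∧
          Relates (fun p ↦ a * p * a⁻¹) 1 ε S S₀) ∧
    -- the Kähler form in a cyclic co-frame
    (∀ S : AlmostHermitian I2 (S3 × S3), S.IsLeftInvariant → S.IsNearlyKahler →
      ∃ e f, IsCyclicCoframe e f ∧ ∃ l ε : ℝ, 0 < l ∧ (ε = 1 ∨ ε = -1) ∧
        HasDiagonalKahlerForm S e f (ε * l)) ∧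
    (∀ e f, IsCyclicCoframe e f → ∀ c : ℝ, c ≠ 0 →
      ∃! S : AlmostHermitian I2 (S3 × S3),
        S.IsLeftInvariant ∧ S.IsNearlyKahler ∧ HasDiagonalKahlerForm S e f c) := by
  refine ⟨?_, fun q hq ↦ existsUnique_ledgerObata hq, fun q hq S hS ↦ hS.isNearlyKahler hq,
    fun S S' hS hS' hT hT' ↦ exists_relates hS hS' hT hT',
    fun S hS hS' ↦ exists_ledgerObata_relates hS hS', fun S hS hS' ↦ exists_coframe hS hS',
    fun e f h c hc ↦ existsUnique_of_coframe h hc⟩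
  obtain ⟨q, hq⟩ := exists_form_eq 1
  exact ⟨q, isAdInvariantInner_of_eq one_pos hq⟩
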